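/- **Setting.** Let $m,n,p\ge 1$ and, for $i=1,\dots,m$, let $f_i,g_i:\mathbb R^n\times\mathbb R^p\to\mathbb R$. Put $\theta_i^*(x)=\arg\min_\theta g_i(x,\theta)$, $\Phi_i(x)=f_i(x,\theta_i^*(x))$, $\Phi=\frac1m\sum_i\Phi_i$ and $v_i^*(x)=[\nabla^2_{\theta\theta}g_i(x,\theta_i^*(x))]^{-1}\nabla_\theta f_i(x,\theta_i^*(x))$. All norms are Euclidean or spectral norms. Let $L_{f,x},L_{f,\theta},L_{g,\theta},L_{g,x\theta},L_{g,\theta\theta},C_{f,\theta},C_{g,x\theta},\mu_g>0$ and $\kappa=\max\{L_{f,x},L_{f,\theta},L_{g,\theta},L_{g,x\theta},L_{g,\theta\theta}\}/\mu_g$. Assume: 1. (Network) $W=(w_{ij})\in\mathbb R^{m\times m}$ is symmetric, nonnegative and doubly stochastic, for $i\ne j$ one has $w_{ij}>0$ exactly when $ij$ is an edge of a connected graph on $\{1,\dots,m\}$, and $\rho:=\|W-\frac1m\mathbf 1\mathbf 1^{T}\|^2<1$. 2. (Outer level) $f_i$ is $C^1$; $\nabla_xf_i$ and $\nabla_\theta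 f_i$ are Lipschitz in $(x,\theta)$ with constants $L_{f,x}$ and $L_{f,\theta}$; $\|\nabla_\theta f_i(x,\theta_i^*(x))\|\le C_{f,\theta}$ for all $x$. 3. (Inner level) $g_i$ is $C^2$; $g_i(x,\cdot)$ is $\mu_g$-strongly convex and $\nabla_\theta g_i(x,\cdot)$ is $L_{g,\theta}$-Lipschitz for every $x$; $\nabla^2_{x\theta}g_i$ and $\nabla^2_{\theta\theta}g_i$ are Lipschitz in $(x,\theta)$ with constants $L_{g,x\theta}$ and $L_{g,\theta\theta}$; $\|\nabla^2_{x\theta}g_i\|\le C_{g,x\theta}$. 4. (Heterogeneity) For some $b_f,b_g>0$ and all $x,\theta$: $\sum_i\|\nabla_xf_i(x,\theta)-\frac1m\sum_j\nabla_xf_j(x,\theta)\|^2\le b_f^2$, and the same with $\nabla_\theta$; and, for $D$ each of $\nabla_\theta,\nabla^2_{x\theta},\nabla^2_{\theta\theta}$, $\frac1m\sum_i\sum_j\|Dg_i(x,\theta_j^*(x))-Dg_j(x,\theta_j^*(x))\|^2\le b_g^2$. 5. (Lower bound) $\Phi\ge\ell$ on $\mathbb R^n$ for some $\ell\in\mathbb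 R$. **Algorithm (LoPA-LG, exact derivatives).** From $x_i^0,\theta_i^0,v_i^0,z_i^0$, with $y_i^k=z_i^k$, iterate $$x_i^{k+1}=(1-\tau)x_i^k+\tau\Big(\sum_jw_{ij}x_j^k-\alpha y_i^k\Big),\quad \theta_i^{k+1}=\theta_i^k-\beta\nabla_\theta g_i,\quad v_i^{k+1}=v_i^k-\lambda\big(\nabla^2_{\theta\theta}g_i\,v_i^k-\nabla_\theta f_i\big),$$ $$s_i^k=\nabla_xf_i-\nabla^2_{x\theta}g_i\,v_i^k,\qquad z_i^{k+1}=s_i^k+(1-\gamma)(z_i^k-s_i^k),$$ where the derivatives are taken at $(x_i^k,\theta_i^k)$. Write $\bar x^k=\frac1m\sum_ix_i^k$ and $\bar z^k=\frac1m\sum_iz_i^k$. **Constants.** $L_{\theta^*}=\frac{C_{g,x\theta}}{\mu_g}$, $L_v=\frac{L_{f,\theta}}{\mu_g}+\frac{C_{f,\theta}L_{g,\theta\theta}}{\mu_g^2}$, $L_{v^*}=L_v(1+L_{\theta^*})$, $L=\big(L_{f,x}+C_{g,x\theta}L_v+\frac{C_{f,\theta}L_{g,x\theta}}{\mu_g}\big)(1+L_{\theta^*})$,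 $M=\frac{C_{f,\theta}}{\mu_g}$, $L_{fg,x}=2L_{f,x}^2+4M^2L_{g,x\theta}^2$, $L_{fg,\theta}=2L_{f,\theta}^2+4M^2L_{g,\theta\theta}^2$, $\omega=\frac{\mu_gL_{g,\theta}}{2(\mu_g+L_{g,\theta})}$, $A=L_{fg,x}+\frac{32C_{g,x\theta}^2L_{fg,\theta}}{\mu_g^2}$, $\varphi=A\big(1+\frac{4\max\{L_{g,\theta},C_{g,x\theta}\}^2}{\omega^2}\big)$, and $b^2=C_1b_f^2+C_2b_g^2$ ($b>0$) with $C_1=4+\frac{4C_{g,x\theta}^2}{\mu_g^2}$ and $$C_2=4\Big(\tfrac{4C_{f,\theta}^2C_{g,x\theta}^2}{\mu_g^4}+\tfrac{4C_{f,\theta}^2}{\mu_g^2}+\tfrac{L_{f,x}^2}{\mu_g^2}+\tfrac{L_{f,\theta}^2C_{g,x\theta}^2}{\mu_g^4}+\tfrac{4C_{f,\theta}^2C_{g,x\theta}^2L_{g,\theta\theta}^2}{\mu_g^6}+\tfrac{4C_{f,\theta}^2L_{g,x\theta}^2}{\mu_g^4}\Big).$$ For $\tau,c_\gamma,c_\lambda,c_\beta>0$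 let $u=\min\{u_1,u_2,u_3\}$ with $u_1=\frac1{2\tau L}$, $$u_2=\min\Big\{\tfrac{1-\rho}{12\varphi^{1/2}},\tfrac{(1-\rho)^{2/3}}{4\varphi^{1/3}},\tfrac{A^{1/3}(1-\rho)^{2/3}}{4\varphi^{1/3}},\tfrac{(1-\rho)^{1/2}}{3L_{fg,x}^{1/4}}\Big\},$$ $$u_3=\min\Big\{\tfrac1{96\tau L_{v^*}C_{g,x\theta}},\ \tfrac{\omega\min\{\frac2{\mu_g+L_{g,\theta}},\frac{\mu_g+L_{g,\theta}}{2\mu_gL_{g,\theta}}\}}{12\tau A^{1/2}L_{\theta^*}},\ \tfrac1{8L\tau}\Big\};$$ $\vartheta=\frac{24\varphi}{(1-\rho)^2c_\gamma}$, $a_2=\frac{4\vartheta}{m}b^2$ and $a_0=4\hat V^0$, where $$\tau\hat V^0=\Phi(\bar x^0)-\ell+\tfrac{8C_{g,x\theta}^2\tau}{\mu_gc_\lambda}\tfrac1m\sum_i\|v_i^0-v_i^*(\bar x^0)\|^2+\tfrac{A\tau}{\omega c_\beta}\tfrac1m\sum_i\|\theta_i^0-\theta_i^*(\bar x^0)\|^2+\tfrac{\tau}{2c_\gamma}\|\nabla\Phi(\bar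 x^0)-\bar z^0\|^2$$ $$\qquad+\tfrac{24\varphi\tau u^3}{(1-\rho)^2c_\gamma}\tfrac1m\sum_i\|\nabla\Phi_i(\bar x^0)-z_i^0\|^2+\tfrac{2\varphi u}{1-\rho}\tfrac1m\sum_i\|x_i^0-\bar x^0\|^2 .$$ **Claim.** There are $c_\gamma,c_\lambda,c_\beta,\tau_0>0$ depending only on $L_{f,x},L_{f,\theta},L_{g,\theta},L_{g,x\theta},L_{g,\theta\theta},C_{f,\theta},C_{g,x\theta}$ and, for every $R>0$, a constant $C>0$ depending only on these seven constants and $R$ such that the following holds for all $\mu_g>0$, all $m,n,p$, $W$, $f_i,g_i$, $b_f,b_g,\ell$ as above, all $K\ge1$, and every initialization with $x_1^0=\dots=x_m^0$, $\Phi(\bar x^0)-\ell\le R$, $\frac1m\sum_i\|\theta_i^0-\theta_i^*(\bar x^0)\|^2\le R$, $\frac1m\sum_i\|v_i^0-v_i^*(\bar x^0)\|^2\le R\kappa^2$ and $\frac1m\sum_i\|z_i^0-\nabla\Phi_i(\bar x^0)\|^2\le R\kappa^2$. With $$\tau=\tau_0\kappa^{-4},\qquad \alpha=\min\Big\{u,\Big(\frac{a_0}{a_2(K+1)}\Big)^{1/3}\Big\},\qquad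 \gamma=c_\gamma\alpha,\quad\lambda=c_\lambda\alpha,\quad\beta=c_\beta\alpha,$$ one has $\tau<1$ and $\gamma<1$, $\Phi$ is differentiable, and $$\frac1{K+1}\sum_{k=0}^K\|\nabla\Phi(\bar x^k)\|^2\le C\Big(\frac{\kappa^8}{(1-\rho)K}+\frac{\kappa^{16/3}(b/\sqrt m)^{2/3}}{(1-\rho)^{2/3}K^{2/3}}\Big).$$ -/

import Mathlib

open scoped BigOperators

namespace LoPA

noncomputable section

/-- `ℝᵈ` with the Euclidean norm. -/
abbrev E (d : ℕ) : Type := EuclideanSpace ℝ (Fin d)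

variable {m n p : ℕ}

/-! ### Partial derivatives of a function on `ℝⁿ × ℝᵖ` -/

/-- Partial gradient in `x`. -/
def gradX (f : E n → E p → ℝ) (x : E n) (θ : E p) : E n :=
  gradient (fun x' => f x' θ) x

/-- Partial gradient in `θ`. -/
def gradT (f : E n → E p → ℝ) (x : E n) (θ : E p) : E p :=
  gradient (fun θ' => f x θ') θ

/-- The `n × p` matrix of mixed second derivatives, as the derivative in `θ` of the partial
gradient in `x`. -/
def jacXT (g : E n → E p → ℝ) (x : E n) (θ : E p) : E p →L[ℝ] E n :=
  fderiv ℝ (fun θ' => gradX g x θ') θ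

/-- The `p × p` Hessian in `θ`. -/
def hessTT (g : E n → E p → ℝ) (x : E n) (θ : E p) : E p →L[ℝ] E p :=
  fderiv ℝ (fun θ' => gradT g x θ') θ

/-! ### The bilevel problem -/

/-- `θ*(x) = argmin_θ g(x, θ)`. -/
def innerSol (g : E n → E p → ℝ) (x : E n) : E p :=
  Classical.epsilon fun θ => ∀ θ', g x θ ≤ g x θ'

/-- `v*(x) = [∇²_θθ g(x, θ*(x))]⁻¹ ∇_θ f(x, θ*(x))`. -/
def vStar (f g : E n → E p → ℝ) (x : E n) : E p :=
  (hessTT g x (innerSol g x)).inverse (gradT f x (innerSol g x))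

/-- The local objective `Φᵢ(x) = fᵢ(x, θᵢ*(x))`. -/
def PhiLoc (f g : E n → E p → ℝ) (x : E n) : ℝ := f x (innerSol g x)

/-- The global objective `Φ = (1/m) ∑ᵢ Φᵢ`. -/
def Phi (f g : Fin m → E n → E p → ℝ) (x : E n) : ℝ :=
  (1 / (m : ℝ)) * ∑ i, PhiLoc (f i) (g i) x

/-- The average of the vectors held by the nodes. -/
def avg {d : ℕ} (x : Fin m → E d) : E d := (1 / (m : ℝ)) • ∑ i, x i

/-! ### The network -/

/-- `ρ = ‖W - 11ᵀ/m‖²` in the spectral norm. -/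
def rho (W : Matrix (Fin m) (Fin m) ℝ) : ℝ :=
  ‖Matrix.toEuclideanCLM (n := Fin m) (𝕜 := ℝ) (W - Matrix.of fun _ _ => 1 / (m : ℝ))‖ ^ 2

/-- A connected undirected network with symmetric doubly stochastic weights supported on its
edges (the diagonal weights are free) and with `ρ < 1`. -/
structure Network (G : SimpleGraph (Fin m)) (W : Matrix (Fin m) (Fin m) ℝ) : Prop where
  connected : G.Connected
  symm : ∀ i j, W i j = W j i
  support : ∀ i j, i ≠ j → (0 < W i j ↔ G.Adj i j)
  stochastic : W ∈ doublyStochastic ℝ (Fin m)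
  rho_lt_one : rho W < 1

/-! ### Regularity of the objectives -/

/-- `F` is `L`-Lipschitz on `ℝⁿ × ℝᵖ` with its Euclidean norm. -/
def JointLip {X : Type*} [NormedAddCommGroup X] (L : ℝ) (F : E n → E p → X) : Prop :=
  ∀ x θ x' θ', ‖F x θ - F x' θ'‖ ≤ L * √(‖x - x'‖ ^ 2 + ‖θ - θ'‖ ^ 2)

/-- The Lipschitz constants and bounds of the problem, apart from the strong convexity modulus. -/
structure Consts where
  Lfx : ℝ
  Lft : ℝ
  Lgt : ℝ
  Lgxt : ℝ
  Lgtt : ℝ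
  Cft : ℝ
  Cgxt : ℝ

/-- All constants are positive. -/
structure Consts.Pos (c : Consts) : Prop where
  Lfx : 0 < c.Lfx
  Lft : 0 < c.Lft
  Lgt : 0 < c.Lgt
  Lgxt : 0 < c.Lgxt
  Lgtt : 0 < c.Lgtt
  Cft : 0 < c.Cft
  Cgxt : 0 < c.Cgxt

/-- Assumptions on an outer-level function `f`, whose inner-level function is `g`. -/
structure OuterAssumption (c : Consts) (f g : E n → E p → ℝ) : Prop where
  contDiff : ContDiff ℝ 1 fun q : E n × E p => f q.1 q.2
  lipX : JointLip c.Lfx (gradX f)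
  lipT : JointLip c.Lft (gradT f)
  bound : ∀ x, ‖gradT f x (innerSol g x)‖ ≤ c.Cft

/-- Assumptions on an inner-level function `g`. -/
structure InnerAssumption (c : Consts) (μ : ℝ) (g : E n → E p → ℝ) : Prop where
  strongConvex : ∀ x, StrongConvexOn Set.univ μ (g x)
  contDiff : ContDiff ℝ 2 fun q : E n × E p => g q.1 q.2
  lipT : ∀ x θ θ', ‖gradT g x θ - gradT g x θ'‖ ≤ c.Lgt * ‖θ - θ'‖
  lipXT : JointLip c.Lgxt (jacXT g)
  lipTT : JointLip c.Lgtt (hessTT g)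
  bound : ∀ x θ, ‖jacXT g x θ‖ ≤ c.Cgxt

/-- Bounded heterogeneity across the nodes. -/
structure Heterogeneity (bf bg : ℝ) (f g : Fin m → E n → E p → ℝ) : Prop where
  outerX : ∀ x θ, ∑ i, ‖gradX (f i) x θ - avg (fun j => gradX (f j) x θ)‖ ^ 2 ≤ bf ^ 2
  outerT : ∀ x θ, ∑ i, ‖gradT (f i) x θ - avg (fun j => gradT (f j) x θ)‖ ^ 2 ≤ bf ^ 2
  innerGrad : ∀ x, (1 / (m : ℝ)) * ∑ i, ∑ j,
    ‖gradT (g i) x (innerSol (g j) x) - gradT (g j) x (innerSol (g j) x)‖ ^ 2 ≤ bg ^ 2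
  innerJac : ∀ x, (1 / (m : ℝ)) * ∑ i, ∑ j,
    ‖jacXT (g i) x (innerSol (g j) x) - jacXT (g j) x (innerSol (g j) x)‖ ^ 2 ≤ bg ^ 2
  innerHess : ∀ x, (1 / (m : ℝ)) * ∑ i, ∑ j,
    ‖hessTT (g i) x (innerSol (g j) x) - hessTT (g j) x (innerSol (g j) x)‖ ^ 2 ≤ bg ^ 2

/-! ### The algorithm LoPA-LG with exact derivatives -/

/-- The variables held by the nodes at one iteration. -/
structure State (m n p : ℕ) where
  x : Fin m → E n
  θ : Fin m → E p
  v : Fin m → E p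
  z : Fin m → E n
  y : Fin m → E n

/-- The step-sizes. -/
structure Steps where
  α : ℝ
  β : ℝ
  lam : ℝ
  γ : ℝ
  τ : ℝ

/-- Direction of the inner-level variable. -/
def dirD (g : Fin m → E n → E p → ℝ) (S : State m n p) (i : Fin m) : E p :=
  gradT (g i) (S.x i) (S.θ i)

/-- Direction of the Hessian-inverse-vector variable. -/
def dirH (f g : Fin m → E n → E p → ℝ) (S : State m n p) (i : Fin m) : E p :=
  hessTT (g i) (S.x i) (S.θ i) (S.v i) - gradT (f i) (S.x i) (S.θ i)

/-- Approximate local hypergradient. -/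
def dirS (f g : Fin m → E n → E p → ℝ) (S : State m n p) (i : Fin m) : E n :=
  gradX (f i) (S.x i) (S.θ i) - jacXT (g i) (S.x i) (S.θ i) (S.v i)

/-- The momentum update of `z`. -/
def nextZ (f g : Fin m → E n → E p → ℝ) (σ : Steps) (S : State m n p) (i : Fin m) : E n :=
  dirS f g S i + (1 - σ.γ) • (S.z i - dirS f g S i)

/-- One iteration of LoPA-LG: the local gradient scheme sets `y = z`. -/
def step (W : Matrix (Fin m) (Fin m) ℝ) (f g : Fin m → E n → E p → ℝ) (σ : Steps)
    (S : State m n p) : State m n p where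
  x := fun i => (1 - σ.τ) • S.x i + σ.τ • ((∑ j, W i j • S.x j) - σ.α • S.y i)
  θ := fun i => S.θ i - σ.β • dirD g S i
  v := fun i => S.v i - σ.lam • dirH f g S i
  z := nextZ f g σ S
  y := nextZ f g σ S

/-- The state after `k` iterations from `S₀`. -/
def run (W : Matrix (Fin m) (Fin m) ℝ) (f g : Fin m → E n → E p → ℝ) (σ : Steps)
    (S₀ : State m n p) (k : ℕ) : State m n p :=
  (step W f g σ)^[k] S₀

/-! ### Derived constants -/

namespace Consts

variable (c : Consts) (μ : ℝ)

/-- The condition number. -/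
def kappa : ℝ := max c.Lfx (max c.Lft (max c.Lgt (max c.Lgxt c.Lgtt))) / μ

/-- `L_{θ*}` -/
def LthetaStar : ℝ := c.Cgxt / μ

/-- `L_v` -/
def Lv : ℝ := c.Lft / μ + c.Cft * c.Lgtt / μ ^ 2

/-- `L_{v*}` -/
def LvStar : ℝ := c.Lv μ * (1 + c.LthetaStar μ)

/-- `L_f` -/
def Lf : ℝ := c.Lfx + c.Cgxt * c.Lv μ + c.Cft * c.Lgxt / μ

/-- `L`, the Lipschitz constant of `∇Φ`. -/
def L : ℝ := c.Lf μ * (1 + c.LthetaStar μ)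

/-- `M`, the bound of `v*`. -/
def M : ℝ := c.Cft / μ

/-- `L_{fg,x}` -/
def Lfgx : ℝ := 2 * c.Lfx ^ 2 + 4 * c.M μ ^ 2 * c.Lgxt ^ 2

/-- `L_{fg,θ}` -/
def Lfgt : ℝ := 2 * c.Lft ^ 2 + 4 * c.M μ ^ 2 * c.Lgtt ^ 2

/-- `ω_θ` -/
def omega : ℝ := μ * c.Lgt / (2 * (μ + c.Lgt))

/-- `A = L_{fg,x} + 32 C_{g,xθ}² L_{fg,θ} / μ²` -/
def A : ℝ := c.Lfgx μ + 32 * c.Cgxt ^ 2 * c.Lfgt μ / μ ^ 2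

/-- `φ`. The maximum is a Lipschitz constant of `∇_θ g` in `x` as well as in `θ`. -/
def phi : ℝ := c.A μ * (1 + 4 * (max c.Lgt c.Cgxt) ^ 2 / c.omega μ ^ 2)

/-- `C₁` in the bound of the hypergradient heterogeneity. -/
def C1 : ℝ := 4 + 4 * c.Cgxt ^ 2 / μ ^ 2

/-- `C₂` in the bound of the hypergradient heterogeneity. -/
def C2 : ℝ :=
  4 * (4 * (c.Cft ^ 2 * c.Cgxt ^ 2 / μ ^ 4) + 4 * (c.Cft ^ 2 / μ ^ 2)
    + c.Lfx ^ 2 / μ ^ 2 + c.Lft ^ 2 * c.Cgxt ^ 2 / μ ^ 4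
    + 4 * (c.Cft ^ 2 * c.Cgxt ^ 2 * c.Lgtt ^ 2 / μ ^ 6)
    + 4 * (c.Cft ^ 2 * c.Lgxt ^ 2 / μ ^ 4))

/-- The hypergradient heterogeneity `b`, `b² = C₁ b_f² + C₂ b_g²`. -/
def b (bf bg : ℝ) : ℝ := √(c.C1 μ * bf ^ 2 + c.C2 μ * bg ^ 2)

/-- `u₁` -/
def u1 (τ : ℝ) : ℝ := 1 / (2 * τ * c.L μ)

/-- `u₂`, for zero sampling variances. -/
def u2 (ρ : ℝ) : ℝ :=
  min ((1 - ρ) / (12 * √(c.phi μ)))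
    (min ((1 - ρ) ^ (2 / 3 : ℝ) / (4 * c.phi μ ^ (1 / 3 : ℝ)))
      (min (c.A μ ^ (1 / 3 : ℝ) * (1 - ρ) ^ (2 / 3 : ℝ) / (4 * c.phi μ ^ (1 / 3 : ℝ)))
        ((1 - ρ) ^ (1 / 2 : ℝ) / (3 * c.Lfgx μ ^ (1 / 4 : ℝ)))))

/-- `u₃`, for zero sampling variances. -/
def u3 (τ : ℝ) : ℝ :=
  min (1 / (96 * τ * c.LvStar μ * c.Cgxt))
    (min (min (2 / (μ + c.Lgt)) ((μ + c.Lgt) / (2 * μ * c.Lgt)) * c.omega μ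
        / (12 * τ * √(c.A μ) * c.LthetaStar μ))
      (1 / (8 * c.L μ * τ)))

/-- The largest admissible value `u = min {u₁, u₂, u₃}` of `α`. -/
def u (ρ τ : ℝ) : ℝ := min (c.u1 μ τ) (min (c.u2 μ ρ) (c.u3 μ τ))

/-- `ϑ = 24 φ / ((1 - ρ)² c_γ)` -/
def vartheta (ρ cγ : ℝ) : ℝ := 24 * c.phi μ / ((1 - ρ) ^ 2 * cγ)

/-- The initial Lyapunov value `V̂⁰`, with `Φ` measured from its lower bound `ℓ`. -/
def V0 (ρ τ cγ cl cβ : ℝ) (f g : Fin m → E n → E p → ℝ) (ℓ : ℝ) (S : State m n p) : ℝ :=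
  (1 / τ) *
    ((Phi f g (avg S.x) - ℓ)
      + 8 * c.Cgxt ^ 2 * τ / (μ * cl)
        * ((1 / (m : ℝ)) * ∑ i, ‖S.v i - vStar (f i) (g i) (avg S.x)‖ ^ 2)
      + c.A μ * τ / (c.omega μ * cβ)
        * ((1 / (m : ℝ)) * ∑ i, ‖S.θ i - innerSol (g i) (avg S.x)‖ ^ 2)
      + τ / (2 * cγ) * ‖gradient (Phi f g) (avg S.x) - avg S.z‖ ^ 2
      + 24 * c.phi μ * τ / ((1 - ρ) ^ 2 * cγ) * c.u μ ρ τ ^ 3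
        * ((1 / (m : ℝ)) * ∑ i, ‖gradient (PhiLoc (f i) (g i)) (avg S.x) - S.z i‖ ^ 2)
      + 2 * c.phi μ / (1 - ρ) * c.u μ ρ τ
        * ((1 / (m : ℝ)) * ∑ i, ‖S.x i - avg S.x‖ ^ 2))

/-- `a₀ = 4 V̂⁰` -/
def a0 (ρ τ cγ cl cβ : ℝ) (f g : Fin m → E n → E p → ℝ) (ℓ : ℝ) (S : State m n p) : ℝ :=
  4 * c.V0 μ ρ τ cγ cl cβ f g ℓ S

/-- `a₂ = 4 ϑ b² / m` -/
def a2 (ρ cγ bf bg : ℝ) (m : ℕ) : ℝ := 4 * c.vartheta μ ρ cγ / m * c.b μ bf bg ^ 2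

/-- `α = min {u, (a₀ / (a₂ (K + 1)))^{1/3}}` -/
def alpha (ρ τ cγ cl cβ bf bg : ℝ) (f g : Fin m → E n → E p → ℝ) (ℓ : ℝ)
    (S : State m n p) (K : ℕ) : ℝ :=
  min (c.u μ ρ τ)
    ((c.a0 μ ρ τ cγ cl cβ f g ℓ S / (c.a2 μ ρ cγ bf bg m * ((K : ℝ) + 1))) ^ (1 / 3 : ℝ))

/-- The step-sizes for a horizon of `K` iterations: `α` as above, and `β = c_β α`, `λ = c_λ α`,
`γ = c_γ α`. -/
def steps (ρ τ cγ cl cβ bf bg : ℝ) (f g : Fin m → E n → E p → ℝ) (ℓ : ℝ)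
    (S : State m n p) (K : ℕ) : Steps where
  α := c.alpha μ ρ τ cγ cl cβ bf bg f g ℓ S K
  β := cβ * c.alpha μ ρ τ cγ cl cβ bf bg f g ℓ S K
  lam := cl * c.alpha μ ρ τ cγ cl cβ bf bg f g ℓ S K
  γ := cγ * c.alpha μ ρ τ cγ cl cβ bf bg f g ℓ S K
  τ := τ

end Consts

/-- The initialization: the outer-level variables agree, `y⁰ = z⁰`, and the initial errors are
bounded through `R`, where those of `v⁰` and `z⁰` may grow with `κ`. -/
structure Init (R κ : ℝ) (f g : Fin m → E n → E p → ℝ) (ℓ : ℝ) (S : State m n p) : Prop where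
  consensus : ∀ i j, S.x i = S.x j
  y_eq_z : S.y = S.z
  gap : Phi f g (avg S.x) - ℓ ≤ R
  errT : (1 / (m : ℝ)) * ∑ i, ‖S.θ i - innerSol (g i) (avg S.x)‖ ^ 2 ≤ R
  errV : (1 / (m : ℝ)) * ∑ i, ‖S.v i - vStar (f i) (g i) (avg S.x)‖ ^ 2 ≤ R * κ ^ 2
  errZ : (1 / (m : ℝ)) * ∑ i, ‖S.z i - gradient (PhiLoc (f i) (g i)) (avg S.x)‖ ^ 2 ≤ R * κ ^ 2

end

end LoPA

open LoPA

/-! Mixing with a doubly stochastic matrix preserves averages, so the averaged iterate moves exactly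
by `x̄ ↦ x̄ - τα z̄`: the method is inexact gradient descent on `Φ`. Per iteration the descent lemma
gains `τα/2 · (‖∇Φ‖² + ‖z̄‖² - ‖z̄ - ∇Φ‖²)` up to a curvature term. What has to be paid for are five
errors: the averaged momentum (`errQ`), the local momenta (`errZ`), the vectors `v` (`errV`), the
inner variables (`errT`) and the disagreement of the nodes (`errX`). Each contracts by a factor,
perturbed by some of the others or by the hypergradient error `errS` that they bound; all but `errX`
are also perturbed by the drift `(τα)²‖z̄‖²` of their targets. With suitable weights
(`lyapunov_decrease`) the contractions cancel all couplings, and the retained `-τα/2 · ‖z̄‖²`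
absorbs all drifts. Only the heterogeneity that drives the nodes apart survives, of order
`φτα³b²/((1-ρ)²m)`.

Three facts about the problem feed this: `Φᵢ` is differentiable with an `L`-Lipschitz gradient
(`hasGradientAt_PhiLoc`, `norm_gradient_PhiLoc_sub_le`), the gradients `∇Φᵢ` have variance at most
`2b²/m` (`Heterogeneity.gradient_PhiLoc`), and steps along strongly monotone Lipschitz fields
contract (`norm_sub_smul_le`).

The powers of `κ` come from writing `μ = maxL/κ` with `κ ≥ 1`: then `L` and `L_{v*}` are `O(κ³)`,
`A` is `O(κ⁴)` and `φ` is `O(κ⁶)`. Hence `τ ~ κ⁻⁴` is small enough, `u` is at least of order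
`(1-ρ)κ⁻³`, and `V̂⁰` is `O(κ⁵)`. Telescoping bounds the mean squared gradient by terms of order
`a₀/(αK)` and `φα²b²/((1-ρ)²m)`, plus a harmless contribution of the initial momentum error. If `α =
u`, the first term is `κ⁵·κ³/((1-ρ)K)`. Otherwise `α` balances the two, and both are of the order of
the cube root of `a₀² · φb²/((1-ρ)²m) / K²`, which carries `κ^((10+6)/3)`. -/

namespace LoPA

open scoped InnerProductSpace
open Filter Topology

/-! ### Partial derivatives from joint smoothness -/

section Calculus

variable {n p : ℕ} {f g : E n → E p → ℝ}

theorem hasFDerivAt_uncurry {k : WithTop ℕ∞} (hk : 1 ≤ k)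
    (hf : ContDiff ℝ k fun q : E n × E p => f q.1 q.2) (q : E n × E p) :
    HasFDerivAt (fun q : E n × E p => f q.1 q.2)
      (fderiv ℝ (fun q : E n × E p => f q.1 q.2) q) q :=
  (hf.differentiable (by rintro rfl; simp at hk)).differentiableAt.hasFDerivAt

theorem hasFDerivAt_left {k : WithTop ℕ∞} (hk : 1 ≤ k)
    (hf : ContDiff ℝ k fun q : E n × E p => f q.1 q.2) (x : E n) (θ : E p) :
    HasFDerivAt (fun x' => f x' θ)
      ((fderiv ℝ (fun q : E n × E p => f q.1 q.2) (x, θ)).comp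
        (ContinuousLinearMap.inl ℝ (E n) (E p))) x :=
  (hasFDerivAt_uncurry hk hf (x, θ)).comp (f := fun x' => (x', θ)) x (hasFDerivAt_prodMk_left x θ)

theorem hasFDerivAt_right {k : WithTop ℕ∞} (hk : 1 ≤ k)
    (hf : ContDiff ℝ k fun q : E n × E p => f q.1 q.2) (x : E n) (θ : E p) :
    HasFDerivAt (fun θ' => f x θ')
      ((fderiv ℝ (fun q : E n × E p => f q.1 q.2) (x, θ)).comp
        (ContinuousLinearMap.inr ℝ (E n) (E p))) θ :=
  (hasFDerivAt_uncurry hk hf (x, θ)).comp (f := fun θ' => (x, θ')) θ (hasFDerivAt_prodMk_right x θ)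

theorem hasGradientAt_gradX {k : WithTop ℕ∞} (hk : 1 ≤ k)
    (hf : ContDiff ℝ k fun q : E n × E p => f q.1 q.2) (x : E n) (θ : E p) :
    HasGradientAt (fun x' => f x' θ) (gradX f x θ) x :=
  (hasFDerivAt_left hk hf x θ).differentiableAt.hasGradientAt

theorem hasGradientAt_gradT {k : WithTop ℕ∞} (hk : 1 ≤ k)
    (hf : ContDiff ℝ k fun q : E n × E p => f q.1 q.2) (x : E n) (θ : E p) :
    HasGradientAt (fun θ' => f x θ') (gradT f x θ) θ :=
  (hasFDerivAt_right hk hf x θ).differentiableAt.hasGradientAt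

theorem inner_gradX {k : WithTop ℕ∞} (hk : 1 ≤ k)
    (hf : ContDiff ℝ k fun q : E n × E p => f q.1 q.2) (x : E n) (θ : E p) (h : E n) :
    ⟪gradX f x θ, h⟫_ℝ = fderiv ℝ (fun q : E n × E p => f q.1 q.2) (x, θ) (h, 0) := by
  rw [← (hasGradientAt_gradX hk hf x θ).fderiv_apply, (hasFDerivAt_left hk hf x θ).fderiv]
  simp

theorem inner_gradT {k : WithTop ℕ∞} (hk : 1 ≤ k)
    (hf : ContDiff ℝ k fun q : E n × E p => f q.1 q.2) (x : E n) (θ : E p) (w : E p) :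
    ⟪gradT f x θ, w⟫_ℝ = fderiv ℝ (fun q : E n × E p => f q.1 q.2) (x, θ) (0, w) := by
  rw [← (hasGradientAt_gradT hk hf x θ).fderiv_apply, (hasFDerivAt_right hk hf x θ).fderiv]
  simp

theorem gradX_eq {k : WithTop ℕ∞} (hk : 1 ≤ k)
    (hf : ContDiff ℝ k fun q : E n × E p => f q.1 q.2) :
    (fun q : E n × E p => gradX f q.1 q.2) = fun q => (InnerProductSpace.toDual ℝ (E n)).symm
      ((fderiv ℝ (fun q : E n × E p => f q.1 q.2) q).comp
        (ContinuousLinearMap.inl ℝ (E n) (E p))) := by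
  funext q
  refine ext_inner_right ℝ fun h => ?_
  rw [inner_gradX hk hf, InnerProductSpace.toDual_symm_apply]
  simp

theorem gradT_eq {k : WithTop ℕ∞} (hk : 1 ≤ k)
    (hf : ContDiff ℝ k fun q : E n × E p => f q.1 q.2) :
    (fun q : E n × E p => gradT f q.1 q.2) = fun q => (InnerProductSpace.toDual ℝ (E p)).symm
      ((fderiv ℝ (fun q : E n × E p => f q.1 q.2) q).comp
        (ContinuousLinearMap.inr ℝ (E n) (E p))) := by
  funext q
  refine ext_inner_right ℝ fun h => ?_
  rw [inner_gradT hk hf, InnerProductSpace.toDual_symm_apply]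
  simp

theorem contDiff_gradX (hg : ContDiff ℝ 2 fun q : E n × E p => g q.1 q.2) :
    ContDiff ℝ 1 fun q : E n × E p => gradX g q.1 q.2 := by
  rw [gradX_eq (by norm_num) hg]
  exact (InnerProductSpace.toDual ℝ (E n)).symm.toContinuousLinearEquiv.contDiff.comp
    ((hg.fderiv_right (m := 1) (by norm_num)).clm_comp contDiff_const)

theorem contDiff_gradT (hg : ContDiff ℝ 2 fun q : E n × E p => g q.1 q.2) :
    ContDiff ℝ 1 fun q : E n × E p => gradT g q.1 q.2 := by
  rw [gradT_eq (by norm_num) hg]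
  exact (InnerProductSpace.toDual ℝ (E p)).symm.toContinuousLinearEquiv.contDiff.comp
    ((hg.fderiv_right (m := 1) (by norm_num)).clm_comp contDiff_const)

/-- Second derivatives of `g` on the product space. -/
noncomputable abbrev hessUncurry (g : E n → E p → ℝ) (q : E n × E p) :
    E n × E p →L[ℝ] E n × E p →L[ℝ] ℝ :=
  fderiv ℝ (fderiv ℝ fun q : E n × E p => g q.1 q.2) q

theorem hessUncurry_symm (hg : ContDiff ℝ 2 fun q : E n × E p => g q.1 q.2)
    (q a b : E n × E p) : hessUncurry g q a b = hessUncurry g q b a :=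
  (hg.contDiffAt.isSymmSndFDerivAt (by simp)).eq a b

theorem hasFDerivAt_fderiv_apply (hg : ContDiff ℝ 2 fun q : E n × E p => g q.1 q.2)
    (q b : E n × E p) :
    HasFDerivAt (fun q' => fderiv ℝ (fun q : E n × E p => g q.1 q.2) q' b)
      ((hessUncurry g q).flip b) q := by
  have h1 : DifferentiableAt ℝ (fderiv ℝ fun q : E n × E p => g q.1 q.2) q :=
    ((hg.fderiv_right (m := 1) (by norm_num)).differentiable (by norm_num)).differentiableAt
  have := h1.hasFDerivAt.clm_apply (hasFDerivAt_const b q)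
  simpa using this

theorem hasFDerivAt_jacXT (hg : ContDiff ℝ 2 fun q : E n × E p => g q.1 q.2)
    (x : E n) (θ : E p) : HasFDerivAt (fun θ' => gradX g x θ') (jacXT g x θ) θ := by
  have h := ((contDiff_gradX hg).differentiable (by norm_num)).differentiableAt (x := (x, θ))
  exact (h.comp (f := fun θ' => (x, θ')) θ
    (hasFDerivAt_prodMk_right x θ).differentiableAt).hasFDerivAt

theorem hasFDerivAt_hessTT (hg : ContDiff ℝ 2 fun q : E n × E p => g q.1 q.2)
    (x : E n) (θ : E p) : HasFDerivAt (fun θ' => gradT g x θ') (hessTT g x θ) θ := by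
  have h := ((contDiff_gradT hg).differentiable (by norm_num)).differentiableAt (x := (x, θ))
  exact (h.comp (f := fun θ' => (x, θ')) θ
    (hasFDerivAt_prodMk_right x θ).differentiableAt).hasFDerivAt

theorem inner_jacXT (hg : ContDiff ℝ 2 fun q : E n × E p => g q.1 q.2)
    (x : E n) (θ w : E p) (h : E n) :
    ⟪jacXT g x θ w, h⟫_ℝ = hessUncurry g (x, θ) (0, w) (h, 0) := by
  have h1 := (hasFDerivAt_jacXT hg x θ).inner ℝ (hasFDerivAt_const h θ)
  have h2 := (hasFDerivAt_fderiv_apply hg (x, θ) (h, 0)).comp (f := fun θ' => (x, θ')) θ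
    (hasFDerivAt_prodMk_right x θ)
  have h3 : (fun θ' => ⟪gradX g x θ', h⟫_ℝ) =
      (fun q' => fderiv ℝ (fun q : E n × E p => g q.1 q.2) q' (h, 0)) ∘ fun θ' => (x, θ') := by
    funext θ'
    exact inner_gradX (by norm_num) hg x θ' h
  rw [h3] at h1
  have := congrArg (fun A : E p →L[ℝ] ℝ => A w) (h1.unique h2)
  simpa [fderivInnerCLM_apply] using this

theorem inner_hessTT (hg : ContDiff ℝ 2 fun q : E n × E p => g q.1 q.2)
    (x : E n) (θ w w' : E p) :
    ⟪hessTT g x θ w, w'⟫_ℝ = hessUncurry g (x, θ) (0, w) (0, w') := by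
  have h1 := (hasFDerivAt_hessTT hg x θ).inner ℝ (hasFDerivAt_const w' θ)
  have h2 := (hasFDerivAt_fderiv_apply hg (x, θ) (0, w')).comp (f := fun θ' => (x, θ')) θ
    (hasFDerivAt_prodMk_right x θ)
  have h3 : (fun θ' => ⟪gradT g x θ', w'⟫_ℝ) =
      (fun q' => fderiv ℝ (fun q : E n × E p => g q.1 q.2) q' (0, w')) ∘ fun θ' => (x, θ') := by
    funext θ'
    exact inner_gradT (by norm_num) hg x θ' w'
  rw [h3] at h1
  have := congrArg (fun A : E p →L[ℝ] ℝ => A w) (h1.unique h2)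
  simpa [fderivInnerCLM_apply] using this

/-- Symmetry of the second derivative turns the `x`-derivative of `∇_θ g` paired with `v` into
`jacXT g` applied to `v`. This is where the mixed derivative, defined by differentiating in `θ`,
enters the hypergradient. -/
theorem hasFDerivAt_inner_gradT (hg : ContDiff ℝ 2 fun q : E n × E p => g q.1 q.2)
    (q : E n × E p) (v : E p) :
    HasFDerivAt (fun q' : E n × E p => ⟪gradT g q'.1 q'.2, v⟫_ℝ)
      ((innerSL ℝ (jacXT g q.1 q.2 v)).comp (ContinuousLinearMap.fst ℝ (E n) (E p)) +
        (innerSL ℝ (hessTT g q.1 q.2 v)).comp (ContinuousLinearMap.snd ℝ (E n) (E p))) q := by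
  have h3 : (fun q' : E n × E p => ⟪gradT g q'.1 q'.2, v⟫_ℝ) =
      (fun q' => fderiv ℝ (fun q : E n × E p => g q.1 q.2) q' (0, v)) := by
    funext q'
    exact inner_gradT (by norm_num) hg q'.1 q'.2 v
  rw [h3]
  refine (hasFDerivAt_fderiv_apply hg q (0, v)).congr_fderiv ?_
  refine ContinuousLinearMap.ext fun w => ?_
  have hw : w = (w.1, 0) + (0, w.2) := by simp
  have hJ := inner_jacXT hg q.1 q.2 v w.1
  have hH := inner_hessTT hg q.1 q.2 v w.2
  simp only [ContinuousLinearMap.flip_apply, add_apply,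
    ContinuousLinearMap.comp_apply, ContinuousLinearMap.coe_fst', ContinuousLinearMap.coe_snd',
    innerSL_apply_apply, hJ, hH]
  rw [hessUncurry_symm hg, ← map_add, ← hw]

end Calculus

/-! ### The inner problem, the hypergradient and their Lipschitz constants -/

section InnerProblem

variable {n p : ℕ} {f g : E n → E p → ℝ} {c : Consts} {μ : ℝ}

/-- Divide the strong convexity inequality on the segment from `θ` to `θ'` by its parameter `t` and
let `t → 0⁺`. -/
theorem StrongConvexOn.add_inner_gradient_le {F : Type*} [NormedAddCommGroup F]
    [InnerProductSpace ℝ F] [CompleteSpace F] {φ : F → ℝ} {θ d : F} (θ' : F)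
    (hφ : StrongConvexOn Set.univ μ φ) (hd : HasGradientAt φ d θ) :
    φ θ + ⟪d, θ' - θ⟫_ℝ + μ / 2 * ‖θ' - θ‖ ^ 2 ≤ φ θ' := by
  have h1 : HasDerivAt (fun t : ℝ => φ (θ + t • (θ' - θ))) ⟪d, θ' - θ⟫_ℝ 0 := by
    have h2 : HasDerivAt (fun t : ℝ => θ + t • (θ' - θ)) (θ' - θ) 0 := by
      simpa using ((hasDerivAt_id (0 : ℝ)).smul_const (θ' - θ)).const_add θ
    have h3 : HasFDerivAt φ (InnerProductSpace.toDual ℝ F d) (θ + (0 : ℝ) • (θ' - θ)) := by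
      simpa using hd.hasFDerivAt
    simpa [Function.comp_def] using h3.comp_hasDerivAt (0 : ℝ) h2
  have h4 := h1.tendsto_slope_zero_right
  have h5 : Tendsto (fun t : ℝ => φ θ' - φ θ - (1 - t) * (μ / 2 * ‖θ' - θ‖ ^ 2)) (𝓝[>] 0)
      (𝓝 (φ θ' - φ θ - (1 - 0) * (μ / 2 * ‖θ' - θ‖ ^ 2))) := by
    refine Tendsto.mono_left (Continuous.tendsto ?_ 0) nhdsWithin_le_nhds
    fun_prop
  have h6 := le_of_tendsto_of_tendsto h4 h5 ?_
  · linarith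
  · have : Set.Ioo (0 : ℝ) 1 ∈ 𝓝[>] (0 : ℝ) := Ioo_mem_nhdsGT one_pos
    filter_upwards [this] with t ht
    have h7 := hφ.2 (Set.mem_univ θ) (Set.mem_univ θ') (sub_nonneg.2 ht.2.le) ht.1.le
      (sub_add_cancel 1 t)
    have h8 : (1 - t) • θ + t • θ' = θ + t • (θ' - θ) := by module
    rw [h8, norm_sub_rev] at h7
    simp only [smul_eq_mul, zero_add, zero_smul, add_zero] at h7 ⊢
    rw [inv_mul_le_iff₀ ht.1]
    nlinarith [h7]

namespace InnerAssumption

variable (hg : InnerAssumption c μ g)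
include hg

theorem hasGradientAt (x : E n) (θ : E p) : HasGradientAt (g x) (gradT g x θ) θ :=
  hasGradientAt_gradT (by norm_num) hg.contDiff x θ

theorem add_inner_le (x : E n) (θ θ' : E p) :
    g x θ + ⟪gradT g x θ, θ' - θ⟫_ℝ + μ / 2 * ‖θ' - θ‖ ^ 2 ≤ g x θ' :=
  StrongConvexOn.add_inner_gradient_le θ' (hg.strongConvex x) (hg.hasGradientAt x θ)

theorem monotone (x : E n) (θ θ' : E p) :
    μ * ‖θ - θ'‖ ^ 2 ≤ ⟪gradT g x θ - gradT g x θ', θ - θ'⟫_ℝ := by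
  have h1 := hg.add_inner_le x θ θ'
  have h2 := hg.add_inner_le x θ' θ
  rw [← neg_sub θ θ', inner_neg_right, norm_neg] at h1
  rw [inner_sub_left]
  linarith

theorem mul_norm_sub_le (x : E n) (θ θ' : E p) :
    μ * ‖θ - θ'‖ ≤ ‖gradT g x θ - gradT g x θ'‖ := by
  rcases (norm_nonneg (θ - θ')).eq_or_lt with h | h
  · rw [← h, mul_zero]
    positivity
  · have h1 := (hg.monotone x θ θ').trans (real_inner_le_norm _ _)
    nlinarith

/-- The quadratic lower bound at `0` beats its linear term once `‖θ‖ ≥ (2/μ)‖∇_θ g(x, 0)‖`, so the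
minimum may be sought in a compact set. -/
theorem exists_min (hμ : 0 < μ) (x : E n) : ∃ θ, ∀ θ', g x θ ≤ g x θ' := by
  have hc : Continuous (g x) :=
    continuous_iff_continuousAt.2 fun θ => (hg.hasGradientAt x θ).differentiableAt.continuousAt
  refine hc.exists_forall_le' 0 ?_
  have h1 : ∀ᶠ θ : E p in cocompact (E p), 2 / μ * ‖gradT g x 0‖ ≤ ‖θ‖ :=
    tendsto_norm_cocompact_atTop.eventually_ge_atTop _
  filter_upwards [h1] with θ hθ
  have h2 := hg.add_inner_le x 0 θ
  rw [sub_zero] at h2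
  have h3 := abs_le.1 (abs_real_inner_le_norm (gradT g x 0) θ)
  have h4 : ‖gradT g x 0‖ ≤ μ / 2 * ‖θ‖ := by
    calc ‖gradT g x 0‖ = μ / 2 * (2 / μ * ‖gradT g x 0‖) := by field_simp
      _ ≤ _ := by gcongr
  nlinarith [norm_nonneg θ]

theorem innerSol_le (hμ : 0 < μ) (x : E n) (θ : E p) : g x (innerSol g x) ≤ g x θ :=
  Classical.epsilon_spec (hg.exists_min hμ x) θ

theorem gradT_innerSol (hμ : 0 < μ) (x : E n) : gradT g x (innerSol g x) = 0 := by
  have h : IsLocalMin (g x) (innerSol g x) := Eventually.of_forall (hg.innerSol_le hμ x)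
  have h1 := h.hasFDerivAt_eq_zero (hg.hasGradientAt x (innerSol g x)).hasFDerivAt
  simpa using h1

/-- Strong monotonicity and the Lipschitz bound are compared on one unit vector, which exists
because `p ≥ 1`. This is the source of `κ ≥ 1`. -/
theorem modulus_le (hp : 1 ≤ p) (x : E n) : μ ≤ c.Lgt := by
  have : Nonempty (Fin p) := ⟨⟨0, hp⟩⟩
  obtain ⟨w, hw⟩ := exists_norm_eq (E p) zero_le_one
  have h1 := hg.mul_norm_sub_le x w 0
  have h2 := hg.lipT x w 0
  rw [sub_zero, hw] at h1 h2
  linarith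

theorem norm_hessTT_le (hL : 0 ≤ c.Lgt) (x : E n) (θ : E p) : ‖hessTT g x θ‖ ≤ c.Lgt :=
  (hasFDerivAt_hessTT hg.contDiff x θ).le_of_lip' hL
    (Eventually.of_forall fun θ' => hg.lipT x θ' θ)

/-- The limit of strong monotonicity along the ray `θ + t • w`, divided by `t²`. -/
theorem hessTT_coercive (x : E n) (θ w : E p) : μ * ‖w‖ ^ 2 ≤ ⟪hessTT g x θ w, w⟫_ℝ := by
  have h1 : HasDerivAt (fun t : ℝ => ⟪gradT g x (θ + t • w), w⟫_ℝ) ⟪hessTT g x θ w, w⟫_ℝ 0 := by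
    have h2 : HasDerivAt (fun t : ℝ => θ + t • w) w 0 := by
      simpa using ((hasDerivAt_id (0 : ℝ)).smul_const w).const_add θ
    have h3 : HasFDerivAt (fun θ' => gradT g x θ') (hessTT g x θ) (θ + (0 : ℝ) • w) := by
      simpa using hasFDerivAt_hessTT hg.contDiff x θ
    simpa using (h3.comp_hasDerivAt (0 : ℝ) h2).inner ℝ (hasDerivAt_const (0 : ℝ) w)
  refine ge_of_tendsto h1.tendsto_slope_zero_right ?_
  filter_upwards [self_mem_nhdsWithin] with t ht
  have ht' : (0 : ℝ) < t := ht
  have h4 := hg.monotone x (θ + t • w) θ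
  rw [add_sub_cancel_left, norm_smul, inner_smul_right, Real.norm_of_nonneg ht'.le,
    inner_sub_left] at h4
  simp only [zero_add, zero_smul, add_zero, smul_eq_mul]
  rw [le_inv_mul_iff₀ ht']
  have h5 : t * (t * (μ * ‖w‖ ^ 2)) ≤
      t * (⟪gradT g x (θ + t • w), w⟫_ℝ - ⟪gradT g x θ, w⟫_ℝ) := by
    linarith
  exact le_of_mul_le_mul_left h5 ht'

theorem mul_norm_le_hessTT (x : E n) (θ w : E p) : μ * ‖w‖ ≤ ‖hessTT g x θ w‖ := by
  rcases (norm_nonneg w).eq_or_lt with h | h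
  · rw [← h, mul_zero]
    positivity
  · have h1 := (hg.hessTT_coercive x θ w).trans (real_inner_le_norm _ _)
    nlinarith

theorem hessTT_isInvertible (hμ : 0 < μ) (x : E n) (θ : E p) : (hessTT g x θ).IsInvertible := by
  have hi : Function.Injective (hessTT g x θ).toLinearMap := by
    refine (injective_iff_map_eq_zero _).2 fun w hw => ?_
    have h1 := hg.mul_norm_le_hessTT x θ w
    rw [ContinuousLinearMap.coe_coe] at hw
    rw [hw, norm_zero] at h1
    have h2 := norm_nonneg w
    exact norm_eq_zero.1 (by nlinarith)
  exact ⟨(LinearEquiv.ofInjectiveEndo _ hi).toContinuousLinearEquiv, by ext; rfl⟩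

theorem hessTT_inverse_apply (hμ : 0 < μ) (x : E n) (θ w : E p) :
    hessTT g x θ ((hessTT g x θ).inverse w) = w := by
  have := (hg.hessTT_isInvertible hμ x θ).self_comp_inverse
  exact congrArg (fun A : E p →L[ℝ] E p => A w) this

theorem mul_norm_inverse_le (hμ : 0 < μ) (x : E n) (θ w : E p) :
    μ * ‖(hessTT g x θ).inverse w‖ ≤ ‖w‖ := by
  simpa [hg.hessTT_inverse_apply hμ] using
    hg.mul_norm_le_hessTT x θ ((hessTT g x θ).inverse w)

theorem hessTT_vStar (hμ : 0 < μ) (f : E n → E p → ℝ) (x : E n) :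
    hessTT g x (innerSol g x) (vStar f g x) = gradT f x (innerSol g x) :=
  hg.hessTT_inverse_apply hμ _ _ _

theorem norm_vStar_le (hμ : 0 < μ) (hf : OuterAssumption c f g) (x : E n) :
    ‖vStar f g x‖ ≤ c.M μ := by
  rw [Consts.M, le_div_iff₀' hμ]
  exact (hg.mul_norm_inverse_le hμ _ _ _).trans (hf.bound x)

/-- The bound on the mixed derivative makes `∇_x g` Lipschitz in `θ`. Integrating in `x` bounds the
double difference of `g`, which is symmetric in the two variables; differentiating that bound in `θ`
gives the claim. -/
theorem norm_gradT_sub_le_left (hC : 0 ≤ c.Cgxt) (x x' : E n) (θ : E p) :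
    ‖gradT g x θ - gradT g x' θ‖ ≤ c.Cgxt * ‖x - x'‖ := by
  have h1 : ∀ θ₁ θ₂ (y : E n), ‖gradX g y θ₁ - gradX g y θ₂‖ ≤ c.Cgxt * ‖θ₁ - θ₂‖ :=
    fun θ₁ θ₂ y => convex_univ.norm_image_sub_le_of_norm_hasFDerivWithin_le
      (fun θ' _ => (hasFDerivAt_jacXT hg.contDiff y θ').hasFDerivWithinAt)
      (fun θ' _ => hg.bound y θ') (Set.mem_univ _) (Set.mem_univ _)
  have h2 : ∀ θ₁ θ₂, ‖(g x θ₁ - g x' θ₁) - (g x θ₂ - g x' θ₂)‖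
      ≤ c.Cgxt * ‖x - x'‖ * ‖θ₁ - θ₂‖ := by
    intro θ₁ θ₂
    have h3 : ∀ y, HasFDerivAt (fun y => g y θ₁ - g y θ₂)
        (InnerProductSpace.toDual ℝ (E n) (gradX g y θ₁ - gradX g y θ₂)) y := by
      intro y
      rw [map_sub]
      exact (hasGradientAt_gradX (by norm_num) hg.contDiff y θ₁).hasFDerivAt.sub
        (hasGradientAt_gradX (by norm_num) hg.contDiff y θ₂).hasFDerivAt
    have h4 := convex_univ.norm_image_sub_le_of_norm_hasFDerivWithin_le
      (fun y _ => (h3 y).hasFDerivWithinAt)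
      (fun y _ => by rw [LinearIsometryEquiv.norm_map]; exact h1 θ₁ θ₂ y)
      (Set.mem_univ x') (Set.mem_univ x)
    calc _ = ‖(g x θ₁ - g x θ₂) - (g x' θ₁ - g x' θ₂)‖ := by congr 1; ring
      _ ≤ _ := h4
      _ = _ := by ring
  have h5 : HasFDerivAt (fun θ => g x θ - g x' θ)
      (InnerProductSpace.toDual ℝ (E p) (gradT g x θ - gradT g x' θ)) θ := by
    rw [map_sub]
    exact (hg.hasGradientAt x θ).hasFDerivAt.sub (hg.hasGradientAt x' θ).hasFDerivAt
  have h6 := h5.le_of_lip' (by positivity) (Eventually.of_forall fun θ' => h2 θ' θ)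
  rwa [LinearIsometryEquiv.norm_map] at h6

theorem norm_innerSol_sub_le (hμ : 0 < μ) (hC : 0 ≤ c.Cgxt) (x x' : E n) :
    ‖innerSol g x - innerSol g x'‖ ≤ c.LthetaStar μ * ‖x - x'‖ := by
  have h1 := hg.mul_norm_sub_le x (innerSol g x) (innerSol g x')
  have h2 := hg.norm_gradT_sub_le_left hC x' x (innerSol g x')
  rw [hg.gradT_innerSol hμ] at h1 h2
  rw [Consts.LthetaStar, div_mul_eq_mul_div, le_div_iff₀' hμ]
  rw [zero_sub, norm_neg] at h1 h2
  rw [norm_sub_rev x]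
  exact h1.trans h2

/-- Distance of the points `(x, θ*(x))`. -/
theorem sqrt_dist_le (hμ : 0 < μ) (hC : 0 ≤ c.Cgxt) (x x' : E n) :
    √(‖x - x'‖ ^ 2 + ‖innerSol g x - innerSol g x'‖ ^ 2)
      ≤ (1 + c.LthetaStar μ) * ‖x - x'‖ := by
  have h := hg.norm_innerSol_sub_le hμ hC x x'
  rw [Real.sqrt_le_left (by rw [Consts.LthetaStar]; positivity)]
  nlinarith [norm_nonneg (x - x'), norm_nonneg (innerSol g x - innerSol g x')]

theorem norm_vStar_sub_le (hμ : 0 < μ) (hc : c.Pos) (hf : OuterAssumption c f g) (x x' : E n) :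
    ‖vStar f g x - vStar f g x'‖ ≤ c.LvStar μ * ‖x - x'‖ := by
  have hd := hg.sqrt_dist_le hμ hc.Cgxt.le x x'
  set D := √(‖x - x'‖ ^ 2 + ‖innerSol g x - innerSol g x'‖ ^ 2)
  have h1 := hg.mul_norm_le_hessTT x (innerSol g x) (vStar f g x - vStar f g x')
  -- Subtract the two linear systems so that the difference of the Hessians acts on `v*(x')`, which
  -- is bounded by `M`, and the remaining Hessian can be inverted with constant `1/μ`.
  have h2 : hessTT g x (innerSol g x) (vStar f g x - vStar f g x') =
      (gradT f x (innerSol g x) - gradT f x' (innerSol g x')) -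
      (hessTT g x (innerSol g x) - hessTT g x' (innerSol g x')) (vStar f g x') := by
    rw [map_sub, sub_apply, hg.hessTT_vStar hμ, hg.hessTT_vStar hμ]
    abel
  have h3 : ‖(hessTT g x (innerSol g x) - hessTT g x' (innerSol g x')) (vStar f g x')‖
      ≤ c.Lgtt * D * c.M μ :=
    (ContinuousLinearMap.le_opNorm _ _).trans
      (mul_le_mul (hg.lipTT _ _ _ _) (hg.norm_vStar_le hμ hf _) (norm_nonneg _)
        (mul_nonneg hc.Lgtt.le (Real.sqrt_nonneg _)))
  rw [h2] at h1
  have h4 := h1.trans ((norm_sub_le _ _).trans (add_le_add (hf.lipT _ _ _ _) h3))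
  have h5 : c.Lft * D + c.Lgtt * D * c.M μ = μ * (c.Lv μ * D) := by
    rw [Consts.M, Consts.Lv]
    field_simp
  have hLv : 0 ≤ c.Lv μ := by
    have := hc.Lft; have := hc.Cft; have := hc.Lgtt
    rw [Consts.Lv]; positivity
  calc ‖vStar f g x - vStar f g x'‖ ≤ c.Lv μ * D :=
        le_of_mul_le_mul_left (h4.trans_eq h5) hμ
    _ ≤ c.Lv μ * ((1 + c.LthetaStar μ) * ‖x - x'‖) := by gcongr
    _ = _ := by rw [Consts.LvStar]; ring

/-- No derivative of `θ*` is needed. With `v = v*(x)` frozen, the function `f - ⟪∇_θ g, v⟫` has zero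
`θ`-derivative at `(x, θ*(x))`, by the equation that defines `v`, and it agrees with `Φᵢ` along `y ↦
(y, θ*(y))`, where `∇_θ g` vanishes. Lipschitz continuity of `θ*` then turns the remainder into
`o(‖y - x‖)`. -/
theorem hasGradientAt_PhiLoc (hμ : 0 < μ) (hc : c.Pos) (hf : OuterAssumption c f g) (x : E n) :
    HasGradientAt (PhiLoc f g)
      (gradX f x (innerSol g x) - jacXT g x (innerSol g x) (vStar f g x)) x := by
  set v := vStar f g x
  set q : E n × E p := (x, innerSol g x)
  have h1 : HasFDerivAt (fun q' : E n × E p => f q'.1 q'.2 - ⟪gradT g q'.1 q'.2, v⟫_ℝ)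
      ((InnerProductSpace.toDual ℝ (E n) (gradX f x (innerSol g x) -
        jacXT g x (innerSol g x) v)).comp (ContinuousLinearMap.fst ℝ (E n) (E p))) q := by
    refine ((hasFDerivAt_uncurry le_rfl hf.contDiff q).sub
      (hasFDerivAt_inner_gradT hg.contDiff q v)).congr_fderiv ?_
    refine ContinuousLinearMap.ext fun w => ?_
    have hw : w = (w.1, 0) + (0, w.2) := by simp
    have hX := inner_gradX le_rfl hf.contDiff q.1 q.2 w.1
    have hT := inner_gradT le_rfl hf.contDiff q.1 q.2 w.2
    have hH : hessTT g q.1 q.2 v = gradT f q.1 q.2 := hg.hessTT_vStar hμ f x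
    have hsum : fderiv ℝ (fun q : E n × E p => f q.1 q.2) q w =
        ⟪gradX f q.1 q.2, w.1⟫_ℝ + ⟪gradT f q.1 q.2, w.2⟫_ℝ := by
      rw [hX, hT, ← map_add, ← hw]
    simp only [sub_apply, add_apply, ContinuousLinearMap.comp_apply,
      ContinuousLinearMap.coe_fst', ContinuousLinearMap.coe_snd', innerSL_apply_apply, hH, hsum,
      InnerProductSpace.toDual_apply_apply, inner_sub_left]
    change _ = ⟪gradX f q.1 q.2, w.1⟫_ℝ - ⟪jacXT g q.1 q.2 v, w.1⟫_ℝ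
    ring
  have hlip : (fun y => (y, innerSol g y) - q) =O[𝓝 x] fun y => y - x := by
    refine Asymptotics.IsBigO.of_bound (1 + c.LthetaStar μ) (Eventually.of_forall fun y => ?_)
    have h2 := hg.norm_innerSol_sub_le hμ hc.Cgxt.le y x
    have h3 : 0 ≤ c.LthetaStar μ := by
      have := hc.Cgxt; rw [Consts.LthetaStar]; positivity
    rw [Prod.mk_sub_mk, Prod.norm_mk]
    refine max_le ?_ ?_ <;> nlinarith [norm_nonneg (y - x)]
  have hcont : Tendsto (fun y => (y, innerSol g y)) (𝓝 x) (𝓝 q) := by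
    have h4 : Tendsto (fun y => y - x) (𝓝 x) (𝓝 0) :=
      tendsto_sub_nhds_zero_iff.2 tendsto_id
    have h5 := hlip.trans_tendsto h4
    simpa using h5.add_const q
  rw [hasGradientAt_iff_hasFDerivAt, hasFDerivAt_iff_isLittleO]
  have h6 := ((hasFDerivAt_iff_isLittleO.1 h1).comp_tendsto hcont).trans_isBigO hlip
  refine h6.congr_left fun y => ?_
  simp only [Function.comp_apply, hg.gradT_innerSol hμ, inner_zero_left, sub_zero,
    ContinuousLinearMap.comp_apply, ContinuousLinearMap.coe_fst', q, Prod.mk_sub_mk]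
  rfl

theorem gradient_PhiLoc (hμ : 0 < μ) (hc : c.Pos) (hf : OuterAssumption c f g) (x : E n) :
    gradient (PhiLoc f g) x =
      gradX f x (innerSol g x) - jacXT g x (innerSol g x) (vStar f g x) :=
  (hg.hasGradientAt_PhiLoc hμ hc hf x).gradient

theorem norm_gradient_PhiLoc_sub_le (hμ : 0 < μ) (hc : c.Pos) (hf : OuterAssumption c f g)
    (x x' : E n) :
    ‖gradient (PhiLoc f g) x - gradient (PhiLoc f g) x'‖ ≤ c.L μ * ‖x - x'‖ := by
  have hd := hg.sqrt_dist_le hμ hc.Cgxt.le x x'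
  have hv := hg.norm_vStar_sub_le hμ hc hf x x'
  rw [hg.gradient_PhiLoc hμ hc hf, hg.gradient_PhiLoc hμ hc hf]
  have h1 := hf.lipX x (innerSol g x) x' (innerSol g x')
  have h2 := hg.lipXT x (innerSol g x) x' (innerSol g x')
  set D := √(‖x - x'‖ ^ 2 + ‖innerSol g x - innerSol g x'‖ ^ 2)
  set J := jacXT g x (innerSol g x)
  set J' := jacXT g x' (innerSol g x')
  set v := vStar f g x
  set v' := vStar f g x'
  set a := gradX f x (innerSol g x)
  set a' := gradX f x' (innerSol g x')
  have h3 : (a - J v) - (a' - J' v') = (a - a') - (J (v - v') + (J - J') v') := by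
    rw [map_sub, sub_apply]; abel
  have h4 : ‖J (v - v')‖ ≤ c.Cgxt * (c.LvStar μ * ‖x - x'‖) :=
    (ContinuousLinearMap.le_opNorm _ _).trans
      (mul_le_mul (hg.bound _ _) hv (norm_nonneg _) hc.Cgxt.le)
  have h5 : ‖(J - J') v'‖ ≤ c.Lgxt * D * c.M μ :=
    (ContinuousLinearMap.le_opNorm _ _).trans
      (mul_le_mul h2 (hg.norm_vStar_le hμ hf _) (norm_nonneg _)
        (mul_nonneg hc.Lgxt.le (Real.sqrt_nonneg _)))
  rw [h3]
  have hM : 0 ≤ c.M μ := (norm_nonneg _).trans (hg.norm_vStar_le hμ hf x)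
  have h6 := hc.Lfx
  have h7 := hc.Lgxt
  calc _ ≤ ‖a - a'‖ + (‖J (v - v')‖ + ‖(J - J') v'‖) :=
        (norm_sub_le _ _).trans (by gcongr; exact norm_add_le _ _)
    _ ≤ c.Lfx * D + (c.Cgxt * (c.LvStar μ * ‖x - x'‖) + c.Lgxt * D * c.M μ) := by gcongr
    _ = (c.Lfx + c.Lgxt * c.M μ) * D + c.Cgxt * (c.LvStar μ * ‖x - x'‖) := by ring
    _ ≤ (c.Lfx + c.Lgxt * c.M μ) * ((1 + c.LthetaStar μ) * ‖x - x'‖)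
        + c.Cgxt * (c.LvStar μ * ‖x - x'‖) := by gcongr
    _ = _ := by rw [Consts.L, Consts.Lf, Consts.LvStar, Consts.M]; ring

end InnerAssumption

end InnerProblem

/-! ### Averages over the nodes -/

section Mean

variable {m d : ℕ}

/-- The average of the numbers held by the nodes. -/
noncomputable def mean (a : Fin m → ℝ) : ℝ := (1 / (m : ℝ)) * ∑ i, a i

theorem mean_mono {a b : Fin m → ℝ} (h : ∀ i, a i ≤ b i) : mean a ≤ mean b :=
  mul_le_mul_of_nonneg_left (Finset.sum_le_sum fun i _ => h i) (by positivity)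

theorem mean_nonneg {a : Fin m → ℝ} (h : ∀ i, 0 ≤ a i) : 0 ≤ mean a :=
  mul_nonneg (by positivity) (Finset.sum_nonneg fun i _ => h i)

theorem mean_add (a b : Fin m → ℝ) : mean (fun i => a i + b i) = mean a + mean b := by
  simp only [mean, Finset.sum_add_distrib, mul_add]

theorem mean_const_mul (r : ℝ) (a : Fin m → ℝ) : mean (fun i => r * a i) = r * mean a := by
  simp only [mean, ← Finset.mul_sum]
  ring

theorem mean_const (hm : 0 < m) (r : ℝ) : mean (fun _ : Fin m => r) = r := by
  simp only [mean, Finset.sum_const, Finset.card_univ, Fintype.card_fin, nsmul_eq_mul]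
  field_simp

theorem avg_add (a b : Fin m → E d) : avg (fun i => a i + b i) = avg a + avg b := by
  simp only [avg, Finset.sum_add_distrib, smul_add]

theorem avg_sub (a b : Fin m → E d) : avg (fun i => a i - b i) = avg a - avg b := by
  simp only [avg, Finset.sum_sub_distrib, smul_sub]

theorem avg_smul (r : ℝ) (a : Fin m → E d) : avg (fun i => r • a i) = r • avg a := by
  simp only [avg, ← Finset.smul_sum]
  exact smul_comm _ _ _

theorem avg_const (hm : 0 < m) (a : E d) : avg (fun _ : Fin m => a) = a := by
  simp only [avg, Finset.sum_const, Finset.card_univ, Fintype.card_fin, ← Nat.cast_smul_eq_nsmul ℝ,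
    smul_smul]
  rw [one_div_mul_cancel (by positivity), one_smul]

theorem inner_avg_left (a : Fin m → E d) (w : E d) :
    ⟪avg a, w⟫_ℝ = mean fun i => ⟪a i, w⟫_ℝ := by
  simp only [avg, mean, real_inner_smul_left, sum_inner]

/-- Bias-variance decomposition. -/
theorem mean_norm_sub_sq (hm : 0 < m) (a : Fin m → E d) (w : E d) :
    (mean fun i => ‖a i - w‖ ^ 2) = (mean fun i => ‖a i - avg a‖ ^ 2) + ‖avg a - w‖ ^ 2 := by
  have h1 : ∀ i, ‖a i - w‖ ^ 2 =
      ‖a i - avg a‖ ^ 2 + (2 * ⟪a i - avg a, avg a - w⟫_ℝ + ‖avg a - w‖ ^ 2) := by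
    intro i
    rw [← sub_add_sub_cancel (a i) (avg a) w, norm_add_sq_real]
    ring
  have h2 : (mean fun i => ⟪a i - avg a, avg a - w⟫_ℝ) = 0 := by
    rw [← inner_avg_left, avg_sub, avg_const hm, sub_self, inner_zero_left]
  simp only [h1]
  rw [mean_add, mean_add, mean_const_mul, h2, mean_const hm]
  ring

theorem mean_norm_sub_avg_sq_le (hm : 0 < m) (a : Fin m → E d) (w : E d) :
    (mean fun i => ‖a i - avg a‖ ^ 2) ≤ mean fun i => ‖a i - w‖ ^ 2 := by
  rw [mean_norm_sub_sq hm a w]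
  exact le_add_of_nonneg_right (by positivity)

theorem norm_avg_sq_le (hm : 0 < m) (a : Fin m → E d) : ‖avg a‖ ^ 2 ≤ mean fun i => ‖a i‖ ^ 2 := by
  have h := mean_norm_sub_sq hm a 0
  simp only [sub_zero] at h
  rw [h]
  exact le_add_of_nonneg_left (mean_nonneg fun i => by positivity)

end Mean

/-! ### Contraction and descent inequalities -/

section Generic

theorem norm_add_sq_le_two {F : Type*} [NormedAddCommGroup F] (a b : F) : ‖a + b‖ ^ 2 ≤ 2 * (‖a‖ ^ 2 + ‖b‖ ^ 2) := by
  have h := norm_add_le a b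
  nlinarith [norm_nonneg (a + b), sq_nonneg (‖a‖ - ‖b‖)]

theorem norm_sub_sq_le_two {F : Type*} [NormedAddCommGroup F] (a b : F) : ‖a - b‖ ^ 2 ≤ 2 * (‖a‖ ^ 2 + ‖b‖ ^ 2) := by
  rw [sub_eq_add_neg, ← norm_neg b]
  exact norm_add_sq_le_two a (-b)

variable {F : Type*} [NormedAddCommGroup F] [InnerProductSpace ℝ F]

/-- A contraction by the factor `1 - r`, perturbed twice. -/
theorem norm_sq_perturbed_contraction {F : Type*} [NormedAddCommGroup F] {r : ℝ} (h0 : 0 < r) (h1 : r < 1) {a s q e : F}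
    (hs : ‖s‖ ≤ (1 - r) * ‖a‖) :
    ‖s + q + e‖ ^ 2 ≤ (1 - r) * ‖a‖ ^ 2 + 2 / r * (‖q‖ ^ 2 + ‖e‖ ^ 2) := by
  -- The right side is a convex combination with weights `1 - r` and `r`, so convexity of the square
  -- leaves the factor `1 - r` in front of `‖a‖²` and costs only `1/r` on the perturbation.
  have h2 : ‖s + q + e‖ ≤ (1 - r) * ‖a‖ + r * ((‖q‖ + ‖e‖) / r) := by
    rw [mul_div_cancel₀ _ h0.ne', add_assoc]
    exact (norm_add_le _ _).trans (add_le_add hs (norm_add_le _ _))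
  set t := (‖q‖ + ‖e‖) / r with ht
  have h3 : ((1 - r) * ‖a‖ + r * t) ^ 2 ≤ (1 - r) * ‖a‖ ^ 2 + r * t ^ 2 := by
    nlinarith [mul_nonneg (mul_nonneg h0.le (sub_nonneg.2 h1.le)) (sq_nonneg (‖a‖ - t))]
  have h4 : r * t ^ 2 ≤ 2 / r * (‖q‖ ^ 2 + ‖e‖ ^ 2) := by
    have : r * t ^ 2 = 1 / r * (‖q‖ + ‖e‖) ^ 2 := by rw [ht]; field_simp
    rw [this, show 2 / r * (‖q‖ ^ 2 + ‖e‖ ^ 2) = 1 / r * (2 * (‖q‖ ^ 2 + ‖e‖ ^ 2)) by ring]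
    refine mul_le_mul_of_nonneg_left ?_ (by positivity)
    nlinarith [sq_nonneg (‖q‖ - ‖e‖)]
  calc ‖s + q + e‖ ^ 2 ≤ ((1 - r) * ‖a‖ + r * t) ^ 2 := by gcongr
    _ ≤ _ := h3.trans (by gcongr)

/-- A gradient step on a strongly monotone Lipschitz field contracts. -/
theorem norm_sub_smul_le {μ l s : ℝ} (hs : 0 ≤ s) (hsl : s * l ^ 2 ≤ μ) (hsμ : s * μ ≤ 1)
    {a w : F} (hm : μ * ‖a‖ ^ 2 ≤ ⟪w, a⟫_ℝ) (hw : ‖w‖ ≤ l * ‖a‖) :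
    ‖a - s • w‖ ≤ (1 - s * μ / 2) * ‖a‖ := by
  refine le_of_sq_le_sq ?_ (mul_nonneg (by linarith) (norm_nonneg _))
  rw [norm_sub_sq_real, norm_smul, real_inner_smul_right, real_inner_comm, mul_pow,
    Real.norm_of_nonneg hs]
  have h1 : ‖w‖ ^ 2 ≤ l ^ 2 * ‖a‖ ^ 2 := by
    rw [← mul_pow]
    gcongr
  have h2 : s ^ 2 * ‖w‖ ^ 2 ≤ s * μ * ‖a‖ ^ 2 := by
    calc s ^ 2 * ‖w‖ ^ 2 ≤ s ^ 2 * (l ^ 2 * ‖a‖ ^ 2) := by gcongr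
      _ = s * (s * l ^ 2) * ‖a‖ ^ 2 := by ring
      _ ≤ s * μ * ‖a‖ ^ 2 := by gcongr
  -- The expansion leaves the factor `1 - 2sμ + sμ = 1 - sμ`, which is at most `(1 - sμ/2)²`.
  nlinarith [mul_le_mul_of_nonneg_left hm hs, mul_nonneg (sq_nonneg (s * μ)) (sq_nonneg ‖a‖)]

/-- The descent lemma, with a constant that is not sharp. -/
theorem le_add_inner_of_lipschitz_gradient [CompleteSpace F] {φ : F → ℝ} {φ' : F → F} {l : ℝ}
    (hl : 0 ≤ l) (hφ : ∀ x, HasGradientAt φ (φ' x) x)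
    (hlip : ∀ x y, ‖φ' x - φ' y‖ ≤ l * ‖x - y‖) (x y : F) :
    φ y ≤ φ x + ⟪φ' x, y - x⟫_ℝ + l * ‖y - x‖ ^ 2 := by
  have h1 : ∀ z ∈ segment ℝ x y, ‖InnerProductSpace.toDual ℝ F (φ' z) -
      InnerProductSpace.toDual ℝ F (φ' x)‖ ≤ l * ‖y - x‖ := by
    intro z hz
    rw [← map_sub, LinearIsometryEquiv.norm_map]
    refine (hlip z x).trans (mul_le_mul_of_nonneg_left ?_ hl)
    obtain ⟨t, ht, rfl⟩ := (segment_eq_image' ℝ x y ▸ hz)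
    rw [add_sub_cancel_left, norm_smul, Real.norm_of_nonneg ht.1]
    exact mul_le_of_le_one_left (norm_nonneg _) ht.2
  have h2 := (convex_segment x y).norm_image_sub_le_of_norm_hasFDerivWithin_le'
    (fun z _ => (hφ z).hasFDerivAt.hasFDerivWithinAt) h1 (left_mem_segment ℝ x y)
    (right_mem_segment ℝ x y)
  rw [InnerProductSpace.toDual_apply_apply, Real.norm_eq_abs] at h2
  nlinarith [le_abs_self (φ y - φ x - ⟪φ' x, y - x⟫_ℝ)]

end Generic

/-! ### Contraction of the disagreement by the weight matrix -/

section Mixing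

variable {m d : ℕ} {G : SimpleGraph (Fin m)} {W : Matrix (Fin m) (Fin m) ℝ}

theorem Network.pos (hW : Network G W) : 0 < m :=
  Fin.pos_iff_nonempty.2 hW.connected.nonempty

theorem rho_nonneg (W : Matrix (Fin m) (Fin m) ℝ) : 0 ≤ rho W := sq_nonneg _

theorem Network.avg_mix (hW : Network G W) (x : Fin m → E d) :
    avg (fun i => ∑ j, W i j • x j) = avg x := by
  simp only [avg]
  rw [Finset.sum_comm]
  congr 1
  refine Finset.sum_congr rfl fun j _ => ?_
  rw [← Finset.sum_smul, (mem_doublyStochastic_iff_sum.1 hW.stochastic).2.2 j, one_smul]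

theorem sum_sq_mulVec_le (W : Matrix (Fin m) (Fin m) ℝ) (u : Fin m → ℝ) :
    ∑ i, (∑ j, (W i j - 1 / (m : ℝ)) * u j) ^ 2 ≤ rho W * ∑ i, u i ^ 2 := by
  have h := (Matrix.toEuclideanCLM (n := Fin m) (𝕜 := ℝ)
    (W - Matrix.of fun _ _ => 1 / (m : ℝ))).le_opNorm (WithLp.toLp 2 u)
  have h1 := pow_le_pow_left₀ (norm_nonneg _) h 2
  rw [mul_pow, EuclideanSpace.real_norm_sq_eq, EuclideanSpace.real_norm_sq_eq] at h1
  simpa [rho, Matrix.mulVec, dotProduct, sub_mul, Finset.sum_sub_distrib] using h1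

theorem Network.mix_contraction (hW : Network G W) (x : Fin m → E d) :
    (mean fun i => ‖(∑ j, W i j • x j) - avg x‖ ^ 2)
      ≤ rho W * mean fun i => ‖x i - avg x‖ ^ 2 := by
  have hm := hW.pos
  -- The rows of `W - 11ᵀ/m` sum to zero, so the average may be subtracted from every `x j`. The
  -- spectral norm bound then applies to each coordinate separately.
  have h0 : ∀ i, (∑ j, W i j • x j) - avg x = ∑ j, (W i j - 1 / (m : ℝ)) • (x j - avg x) := by
    intro i
    have h1 : ∑ j, W i j = 1 := (mem_doublyStochastic_iff_sum.1 hW.stochastic).2.1 i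
    have h2 : ∑ _j : Fin m, 1 / (m : ℝ) = 1 := by
      rw [Finset.sum_const, Finset.card_univ, Fintype.card_fin, nsmul_eq_mul]
      field_simp
    have h3 : ∑ j, (1 / (m : ℝ)) • x j = avg x := by rw [avg, Finset.smul_sum]
    simp only [sub_smul, smul_sub, Finset.sum_sub_distrib, ← Finset.sum_smul, h1, h2, h3, one_smul]
    abel
  have h1 : ∑ i, ‖(∑ j, W i j • x j) - avg x‖ ^ 2 ≤ rho W * ∑ i, ‖x i - avg x‖ ^ 2 := by
    simp only [h0, EuclideanSpace.real_norm_sq_eq]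
    rw [Finset.sum_comm, Finset.sum_comm (s := Finset.univ (α := Fin m)), Finset.mul_sum]
    refine Finset.sum_le_sum fun k _ => ?_
    simpa using sum_sq_mulVec_le W fun j => (x j - avg x) k
  calc (mean fun i => ‖(∑ j, W i j • x j) - avg x‖ ^ 2)
      ≤ (1 / (m : ℝ)) * (rho W * ∑ i, ‖x i - avg x‖ ^ 2) :=
        mul_le_mul_of_nonneg_left h1 (by positivity)
    _ = _ := by rw [mean]; ring

end Mixing

/-! ### The global objective -/

section Network

variable {m n p : ℕ} {f g : Fin m → E n → E p → ℝ} {c : Consts} {μ : ℝ}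

theorem hasGradientAt_Phi (hμ : 0 < μ) (hc : c.Pos) (hf : ∀ i, OuterAssumption c (f i) (g i))
    (hg : ∀ i, InnerAssumption c μ (g i)) (x : E n) :
    HasGradientAt (Phi f g) (avg fun i => gradient (PhiLoc (f i) (g i)) x) x := by
  rw [hasGradientAt_iff_hasFDerivAt]
  have h1 : ∀ i ∈ Finset.univ, HasFDerivAt (PhiLoc (f i) (g i))
      (InnerProductSpace.toDual ℝ (E n) (gradient (PhiLoc (f i) (g i)) x)) x := fun i _ =>
    ((hg i).hasGradientAt_PhiLoc hμ hc (hf i) x).differentiableAt.hasGradientAt.hasFDerivAt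
  have h2 := (HasFDerivAt.fun_sum h1).const_mul (1 / (m : ℝ))
  refine h2.congr_fderiv ?_
  rw [avg, map_smulₛₗ, map_sum]
  rfl

theorem gradient_Phi (hμ : 0 < μ) (hc : c.Pos) (hf : ∀ i, OuterAssumption c (f i) (g i))
    (hg : ∀ i, InnerAssumption c μ (g i)) (x : E n) :
    gradient (Phi f g) x = avg fun i => gradient (PhiLoc (f i) (g i)) x :=
  (hasGradientAt_Phi hμ hc hf hg x).gradient

theorem norm_gradient_Phi_sub_le (hm : 0 < m) (hμ : 0 < μ) (hc : c.Pos)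
    (hf : ∀ i, OuterAssumption c (f i) (g i)) (hg : ∀ i, InnerAssumption c μ (g i)) (x x' : E n) :
    ‖gradient (Phi f g) x - gradient (Phi f g) x'‖ ≤ c.L μ * ‖x - x'‖ := by
  have hL := fun i => (hg i).norm_gradient_PhiLoc_sub_le hμ hc (hf i) x x'
  have h0 := (norm_nonneg _).trans (hL ⟨0, hm⟩)
  refine le_of_sq_le_sq ?_ h0
  rw [gradient_Phi hμ hc hf hg, gradient_Phi hμ hc hf hg, ← avg_sub]
  calc _ ≤ _ := norm_avg_sq_le hm _
    _ ≤ mean fun _ : Fin m => (c.L μ * ‖x - x'‖) ^ 2 :=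
      mean_mono fun i => pow_le_pow_left₀ (norm_nonneg _) (hL i) 2
    _ = _ := mean_const hm _

end Network

/-! ### Heterogeneity of the local hypergradients -/

section HeterogeneityBound

variable {m n p : ℕ} {f g : Fin m → E n → E p → ℝ} {c : Consts} {μ bf bg : ℝ}

theorem mean_mean_le {a : Fin m → Fin m → ℝ} {B : ℝ}
    (h : (1 / (m : ℝ)) * ∑ i, ∑ j, a i j ≤ B) : (mean fun j => mean fun i => a i j) ≤ B / m := by
  have h1 : (mean fun j => mean fun i => a i j) = ((1 / (m : ℝ)) * ∑ i, ∑ j, a i j) / m := by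
    rw [Finset.sum_comm]
    simp only [mean, ← Finset.mul_sum]
    ring
  rw [h1]
  gcongr

theorem mean_mean_le_of_forall (hm : 0 < m) {a : Fin m → Fin m → ℝ} {B : ℝ}
    (h : ∀ j, ∑ i, a i j ≤ B) : (mean fun j => mean fun i => a i j) ≤ B / m := by
  calc (mean fun j => mean fun i => a i j) ≤ mean fun _ : Fin m => B / m := by
        refine mean_mono fun j => ?_
        rw [mean, div_eq_inv_mul B, one_div]
        exact mul_le_mul_of_nonneg_left (h j) (by positivity)
    _ = _ := mean_const hm _

theorem sq_add_eight_le (a b c d e f g h : ℝ) : (a + b + c + d + e + f + g + h) ^ 2 ≤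
    8 * (a ^ 2 + b ^ 2 + c ^ 2 + d ^ 2 + e ^ 2 + f ^ 2 + g ^ 2 + h ^ 2) := by
  have h1 : ∀ x y : ℝ, (x + y) ^ 2 ≤ 2 * (x ^ 2 + y ^ 2) := fun x y => by
    nlinarith [sq_nonneg (x - y)]
  have h2 := h1 (a + b + c + d) (e + f + g + h)
  have h3 := h1 (a + b) (c + d)
  have h4 := h1 (e + f) (g + h)
  have h5 := h1 a b
  have h6 := h1 c d
  have h7 := h1 e f
  have h8 := h1 g h
  have h9 : a + b + c + d + (e + f + g + h) = a + b + c + d + e + f + g + h := by ring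
  have h10 : a + b + (c + d) = a + b + c + d := by ring
  have h11 : e + f + (g + h) = e + f + g + h := by ring
  rw [h9] at h2
  rw [h10] at h3
  rw [h11] at h4
  linarith

theorem jointLip_right {X : Type*} [NormedAddCommGroup X] {L : ℝ} {F : E n → E p → X}
    (h : JointLip L F) (x : E n) (θ θ' : E p) : ‖F x θ - F x θ'‖ ≤ L * ‖θ - θ'‖ := by
  simpa using h x θ x θ'

/-- The hypergradient of one node against the hypergradient of another node `g'`, whose outer
derivatives are replaced by given vectors. -/
theorem norm_gradient_PhiLoc_sub_hybrid_le {f g g' : E n → E p → ℝ} (hμ : 0 < μ) (hc : c.Pos)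
    (hf : OuterAssumption c f g) (hg : InnerAssumption c μ g) (hg' : InnerAssumption c μ g')
    (x : E n) (a : E n) (w : E p) :
    ‖gradient (PhiLoc f g) x - (a - jacXT g' x (innerSol g' x)
        ((hessTT g' x (innerSol g' x)).inverse w))‖ ^ 2 ≤
      8 * (((c.Lfx / μ) ^ 2 + (c.M μ * c.Lgxt / μ) ^ 2 + (c.Cgxt * c.M μ * c.Lgtt / μ ^ 2) ^ 2 +
          (c.Cgxt * c.Lft / μ ^ 2) ^ 2)
          * ‖gradT g x (innerSol g' x) - gradT g' x (innerSol g' x)‖ ^ 2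
        + c.M μ ^ 2 * ‖jacXT g x (innerSol g' x) - jacXT g' x (innerSol g' x)‖ ^ 2
        + (c.Cgxt * c.M μ / μ) ^ 2
          * ‖hessTT g x (innerSol g' x) - hessTT g' x (innerSol g' x)‖ ^ 2
        + ‖gradX f x (innerSol g' x) - a‖ ^ 2
        + (c.Cgxt / μ) ^ 2 * ‖gradT f x (innerSol g' x) - w‖ ^ 2) := by
  have hLfx := hc.Lfx
  have hLft := hc.Lft
  have hLgxt := hc.Lgxt
  have hLgtt := hc.Lgtt
  have hC := hc.Cgxt
  set θ := innerSol g x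
  set θ' := innerSol g' x
  set v := vStar f g x with hvdef
  set v' := (hessTT g' x θ').inverse w with hv'def
  have hvM : ‖v‖ ≤ c.M μ := hg.norm_vStar_le hμ hf x
  have hM : 0 ≤ c.M μ := (norm_nonneg _).trans hvM
  set d := ‖gradT g x θ' - gradT g' x θ'‖ with hd
  -- Both inner gradients vanish at their own minimizers, so strong monotonicity bounds the distance
  -- of the minimizers by the gradient discrepancy at `θ'`. All comparisons below then take place at
  -- `θ'`, where the heterogeneity assumption speaks.
  have hθ : ‖θ - θ'‖ ≤ d / μ := by
    rw [le_div_iff₀' hμ, hd, hg'.gradT_innerSol hμ, ← hg.gradT_innerSol hμ x,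
      norm_sub_rev (gradT g x θ')]
    exact hg.mul_norm_sub_le x θ θ'
  have h1 : ‖gradX f x θ - a‖ ≤ c.Lfx * (d / μ) + ‖gradX f x θ' - a‖ :=
    (norm_sub_le_norm_sub_add_norm_sub _ (gradX f x θ') _).trans
      (by gcongr; exact (jointLip_right hf.lipX x θ θ').trans (by gcongr))
  have h2 : ‖jacXT g x θ - jacXT g' x θ'‖ ≤
      c.Lgxt * (d / μ) + ‖jacXT g x θ' - jacXT g' x θ'‖ :=
    (norm_sub_le_norm_sub_add_norm_sub _ (jacXT g x θ') _).trans
      (by gcongr; exact (jointLip_right hg.lipXT x θ θ').trans (by gcongr))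
  have h3 : ‖hessTT g x θ - hessTT g' x θ'‖ ≤
      c.Lgtt * (d / μ) + ‖hessTT g x θ' - hessTT g' x θ'‖ :=
    (norm_sub_le_norm_sub_add_norm_sub _ (hessTT g x θ') _).trans
      (by gcongr; exact (jointLip_right hg.lipTT x θ θ').trans (by gcongr))
  have h4 : ‖gradT f x θ - w‖ ≤ c.Lft * (d / μ) + ‖gradT f x θ' - w‖ :=
    (norm_sub_le_norm_sub_add_norm_sub _ (gradT f x θ') _).trans
      (by gcongr; exact (jointLip_right hf.lipT x θ θ').trans (by gcongr))
  have h5 : ‖v - v'‖ ≤ ((c.Lgtt * (d / μ) + ‖hessTT g x θ' - hessTT g' x θ'‖) * c.M μ +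
      (c.Lft * (d / μ) + ‖gradT f x θ' - w‖)) / μ := by
    have h6 := hg'.mul_norm_le_hessTT x θ' (v - v')
    have h7 : hessTT g' x θ' (v - v') =
        (gradT f x θ - w) - (hessTT g x θ - hessTT g' x θ') v := by
      have h8 : hessTT g x θ v = gradT f x θ := hg.hessTT_vStar hμ f x
      rw [map_sub, hv'def, hg'.hessTT_inverse_apply hμ, sub_apply, h8]
      abel
    rw [le_div_iff₀' hμ]
    rw [h7] at h6
    calc _ ≤ _ := h6
      _ ≤ ‖gradT f x θ - w‖ + ‖(hessTT g x θ - hessTT g' x θ') v‖ := norm_sub_le _ _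
      _ ≤ (c.Lft * (d / μ) + ‖gradT f x θ' - w‖)
          + (c.Lgtt * (d / μ) + ‖hessTT g x θ' - hessTT g' x θ'‖) * c.M μ := by
        gcongr
        exact (ContinuousLinearMap.le_opNorm _ _).trans (by gcongr)
      _ = _ := add_comm _ _
  have h9 : gradient (PhiLoc f g) x - (a - jacXT g' x θ' v') =
      (gradX f x θ - a) - ((jacXT g x θ - jacXT g' x θ') v + jacXT g' x θ' (v - v')) := by
    rw [hg.gradient_PhiLoc hμ hc hf, sub_apply, map_sub]
    abel
  have h10 : ‖gradient (PhiLoc f g) x - (a - jacXT g' x θ' v')‖ ≤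
      (c.Lfx * (d / μ) + ‖gradX f x θ' - a‖)
      + ((c.Lgxt * (d / μ) + ‖jacXT g x θ' - jacXT g' x θ'‖) * c.M μ
      + c.Cgxt * (((c.Lgtt * (d / μ) + ‖hessTT g x θ' - hessTT g' x θ'‖) * c.M μ +
        (c.Lft * (d / μ) + ‖gradT f x θ' - w‖)) / μ)) := by
    rw [h9]
    refine (norm_sub_le _ _).trans (add_le_add h1 ((norm_add_le _ _).trans (add_le_add ?_ ?_)))
    · exact (ContinuousLinearMap.le_opNorm _ _).trans (by gcongr)
    · exact (ContinuousLinearMap.le_opNorm _ _).trans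
        (mul_le_mul (hg'.bound _ _) h5 (norm_nonneg _) hC.le)
  refine (pow_le_pow_left₀ (norm_nonneg _) h10 2).trans ?_
  -- Eight contributions: four are multiples of `d`, caused by the shift from `θ` to `θ'`, and four
  -- are the discrepancies of the single derivatives at `θ'`.
  have h11 := sq_add_eight_le (c.Lfx / μ * d) (c.M μ * c.Lgxt / μ * d)
    (c.Cgxt * c.M μ * c.Lgtt / μ ^ 2 * d) (c.Cgxt * c.Lft / μ ^ 2 * d)
    (c.M μ * ‖jacXT g x θ' - jacXT g' x θ'‖)
    (c.Cgxt * c.M μ / μ * ‖hessTT g x θ' - hessTT g' x θ'‖) ‖gradX f x θ' - a‖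
    (c.Cgxt / μ * ‖gradT f x θ' - w‖)
  refine le_trans (le_of_eq ?_) (h11.trans (le_of_eq ?_))
  · congr 1
    field_simp
    ring
  · ring

/-- The variance of the `∇Φᵢ` is at most their mean squared distance to any fixed vector. For each
`j` the vector taken is a hybrid `q j`: outer derivatives averaged over the nodes, inner derivatives
of node `j`, all at `θ_j*(x)`. Averaging over `j` produces exactly the double sums of the
assumption, and the further factor `1/m` of the second mean gives `2b²/m`. -/
theorem Heterogeneity.gradient_PhiLoc (hm : 0 < m) (hμ : 0 < μ) (hc : c.Pos)
    (hf : ∀ i, OuterAssumption c (f i) (g i)) (hg : ∀ i, InnerAssumption c μ (g i))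
    (h : Heterogeneity bf bg f g) (x : E n) :
    (mean fun i => ‖gradient (PhiLoc (f i) (g i)) x - gradient (Phi f g) x‖ ^ 2)
      ≤ 2 * c.b μ bf bg ^ 2 / m := by
  set q : Fin m → E n := fun j => (avg fun k => gradX (f k) x (innerSol (g j) x)) -
    jacXT (g j) x (innerSol (g j) x) ((hessTT (g j) x (innerSol (g j) x)).inverse
      (avg fun k => gradT (f k) x (innerSol (g j) x)))
  have h1 : (mean fun i => ‖gradient (PhiLoc (f i) (g i)) x - gradient (Phi f g) x‖ ^ 2) ≤
      mean fun j => mean fun i => ‖gradient (PhiLoc (f i) (g i)) x - q j‖ ^ 2 := by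
    rw [gradient_Phi hμ hc hf hg]
    calc _ = mean fun _ : Fin m => _ := (mean_const hm _).symm
      _ ≤ _ := mean_mono fun j => mean_norm_sub_avg_sq_le hm _ (q j)
  refine h1.trans ((mean_mono fun j => mean_mono fun i =>
    norm_gradient_PhiLoc_sub_hybrid_le hμ hc (hf i) (hg i) (hg j) x _ _).trans ?_)
  simp only [mean_const_mul, mean_add]
  have hX := mean_mean_le_of_forall hm fun j => h.outerX x (innerSol (g j) x)
  have hT := mean_mean_le_of_forall hm fun j => h.outerT x (innerSol (g j) x)
  have hG := mean_mean_le (h.innerGrad x)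
  have hJ := mean_mean_le (h.innerJac x)
  have hH := mean_mean_le (h.innerHess x)
  have hb : c.b μ bf bg ^ 2 = c.C1 μ * bf ^ 2 + c.C2 μ * bg ^ 2 := by
    refine Real.sq_sqrt ?_
    have := hc.Lfx; have := hc.Lft; have := hc.Cft; have := hc.Lgtt; have := hc.Lgxt
    have := hc.Cgxt
    rw [Consts.C1, Consts.C2]
    positivity
  have h2 : 0 ≤ c.M μ * c.Lgxt / μ := by
    have := hc.Cft; have := hc.Lgxt
    rw [Consts.M]; positivity
  have hcoef : 0 ≤ bg ^ 2 / (m : ℝ) := by positivity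
  have hcoef' : 0 ≤ bf ^ 2 / (m : ℝ) := by positivity
  calc _ ≤ 8 * (((c.Lfx / μ) ^ 2 + (c.M μ * c.Lgxt / μ) ^ 2
          + (c.Cgxt * c.M μ * c.Lgtt / μ ^ 2) ^ 2 + (c.Cgxt * c.Lft / μ ^ 2) ^ 2) * (bg ^ 2 / m)
        + c.M μ ^ 2 * (bg ^ 2 / m) + (c.Cgxt * c.M μ / μ) ^ 2 * (bg ^ 2 / m) + bf ^ 2 / m
        + (c.Cgxt / μ) ^ 2 * (bf ^ 2 / m)) := by gcongr
    _ ≤ 2 * (c.C1 μ * (bf ^ 2 / m) + c.C2 μ * (bg ^ 2 / m)) := by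
      have h3 : 8 * ((c.Lfx / μ) ^ 2 + (c.M μ * c.Lgxt / μ) ^ 2
          + (c.Cgxt * c.M μ * c.Lgtt / μ ^ 2) ^ 2 + (c.Cgxt * c.Lft / μ ^ 2) ^ 2
          + c.M μ ^ 2 + (c.Cgxt * c.M μ / μ) ^ 2) ≤ 2 * c.C2 μ := by
        rw [Consts.C2, Consts.M]
        have e1 : 0 ≤ (c.Cft / μ) ^ 2 := sq_nonneg _
        have e2 : 0 ≤ (c.Cft * c.Cgxt / μ ^ 2) ^ 2 := sq_nonneg _
        have e3 : 0 ≤ (c.Cft * c.Lgxt / μ ^ 2) ^ 2 := sq_nonneg _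
        have e4 : 0 ≤ (c.Cft * c.Cgxt * c.Lgtt / μ ^ 3) ^ 2 := sq_nonneg _
        have e5 : 0 ≤ (c.Lfx / μ) ^ 2 := sq_nonneg _
        have e6 : 0 ≤ (c.Lft * c.Cgxt / μ ^ 2) ^ 2 := sq_nonneg _
        ring_nf at e1 e2 e3 e4 e5 e6 ⊢
        nlinarith
      have h4 : 8 * (1 + (c.Cgxt / μ) ^ 2) = 2 * c.C1 μ := by
        rw [Consts.C1]; ring
      nlinarith [mul_le_mul_of_nonneg_right h3 hcoef]
    _ = 2 * c.b μ bf bg ^ 2 / m := by rw [hb]; ring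

end HeterogeneityBound

/-! ### One iteration at a single node -/

section NodeStep

variable {n p : ℕ} {f g : E n → E p → ℝ} {c : Consts} {μ : ℝ}

theorem JointLip.sq_le {X : Type*} [NormedAddCommGroup X] {L : ℝ} {F : E n → E p → X}
    (h : JointLip L F) (x x' : E n) (θ θ' : E p) :
    ‖F x θ - F x' θ'‖ ^ 2 ≤ L ^ 2 * (‖x - x'‖ ^ 2 + ‖θ - θ'‖ ^ 2) := by
  refine (pow_le_pow_left₀ (norm_nonneg _) (h x θ x' θ') 2).trans_eq ?_
  rw [mul_pow, Real.sq_sqrt (by positivity)]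

theorem norm_clm_apply_sq_le {X Y : Type*} [NormedAddCommGroup X] [NormedSpace ℝ X]
    [NormedAddCommGroup Y] [NormedSpace ℝ Y] (A : X →L[ℝ] Y) (v : X) {B K : ℝ}
    (hA : ‖A‖ ^ 2 ≤ B) (hv : ‖v‖ ≤ K) : ‖A v‖ ^ 2 ≤ K ^ 2 * B :=
  calc ‖A v‖ ^ 2 ≤ (‖A‖ * ‖v‖) ^ 2 := by gcongr; exact A.le_opNorm v
    _ = ‖v‖ ^ 2 * ‖A‖ ^ 2 := by ring
    _ ≤ K ^ 2 * B := by gcongr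

/-- Error of the approximate local hypergradient. -/
theorem norm_hypergradient_sub_sq_le (hμ : 0 < μ) (hc : c.Pos) (hf : OuterAssumption c f g)
    (hg : InnerAssumption c μ g) (x y : E n) (θ v : E p) :
    ‖gradX f x θ - jacXT g x θ v - gradient (PhiLoc f g) y‖ ^ 2 ≤
      2 * c.Lfgx μ * (‖x - y‖ ^ 2 + ‖θ - innerSol g y‖ ^ 2)
        + 2 * c.Cgxt ^ 2 * ‖v - vStar f g y‖ ^ 2 := by
  have h1 := hf.lipX.sq_le x y θ (innerSol g y)
  have h2 := norm_clm_apply_sq_le _ _ (hg.lipXT.sq_le x y θ (innerSol g y))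
    (hg.norm_vStar_le hμ hf y)
  have h3 : ‖jacXT g x θ (v - vStar f g y)‖ ^ 2 ≤ c.Cgxt ^ 2 * ‖v - vStar f g y‖ ^ 2 := by
    rw [← mul_pow]
    gcongr
    exact (ContinuousLinearMap.le_opNorm _ _).trans (by gcongr; exact hg.bound _ _)
  set D := ‖x - y‖ ^ 2 + ‖θ - innerSol g y‖ ^ 2
  have h4 : gradX f x θ - jacXT g x θ v - gradient (PhiLoc f g) y =
      ((gradX f x θ - gradX f y (innerSol g y)) -
        (jacXT g x θ - jacXT g y (innerSol g y)) (vStar f g y))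
      - jacXT g x θ (v - vStar f g y) := by
    rw [hg.gradient_PhiLoc hμ hc hf, sub_apply, map_sub]
    abel
  rw [h4]
  have h5 := norm_sub_sq_le_two ((gradX f x θ - gradX f y (innerSol g y)) -
        (jacXT g x θ - jacXT g y (innerSol g y)) (vStar f g y)) (jacXT g x θ (v - vStar f g y))
  have h6 := norm_sub_sq_le_two (gradX f x θ - gradX f y (innerSol g y))
    ((jacXT g x θ - jacXT g y (innerSol g y)) (vStar f g y))
  have h7 : 2 * c.Lfgx μ * D = 4 * (c.Lfx ^ 2 * D) + 8 * (c.M μ ^ 2 * (c.Lgxt ^ 2 * D)) := by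
    rw [Consts.Lfgx]; ring
  have h8 : 0 ≤ c.M μ ^ 2 * (c.Lgxt ^ 2 * D) := (sq_nonneg _).trans h2
  linarith

/-- The step is a contraction towards `v*(y)` for the Hessian at the current point, plus the error
of solving the system at `(x, θ)` instead of `(y, θ*(y))`, plus the displacement of the target. Both
perturbations are weighted by the inverse of the contraction rate `lμ/2`. -/
theorem norm_vStep_sub_sq_le (hμ : 0 < μ) (hc : c.Pos) (hf : OuterAssumption c f g)
    (hg : InnerAssumption c μ g) {l : ℝ} (hl : 0 < l) (hlL : l * c.Lgt ^ 2 ≤ μ)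
    (hlμ : l * μ ≤ 1) (x y y' : E n) (θ v : E p) :
    ‖v - l • (hessTT g x θ v - gradT f x θ) - vStar f g y'‖ ^ 2 ≤
      (1 - l * μ / 2) * ‖v - vStar f g y‖ ^ 2
        + 4 * l / μ * c.Lfgt μ * (‖x - y‖ ^ 2 + ‖θ - innerSol g y‖ ^ 2)
        + 4 / (l * μ) * c.LvStar μ ^ 2 * ‖y - y'‖ ^ 2 := by
  set v₀ := vStar f g y
  set H := hessTT g x θ
  set H₀ := hessTT g y (innerSol g y)
  have h0 : H₀ v₀ = gradT f y (innerSol g y) := hg.hessTT_vStar hμ f y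
  have h1 : v - l • (H v - gradT f x θ) - vStar f g y' = ((v - v₀) - l • H (v - v₀))
      + (-(l • ((H - H₀) v₀ - (gradT f x θ - gradT f y (innerSol g y)))))
      + (v₀ - vStar f g y') := by
    rw [← h0, sub_apply, map_sub]
    module
  have h2 : ‖(v - v₀) - l • H (v - v₀)‖ ≤ (1 - l * μ / 2) * ‖v - v₀‖ :=
    norm_sub_smul_le hl.le hlL hlμ (hg.hessTT_coercive x θ _)
      ((ContinuousLinearMap.le_opNorm _ _).trans
        (by gcongr; exact hg.norm_hessTT_le hc.Lgt.le x θ))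
  have h3 := norm_sq_perturbed_contraction (r := l * μ / 2) (by positivity) (by linarith)
    (q := -(l • ((H - H₀) v₀ - (gradT f x θ - gradT f y (innerSol g y)))))
    (e := v₀ - vStar f g y') h2
  rw [h1]
  refine h3.trans ?_
  rw [norm_neg, norm_smul, mul_pow, Real.norm_of_nonneg hl.le]
  have h4 := norm_sub_sq_le_two ((H - H₀) v₀) (gradT f x θ - gradT f y (innerSol g y))
  have h5 := hf.lipT.sq_le x y θ (innerSol g y)
  have h6 := norm_clm_apply_sq_le _ _ (hg.lipTT.sq_le x y θ (innerSol g y))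
    (hg.norm_vStar_le hμ hf y)
  have h7 : ‖v₀ - vStar f g y'‖ ^ 2 ≤ c.LvStar μ ^ 2 * ‖y - y'‖ ^ 2 := by
    rw [← mul_pow]
    exact pow_le_pow_left₀ (norm_nonneg _) (hg.norm_vStar_sub_le hμ hc hf y y') 2
  set D := ‖x - y‖ ^ 2 + ‖θ - innerSol g y‖ ^ 2
  have h8 : ‖(H - H₀) v₀ - (gradT f x θ - gradT f y (innerSol g y))‖ ^ 2 ≤ c.Lfgt μ * D := by
    have h9 : c.Lfgt μ * D = 2 * (c.Lft ^ 2 * D) + 4 * (c.M μ ^ 2 * (c.Lgtt ^ 2 * D)) := by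
      rw [Consts.Lfgt]; ring
    have h10 : 0 ≤ c.M μ ^ 2 * (c.Lgtt ^ 2 * D) := (sq_nonneg _).trans h6
    linarith
  calc _ ≤ (1 - l * μ / 2) * ‖v - v₀‖ ^ 2 + 2 / (l * μ / 2) *
        (l ^ 2 * (c.Lfgt μ * D) + c.LvStar μ ^ 2 * ‖y - y'‖ ^ 2) := by gcongr
    _ = _ := by field_simp; ring

theorem norm_thetaStep_sub_sq_le (hμ : 0 < μ) (hc : c.Pos)
    (hg : InnerAssumption c μ g) {l : ℝ} (hl : 0 < l) (hlL : l * c.Lgt ^ 2 ≤ μ)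
    (hlμ : l * μ ≤ 1) (x y y' : E n) (θ : E p) :
    ‖θ - l • gradT g x θ - innerSol g y'‖ ^ 2 ≤
      (1 - l * μ / 2) * ‖θ - innerSol g y‖ ^ 2
        + 4 * l / μ * c.Cgxt ^ 2 * ‖x - y‖ ^ 2
        + 4 / (l * μ) * c.LthetaStar μ ^ 2 * ‖y - y'‖ ^ 2 := by
  set θ₀ := innerSol g y
  have h0 : gradT g y θ₀ = 0 := hg.gradT_innerSol hμ y
  -- The contraction is run for the field `∇_θ g(y, ·)`, whose zero is `θ*(y)`; evaluating at `x`
  -- instead is treated as a perturbation.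
  have h1 : θ - l • gradT g x θ - innerSol g y' =
      ((θ - θ₀) - l • (gradT g y θ - gradT g y θ₀))
      + (-(l • (gradT g x θ - gradT g y θ))) + (θ₀ - innerSol g y') := by
    rw [h0]
    module
  have h2 : ‖(θ - θ₀) - l • (gradT g y θ - gradT g y θ₀)‖ ≤ (1 - l * μ / 2) * ‖θ - θ₀‖ :=
    norm_sub_smul_le hl.le hlL hlμ (hg.monotone y θ θ₀) (hg.lipT y θ θ₀)
  have h3 := norm_sq_perturbed_contraction (r := l * μ / 2) (by positivity) (by linarith)
    (q := -(l • (gradT g x θ - gradT g y θ))) (e := θ₀ - innerSol g y') h2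
  rw [h1]
  refine h3.trans ?_
  rw [norm_neg, norm_smul, mul_pow, Real.norm_of_nonneg hl.le]
  have h4 : ‖gradT g x θ - gradT g y θ‖ ^ 2 ≤ c.Cgxt ^ 2 * ‖x - y‖ ^ 2 := by
    rw [← mul_pow]
    exact pow_le_pow_left₀ (norm_nonneg _) (hg.norm_gradT_sub_le_left hc.Cgxt.le x y θ) 2
  have h5 : ‖θ₀ - innerSol g y'‖ ^ 2 ≤ c.LthetaStar μ ^ 2 * ‖y - y'‖ ^ 2 := by
    rw [← mul_pow]
    exact pow_le_pow_left₀ (norm_nonneg _) (hg.norm_innerSol_sub_le hμ hc.Cgxt.le y y') 2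
  calc _ ≤ (1 - l * μ / 2) * ‖θ - θ₀‖ ^ 2 + 2 / (l * μ / 2) *
        (l ^ 2 * (c.Cgxt ^ 2 * ‖x - y‖ ^ 2) + c.LthetaStar μ ^ 2 * ‖y - y'‖ ^ 2) := by gcongr
    _ = _ := by field_simp; ring

/-- A momentum step towards `s`, measured against a target that moves from `a` to `a'`. -/
theorem norm_momentum_sub_sq_le {F : Type*} [NormedAddCommGroup F] [NormedSpace ℝ F] {γ : ℝ}
    (h0 : 0 < γ) (h1 : γ < 1) (s z a a' : F) :
    ‖s + (1 - γ) • (z - s) - a'‖ ^ 2 ≤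
      (1 - γ) * ‖z - a‖ ^ 2 + 2 * γ * ‖s - a‖ ^ 2 + 2 / γ * ‖a - a'‖ ^ 2 := by
  have h2 : s + (1 - γ) • (z - s) - a' = (1 - γ) • (z - a) + γ • (s - a) + (a - a') := by module
  have h3 : ‖(1 - γ) • (z - a)‖ ≤ (1 - γ) * ‖z - a‖ := by
    rw [norm_smul, Real.norm_of_nonneg (by linarith)]
  have h4 := norm_sq_perturbed_contraction h0 h1 (q := γ • (s - a)) (e := a - a') h3
  rw [h2]
  refine h4.trans_eq ?_
  rw [norm_smul, mul_pow, Real.norm_of_nonneg h0.le]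
  field_simp
  ring

/-- Convexity of the square handles the relaxation `τ`, so that `τ` multiplies the whole gain of
mixing; Young's inequality with the free parameter `η` separates mixing from the gradient step. -/
theorem norm_relaxed_mix_sq_le {F : Type*} [NormedAddCommGroup F] [InnerProductSpace ℝ F]
    {τ η α : ℝ} (h0 : 0 ≤ τ) (h1 : τ ≤ 1) (hη : 0 < η) (a w q : F) :
    ‖(1 - τ) • a + τ • (w - α • q)‖ ^ 2 ≤
      (1 - τ) * ‖a‖ ^ 2 + τ * ((1 + η) * ‖w‖ ^ 2 + (1 + 1 / η) * (α ^ 2 * ‖q‖ ^ 2)) := by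
  have h2 : ‖(1 - τ) • a + τ • (w - α • q)‖ ^ 2 ≤
      (1 - τ) * ‖a‖ ^ 2 + τ * ‖w - α • q‖ ^ 2 :=
    ((convexOn_univ_norm (E := F)).pow (fun _ _ => norm_nonneg _) 2).2 (Set.mem_univ _)
      (Set.mem_univ _) (sub_nonneg.2 h1) h0 (by ring)
  have h3 : ‖w - α • q‖ ^ 2 ≤ (1 + η) * ‖w‖ ^ 2 + (1 + 1 / η) * (α ^ 2 * ‖q‖ ^ 2) := by
    have h4 : ‖w - α • q‖ ≤ ‖w‖ + |α| * ‖q‖ := by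
      refine (norm_sub_le _ _).trans_eq ?_
      rw [norm_smul, Real.norm_eq_abs]
    have h5 : (‖w‖ + |α| * ‖q‖) ^ 2 ≤ (1 + η) * ‖w‖ ^ 2 + (1 + 1 / η) * (|α| * ‖q‖) ^ 2 := by
      have h6 : 0 ≤ (η * ‖w‖ - |α| * ‖q‖) ^ 2 / η := by positivity
      have h7 : (η * ‖w‖ - |α| * ‖q‖) ^ 2 / η =
          η * ‖w‖ ^ 2 - 2 * ‖w‖ * (|α| * ‖q‖) + 1 / η * (|α| * ‖q‖) ^ 2 := by
        field_simp
        ring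
      nlinarith
    calc _ ≤ (‖w‖ + |α| * ‖q‖) ^ 2 := by gcongr
      _ ≤ _ := h5
      _ = _ := by rw [mul_pow, sq_abs]
  exact h2.trans (by gcongr)

end NodeStep

/-! ### Recursions of the mean errors -/

section StateStep

variable {m n p : ℕ} {f g : Fin m → E n → E p → ℝ} {c : Consts} {μ : ℝ}
  {G : SimpleGraph (Fin m)} {W : Matrix (Fin m) (Fin m) ℝ} {σ : Steps} {S : State m n p}

/-- Mean squared consensus error. -/
noncomputable def errX (S : State m n p) : ℝ := mean fun i => ‖S.x i - avg S.x‖ ^ 2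

/-- Mean squared error of the inner-level variables. -/
noncomputable def errT (g : Fin m → E n → E p → ℝ) (S : State m n p) : ℝ :=
  mean fun i => ‖S.θ i - innerSol (g i) (avg S.x)‖ ^ 2

/-- Mean squared error of the Hessian-inverse-vector variables. -/
noncomputable def errV (f g : Fin m → E n → E p → ℝ) (S : State m n p) : ℝ :=
  mean fun i => ‖S.v i - vStar (f i) (g i) (avg S.x)‖ ^ 2

/-- Mean squared error of the local momenta. -/
noncomputable def errZ (f g : Fin m → E n → E p → ℝ) (S : State m n p) : ℝ :=
  mean fun i => ‖S.z i - gradient (PhiLoc (f i) (g i)) (avg S.x)‖ ^ 2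

/-- Squared error of the averaged momentum. -/
noncomputable def errQ (f g : Fin m → E n → E p → ℝ) (S : State m n p) : ℝ :=
  ‖avg S.z - gradient (Phi f g) (avg S.x)‖ ^ 2

/-- Mean squared error of the approximate local hypergradients. -/
noncomputable def errS (f g : Fin m → E n → E p → ℝ) (S : State m n p) : ℝ :=
  mean fun i => ‖dirS f g S i - gradient (PhiLoc (f i) (g i)) (avg S.x)‖ ^ 2

theorem avg_step (hW : Network G W) (hy : S.y = S.z) :
    avg (step W f g σ S).x = avg S.x - (σ.τ * σ.α) • avg S.z := by
  change avg (fun i => (1 - σ.τ) • S.x i + σ.τ • ((∑ j, W i j • S.x j) - σ.α • S.y i)) = _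
  rw [avg_add, avg_smul, avg_smul, avg_sub, avg_smul, hW.avg_mix, hy]
  module

theorem norm_avg_sub_avg_step_sq (hW : Network G W) (hy : S.y = S.z) :
    ‖avg S.x - avg (step W f g σ S).x‖ ^ 2 = (σ.τ * σ.α) ^ 2 * ‖avg S.z‖ ^ 2 := by
  rw [avg_step hW hy, sub_sub_cancel, norm_smul, mul_pow, Real.norm_eq_abs, sq_abs]

theorem errS_le (hμ : 0 < μ) (hc : c.Pos) (hf : ∀ i, OuterAssumption c (f i) (g i))
    (hg : ∀ i, InnerAssumption c μ (g i)) :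
    errS f g S ≤ 2 * c.Lfgx μ * (errX S + errT g S) + 2 * c.Cgxt ^ 2 * errV f g S := by
  refine (mean_mono fun i => norm_hypergradient_sub_sq_le hμ hc (hf i) (hg i) (S.x i) (avg S.x)
    (S.θ i) (S.v i)).trans_eq ?_
  simp only [mean_add, mean_const_mul]
  rfl

theorem errV_step_le (hW : Network G W) (hy : S.y = S.z) (hμ : 0 < μ) (hc : c.Pos)
    (hf : ∀ i, OuterAssumption c (f i) (g i)) (hg : ∀ i, InnerAssumption c μ (g i))
    (hl : 0 < σ.lam) (hlL : σ.lam * c.Lgt ^ 2 ≤ μ) (hlμ : σ.lam * μ ≤ 1) :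
    errV f g (step W f g σ S) ≤ (1 - σ.lam * μ / 2) * errV f g S
      + 4 * σ.lam / μ * c.Lfgt μ * (errX S + errT g S)
      + 4 / (σ.lam * μ) * c.LvStar μ ^ 2 * ((σ.τ * σ.α) ^ 2 * ‖avg S.z‖ ^ 2) := by
  refine (mean_mono fun i => norm_vStep_sub_sq_le hμ hc (hf i) (hg i) hl hlL hlμ (S.x i) (avg S.x)
    (avg (step W f g σ S).x) (S.θ i) (S.v i)).trans_eq ?_
  simp only [mean_add, mean_const_mul, norm_avg_sub_avg_step_sq hW hy, mean_const hW.pos]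
  rfl

theorem errT_step_le (hW : Network G W) (hy : S.y = S.z) (hμ : 0 < μ) (hc : c.Pos)
    (hg : ∀ i, InnerAssumption c μ (g i))
    (hl : 0 < σ.β) (hlL : σ.β * c.Lgt ^ 2 ≤ μ) (hlμ : σ.β * μ ≤ 1) :
    errT g (step W f g σ S) ≤ (1 - σ.β * μ / 2) * errT g S
      + 4 * σ.β / μ * c.Cgxt ^ 2 * errX S
      + 4 / (σ.β * μ) * c.LthetaStar μ ^ 2 * ((σ.τ * σ.α) ^ 2 * ‖avg S.z‖ ^ 2) := by
  refine (mean_mono fun i => norm_thetaStep_sub_sq_le hμ hc (hg i) hl hlL hlμ (S.x i) (avg S.x)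
    (avg (step W f g σ S).x) (S.θ i)).trans_eq ?_
  simp only [mean_add, mean_const_mul, norm_avg_sub_avg_step_sq hW hy, mean_const hW.pos]
  rfl

theorem errZ_step_le (hW : Network G W) (hy : S.y = S.z) (hμ : 0 < μ) (hc : c.Pos)
    (hf : ∀ i, OuterAssumption c (f i) (g i)) (hg : ∀ i, InnerAssumption c μ (g i))
    (h0 : 0 < σ.γ) (h1 : σ.γ < 1) :
    errZ f g (step W f g σ S) ≤ (1 - σ.γ) * errZ f g S + 2 * σ.γ * errS f g S
      + 2 / σ.γ * (c.L μ ^ 2 * ((σ.τ * σ.α) ^ 2 * ‖avg S.z‖ ^ 2)) := by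
  have h2 : ∀ i, ‖(step W f g σ S).z i -
      gradient (PhiLoc (f i) (g i)) (avg (step W f g σ S).x)‖ ^ 2 ≤
      (1 - σ.γ) * ‖S.z i - gradient (PhiLoc (f i) (g i)) (avg S.x)‖ ^ 2
      + 2 * σ.γ * ‖dirS f g S i - gradient (PhiLoc (f i) (g i)) (avg S.x)‖ ^ 2
      + 2 / σ.γ * (c.L μ ^ 2 * ((σ.τ * σ.α) ^ 2 * ‖avg S.z‖ ^ 2)) := by
    intro i
    refine (norm_momentum_sub_sq_le h0 h1 (dirS f g S i) (S.z i)
      (gradient (PhiLoc (f i) (g i)) (avg S.x)) _).trans ?_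
    gcongr
    rw [← norm_avg_sub_avg_step_sq (f := f) (g := g) hW hy, ← mul_pow]
    exact pow_le_pow_left₀ (norm_nonneg _) ((hg i).norm_gradient_PhiLoc_sub_le hμ hc (hf i) _ _) 2
  refine (mean_mono h2).trans_eq ?_
  simp only [mean_add, mean_const_mul, mean_const hW.pos]
  rfl

/-- The averaged momentum is itself a momentum step, towards the average of the directions. It is
tracked apart from `errZ` because only this error enters the descent of `Φ`. -/
theorem errQ_step_le (hW : Network G W) (hy : S.y = S.z) (hμ : 0 < μ) (hc : c.Pos)
    (hf : ∀ i, OuterAssumption c (f i) (g i)) (hg : ∀ i, InnerAssumption c μ (g i))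
    (h0 : 0 < σ.γ) (h1 : σ.γ < 1) :
    errQ f g (step W f g σ S) ≤ (1 - σ.γ) * errQ f g S + 2 * σ.γ * errS f g S
      + 2 / σ.γ * (c.L μ ^ 2 * ((σ.τ * σ.α) ^ 2 * ‖avg S.z‖ ^ 2)) := by
  have hz : avg (step W f g σ S).z =
      avg (dirS f g S) + (1 - σ.γ) • (avg S.z - avg (dirS f g S)) := by
    change avg (fun i => dirS f g S i + (1 - σ.γ) • (S.z i - dirS f g S i)) = _
    rw [avg_add, avg_smul, avg_sub]
  have h2 := norm_momentum_sub_sq_le h0 h1 (avg (dirS f g S)) (avg S.z)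
    (gradient (Phi f g) (avg S.x)) (gradient (Phi f g) (avg (step W f g σ S).x))
  have h3 : ‖avg (dirS f g S) - gradient (Phi f g) (avg S.x)‖ ^ 2 ≤ errS f g S := by
    rw [gradient_Phi hμ hc hf hg, ← avg_sub]
    exact norm_avg_sq_le hW.pos _
  rw [errQ, hz]
  refine h2.trans ?_
  rw [errQ]
  gcongr
  rw [← norm_avg_sub_avg_step_sq (f := f) (g := g) hW hy, ← mul_pow]
  exact pow_le_pow_left₀ (norm_nonneg _) (norm_gradient_Phi_sub_le hW.pos hμ hc hf hg _ _) 2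

theorem errX_step_le (hW : Network G W) (hy : S.y = S.z) (hμ : 0 < μ) (hc : c.Pos)
    (hf : ∀ i, OuterAssumption c (f i) (g i)) (hg : ∀ i, InnerAssumption c μ (g i))
    {bf bg : ℝ} (hh : Heterogeneity bf bg f g) (h0 : 0 ≤ σ.τ) (h1 : σ.τ ≤ 1) :
    errX (step W f g σ S) ≤ (1 - σ.τ * (1 - rho W) / 2) * errX S
      + 3 * σ.τ * σ.α ^ 2 / (1 - rho W) * (2 * errZ f g S + 4 * c.b μ bf bg ^ 2 / m) := by
  have hm := hW.pos
  have hρ := hW.rho_lt_one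
  have hρ0 := rho_nonneg W
  set r := 1 - rho W with hr
  have hr0 : 0 < r := by linarith
  have hx : ∀ i, (step W f g σ S).x i - avg (step W f g σ S).x =
      (1 - σ.τ) • (S.x i - avg S.x) +
        σ.τ • (((∑ j, W i j • S.x j) - avg S.x) - σ.α • (S.z i - avg S.z)) := by
    intro i
    rw [avg_step hW hy]
    change (1 - σ.τ) • S.x i + σ.τ • ((∑ j, W i j • S.x j) - σ.α • S.y i) - _ = _
    rw [hy]
    module
  have h2 : errX (step W f g σ S) ≤ (1 - σ.τ) * errX S + σ.τ * ((1 + r / 2) * (rho W * errX S)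
      + (1 + 1 / (r / 2)) * (σ.α ^ 2 * mean fun i => ‖S.z i - avg S.z‖ ^ 2)) := by
    rw [errX]
    simp only [hx]
    refine (mean_mono fun i => norm_relaxed_mix_sq_le h0 h1 (half_pos hr0) _ _ _).trans ?_
    simp only [mean_add, mean_const_mul]
    have := hW.mix_contraction S.x
    gcongr
    · exact le_rfl
    · exact this
  have h3 : (mean fun i => ‖S.z i - avg S.z‖ ^ 2) ≤ 2 * errZ f g S + 4 * c.b μ bf bg ^ 2 / m := by
    refine (mean_norm_sub_avg_sq_le hm S.z (gradient (Phi f g) (avg S.x))).trans ?_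
    have h4 := hh.gradient_PhiLoc hm hμ hc hf hg (avg S.x)
    have h5 : ∀ i, ‖S.z i - gradient (Phi f g) (avg S.x)‖ ^ 2 ≤
        2 * (‖S.z i - gradient (PhiLoc (f i) (g i)) (avg S.x)‖ ^ 2 +
          ‖gradient (PhiLoc (f i) (g i)) (avg S.x) - gradient (Phi f g) (avg S.x)‖ ^ 2) :=
      fun i => by
        rw [← sub_add_sub_cancel (S.z i) (gradient (PhiLoc (f i) (g i)) (avg S.x))]
        exact norm_add_sq_le_two _ _
    refine (mean_mono h5).trans ?_
    rw [mean_const_mul, mean_add, errZ]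
    have h6 : 4 * c.b μ bf bg ^ 2 / m = 2 * (2 * c.b μ bf bg ^ 2 / m) := by ring
    rw [h6]
    linarith
  have hX : 0 ≤ errX S := mean_nonneg fun i => sq_nonneg _
  have hY : 0 ≤ mean fun i => ‖S.z i - avg S.z‖ ^ 2 := mean_nonneg fun i => sq_nonneg _
  -- With `η = r/2` and `rho W = 1 - r`, half of the spectral gap survives Young's inequality: `(1 +
  -- r/2)(1 - r) ≤ 1 - r/2`.
  have h7 : (1 + r / 2) * (rho W * errX S) ≤ (1 - r / 2) * errX S := by
    rw [← mul_assoc]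
    refine mul_le_mul_of_nonneg_right ?_ hX
    have : rho W = 1 - r := by rw [hr]; ring
    rw [this]
    nlinarith
  have h8 : 1 + 1 / (r / 2) ≤ 3 / r := by
    have : r ≤ 1 := by linarith
    rw [one_div_div, ← sub_nonneg, show 3 / r - (1 + 2 / r) = (1 - r) / r by field_simp; ring]
    exact div_nonneg (by linarith) hr0.le
  calc _ ≤ _ := h2
    _ ≤ (1 - σ.τ) * errX S + σ.τ * ((1 - r / 2) * errX S + 3 / r *
        (σ.α ^ 2 * (2 * errZ f g S + 4 * c.b μ bf bg ^ 2 / m))) := by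
      gcongr
    _ = _ := by ring

/-- Polarization of `⟪∇Φ, z̄⟫` in the descent lemma. Keeping `-‖z̄‖²` is essential, since every
drift term is a multiple of `‖z̄‖²`. -/
theorem Phi_step_le (hW : Network G W) (hy : S.y = S.z) (hμ : 0 < μ) (hc : c.Pos)
    (hf : ∀ i, OuterAssumption c (f i) (g i)) (hg : ∀ i, InnerAssumption c μ (g i)) :
    Phi f g (avg (step W f g σ S).x) ≤ Phi f g (avg S.x)
      - σ.τ * σ.α / 2 * (‖gradient (Phi f g) (avg S.x)‖ ^ 2 + ‖avg S.z‖ ^ 2 - errQ f g S)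
      + c.L μ * ((σ.τ * σ.α) ^ 2 * ‖avg S.z‖ ^ 2) := by
  have hL : 0 ≤ c.L μ := by
    have := hc.Lfx; have := hc.Lft; have := hc.Cft; have := hc.Lgtt; have := hc.Lgxt
    have := hc.Cgxt
    rw [Consts.L, Consts.Lf, Consts.Lv, Consts.LthetaStar]
    positivity
  have h1 := le_add_inner_of_lipschitz_gradient hL
    (fun x => (hasGradientAt_Phi hμ hc hf hg x).differentiableAt.hasGradientAt)
    (norm_gradient_Phi_sub_le hW.pos hμ hc hf hg) (avg S.x) (avg (step W f g σ S).x)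
  rw [norm_sub_rev, norm_avg_sub_avg_step_sq hW hy] at h1
  refine h1.trans (le_of_eq ?_)
  rw [avg_step hW hy, sub_sub_cancel_left, inner_neg_right, real_inner_smul_right, errQ,
    norm_sub_sq_real, real_inner_comm]
  ring

end StateStep

/-! ### Decrease of the weighted errors -/

section Lyapunov

/-- The weighted errors decrease along one iteration, given the recursions of the single errors. -/
theorem lyapunov_decrease {τ α μ C A Lx Lt φ cγ cl cβ L Lv Lθ r F F' X X' T T' V V' Q Q' Z Z' S G N
    B : ℝ} (hτ : 0 < τ) (hα : 0 < α) (hμ : 0 < μ) (hA : 0 < A) (hφ : 0 < φ)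
    (hcγ : 0 < cγ) (hcl : 0 < cl) (hcβ : 0 < cβ) (hr : 0 < r)
    (hX0 : 0 ≤ X) (hT0 : 0 ≤ T) (hS0 : 0 ≤ S) (hN0 : 0 ≤ N)
    (hF : F' ≤ F - τ * α / 2 * (G + N - Q) + L * ((τ * α) ^ 2 * N))
    (hQ : Q' ≤ (1 - cγ * α) * Q + 2 * (cγ * α) * S
      + 2 / (cγ * α) * (L ^ 2 * ((τ * α) ^ 2 * N)))
    (hZ : Z' ≤ (1 - cγ * α) * Z + 2 * (cγ * α) * S
      + 2 / (cγ * α) * (L ^ 2 * ((τ * α) ^ 2 * N)))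
    (hS : S ≤ 2 * Lx * (X + T) + 2 * C ^ 2 * V)
    (hV : V' ≤ (1 - cl * α * μ / 2) * V + 4 * (cl * α) / μ * Lt * (X + T)
      + 4 / (cl * α * μ) * Lv ^ 2 * ((τ * α) ^ 2 * N))
    (hT : T' ≤ (1 - cβ * α * μ / 2) * T + 4 * (cβ * α) / μ * C ^ 2 * X
      + 4 / (cβ * α * μ) * Lθ ^ 2 * ((τ * α) ^ 2 * N))
    (hX : X' ≤ (1 - τ * r / 2) * X + 3 * τ * α ^ 2 / r * (2 * Z + B))
    (hAdef : Lx + 32 * C ^ 2 * Lt / μ ^ 2 ≤ A) (hLt : 0 ≤ Lt)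
    (hφA : A * (1 + 16 * C ^ 2 / μ ^ 2) ≤ φ)
    (hαφ : 96 * φ * α ^ 2 / r ^ 2 ≤ 1) (hLα : L * τ * α ≤ 1 / 8)
    (h1 : (L * τ / cγ) ^ 2 ≤ 1 / 16) (h2 : (C * Lv * τ / (μ * cl)) ^ 2 ≤ 1 / 256)
    (h3 : A * (Lθ * τ / (μ * cβ)) ^ 2 ≤ 1 / 256) :
    F' + 8 * C ^ 2 * τ / (μ * cl) * V' + 8 * A * τ / (μ * cβ) * T' + τ / (2 * cγ) * Q'
        + 48 * φ * α ^ 2 * τ / (r ^ 2 * cγ) * Z' + 8 * α * φ / r * X'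
      ≤ F + 8 * C ^ 2 * τ / (μ * cl) * V + 8 * A * τ / (μ * cβ) * T + τ / (2 * cγ) * Q
        + 48 * φ * α ^ 2 * τ / (r ^ 2 * cγ) * Z + 8 * α * φ / r * X
        - τ * α / 2 * G + 24 * φ * τ * α ^ 3 / r ^ 2 * B := by
  set ε := 96 * φ * α ^ 2 / r ^ 2 with hε
  set P := (L * τ / cγ) ^ 2 with hP
  set O := (C * Lv * τ / (μ * cl)) ^ 2 with hO
  set R := A * (Lθ * τ / (μ * cβ)) ^ 2 with hR
  set D := C ^ 2 / μ ^ 2 with hD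
  have hD0 : 0 ≤ D := by positivity
  have hP0 : 0 ≤ P := sq_nonneg _
  have kQ : τ / (2 * cγ) * Q' ≤ τ / (2 * cγ) * Q - τ * α * (Q / 2) + τ * α * S
      + τ * α * (P * N) := by
    refine (mul_le_mul_of_nonneg_left hQ (by positivity)).trans_eq ?_
    rw [hP]
    field_simp
  -- The weight is chosen so that the decay of `Z` is exactly the `ε/2 · Z` that `kX` feeds in; `ε ≤
  -- 1` then makes the cost in `S` no larger than that of `kQ`.
  have kZ : 48 * φ * α ^ 2 * τ / (r ^ 2 * cγ) * Z' ≤ 48 * φ * α ^ 2 * τ / (r ^ 2 * cγ) * Z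
      - τ * α * (ε / 2 * Z) + τ * α * (ε * S) + τ * α * (ε * (P * N)) := by
    refine (mul_le_mul_of_nonneg_left hZ (by positivity)).trans_eq ?_
    rw [hP, hε]
    field_simp
    ring
  have kV : 8 * C ^ 2 * τ / (μ * cl) * V' ≤ 8 * C ^ 2 * τ / (μ * cl) * V
      - τ * α * (4 * C ^ 2 * V) + τ * α * (32 * D * Lt * (X + T)) + τ * α * (32 * O * N) := by
    refine (mul_le_mul_of_nonneg_left hV (by positivity)).trans_eq ?_
    rw [hO, hD]
    field_simp
    ring
  have kT : 8 * A * τ / (μ * cβ) * T' ≤ 8 * A * τ / (μ * cβ) * T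
      - τ * α * (4 * A * T) + τ * α * (32 * A * D * X) + τ * α * (32 * R * N) := by
    refine (mul_le_mul_of_nonneg_left hT (by positivity)).trans_eq ?_
    rw [hR, hD]
    field_simp
    ring
  have kX : 8 * α * φ / r * X' ≤ 8 * α * φ / r * X
      - τ * α * (4 * φ * X) + τ * α * (ε / 2 * Z) + 24 * φ * τ * α ^ 3 / r ^ 2 * B := by
    refine (mul_le_mul_of_nonneg_left hX (by positivity)).trans_eq ?_
    rw [hε]
    field_simp
    ring
  have kF : F' ≤ F - τ * α * (G / 2) - τ * α * (N / 2) + τ * α * (Q / 2)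
      + τ * α * (L * τ * α * N) := hF.trans_eq (by ring)
  have e1 : 32 * C ^ 2 * Lt / μ ^ 2 = 32 * D * Lt := by rw [hD]; ring
  have e2 : A * (1 + 16 * C ^ 2 / μ ^ 2) = A + 16 * (A * D) := by rw [hD]; ring
  rw [e1] at hAdef
  rw [e2] at hφA
  have s1 : ε * S ≤ S := mul_le_of_le_one_left hS0 hαφ
  have s2 : ε * (P * N) ≤ P * N := mul_le_of_le_one_left (by positivity) hαφ
  have s3 : (Lx + 32 * D * Lt) * T ≤ A * T := mul_le_mul_of_nonneg_right hAdef hT0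
  have s4 : (Lx + 32 * D * Lt) * X ≤ A * X := mul_le_mul_of_nonneg_right hAdef hX0
  have s5 : (A + 16 * (A * D)) * X ≤ φ * X := mul_le_mul_of_nonneg_right hφA hX0
  have s6 : (L * τ * α) * N ≤ 1 / 8 * N := mul_le_mul_of_nonneg_right hLα hN0
  have s7 : P * N ≤ 1 / 16 * N := mul_le_mul_of_nonneg_right h1 hN0
  have s8 : O * N ≤ 1 / 256 * N := mul_le_mul_of_nonneg_right h2 hN0
  have s9 : R * N ≤ 1 / 256 * N := mul_le_mul_of_nonneg_right h3 hN0
  have s10 : 0 ≤ A * D * X := by positivity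
  have s11 : 0 ≤ D * Lt * X := by positivity
  have s12 : 0 ≤ D * Lt * T := by positivity
  -- Budget in units of `τα`. The two copies of `S` cost at most `4 * Lx * (X + T) + 4 * C ^ 2 * V`,
  -- which the decay of `V`, `T` and `X` covers through the definitions of `A` and `φ`. The
  -- multiples of `N` add up to at most `1/8 + 2 · 1/16 + 2 · 32/256 = 1/2`.
  have key : -(N / 2) + L * τ * α * N + S + P * N + ε * S + ε * (P * N) - 4 * C ^ 2 * V
      + 32 * D * Lt * (X + T) + 32 * O * N - 4 * A * T + 32 * A * D * X + 32 * R * N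
      - 4 * φ * X ≤ 0 := by
    linarith
  have key' := mul_nonpos_of_nonneg_of_nonpos (mul_pos hτ hα).le key
  linarith

end Lyapunov

/-! ### Telescoping the Lyapunov function -/

section Convergence

variable {m n p : ℕ} {f g : Fin m → E n → E p → ℝ} {c : Consts} {μ : ℝ}
  {G : SimpleGraph (Fin m)} {W : Matrix (Fin m) (Fin m) ℝ} {σ : Steps}

/-- The Lyapunov function. -/
noncomputable def lyapunov (c : Consts) (μ cγ cl cβ r τ α ℓ : ℝ) (f g : Fin m → E n → E p → ℝ)
    (S : State m n p) : ℝ :=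
  (Phi f g (avg S.x) - ℓ) + 8 * c.Cgxt ^ 2 * τ / (μ * cl) * errV f g S
    + 8 * c.A μ * τ / (μ * cβ) * errT g S + τ / (2 * cγ) * errQ f g S
    + 48 * c.phi μ * α ^ 2 * τ / (r ^ 2 * cγ) * errZ f g S + 8 * α * c.phi μ / r * errX S

theorem run_succ (S : State m n p) (k : ℕ) :
    run W f g σ S (k + 1) = step W f g σ (run W f g σ S k) :=
  Function.iterate_succ_apply' _ _ _

theorem run_y_eq_z {S : State m n p} (hy : S.y = S.z) (k : ℕ) :
    (run W f g σ S k).y = (run W f g σ S k).z := by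
  cases k with
  | zero => exact hy
  | succ k => rw [run_succ]; rfl

theorem errX_nonneg (S : State m n p) : 0 ≤ errX S := mean_nonneg fun _ => sq_nonneg _

theorem errT_nonneg (S : State m n p) : 0 ≤ errT g S := mean_nonneg fun _ => sq_nonneg _

theorem errV_nonneg (S : State m n p) : 0 ≤ errV f g S := mean_nonneg fun _ => sq_nonneg _

theorem errZ_nonneg (S : State m n p) : 0 ≤ errZ f g S := mean_nonneg fun _ => sq_nonneg _

theorem errS_nonneg (S : State m n p) : 0 ≤ errS f g S := mean_nonneg fun _ => sq_nonneg _

theorem errQ_nonneg (S : State m n p) : 0 ≤ errQ f g S := sq_nonneg _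

theorem errQ_le_errZ (hm : 0 < m) (hμ : 0 < μ) (hc : c.Pos)
    (hf : ∀ i, OuterAssumption c (f i) (g i)) (hg : ∀ i, InnerAssumption c μ (g i))
    (S : State m n p) : errQ f g S ≤ errZ f g S := by
  rw [errQ, gradient_Phi hμ hc hf hg, ← avg_sub]
  exact norm_avg_sq_le hm _

/-- Conditions on the step-sizes. -/
structure Admissible (c : Consts) (μ cγ cl cβ r : ℝ) (σ : Steps) : Prop where
  τ_pos : 0 < σ.τ
  τ_le : σ.τ ≤ 1
  α_pos : 0 < σ.α
  cγ_pos : 0 < cγ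
  cl_pos : 0 < cl
  cβ_pos : 0 < cβ
  γ_eq : σ.γ = cγ * σ.α
  lam_eq : σ.lam = cl * σ.α
  β_eq : σ.β = cβ * σ.α
  γ_lt : σ.γ < 1
  lam_mul_sq_le : σ.lam * c.Lgt ^ 2 ≤ μ
  lam_mul_le : σ.lam * μ ≤ 1
  β_mul_sq_le : σ.β * c.Lgt ^ 2 ≤ μ
  β_mul_le : σ.β * μ ≤ 1
  consensus : 96 * c.phi μ * σ.α ^ 2 / r ^ 2 ≤ 1
  descent : c.L μ * σ.τ * σ.α ≤ 1 / 8
  momentum : (c.L μ * σ.τ / cγ) ^ 2 ≤ 1 / 16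
  hessian : (c.Cgxt * c.LvStar μ * σ.τ / (μ * cl)) ^ 2 ≤ 1 / 256
  inner : c.A μ * (c.LthetaStar μ * σ.τ / (μ * cβ)) ^ 2 ≤ 1 / 256

theorem Consts.Pos.M (hc : c.Pos) (hμ : 0 < μ) : 0 < c.M μ := by
  have := hc.Cft
  rw [Consts.M]; positivity

theorem Consts.Pos.Lfgx' (hc : c.Pos) (hμ : 0 < μ) : 2 * c.Lfx ^ 2 ≤ c.Lfgx μ := by
  rw [Consts.Lfgx]
  have := hc.M hμ
  exact le_add_of_nonneg_right (by positivity)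

theorem Consts.Pos.Lfgt' (hc : c.Pos) (hμ : 0 < μ) : 0 < c.Lfgt μ := by
  have := hc.M hμ; have := hc.Lft
  rw [Consts.Lfgt]; positivity

theorem Consts.Pos.Lfgx_le_A (hc : c.Pos) (hμ : 0 < μ) : c.Lfgx μ ≤ c.A μ := by
  have := hc.Lfgt' hμ
  rw [Consts.A]
  exact le_add_of_nonneg_right (by positivity)

theorem Consts.Pos.A' (hc : c.Pos) (hμ : 0 < μ) : 0 < c.A μ := by
  have h1 := hc.Lfgx' hμ
  have h2 := hc.Lfgx_le_A hμ
  have := hc.Lfx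
  exact lt_of_lt_of_le (by positivity) (h1.trans h2)

theorem Consts.Pos.omega' (hc : c.Pos) (hμ : 0 < μ) : 0 < c.omega μ := by
  have := hc.Lgt
  rw [Consts.omega]; positivity

theorem Consts.Pos.omega_le (hc : c.Pos) (hμ : 0 < μ) : c.omega μ ≤ μ / 2 := by
  have := hc.Lgt
  rw [Consts.omega, div_le_div_iff₀ (by positivity) (by positivity)]
  nlinarith [mul_pos hμ hμ]

/-- Since `ω ≤ μ/2`, the factor `4/ω²` in `φ` dominates `16/μ²`. It is used with `C = C_{g,xθ}` for
the Lyapunov decrease and with `C = L_{g,θ}` for the step-sizes. -/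
theorem Consts.Pos.le_phi (hc : c.Pos) (hμ : 0 < μ) {C : ℝ} (hC : 0 ≤ C)
    (hC' : C ≤ max c.Lgt c.Cgxt) : c.A μ * (1 + 16 * C ^ 2 / μ ^ 2) ≤ c.phi μ := by
  have h1 := hc.omega_le hμ
  have h2 := hc.omega' hμ
  have h3 := hc.A' hμ
  rw [Consts.phi]
  have h4 : 16 * C ^ 2 / μ ^ 2 = 4 * C ^ 2 / (μ / 2) ^ 2 := by field_simp; ring
  rw [h4]
  gcongr

theorem Consts.Pos.A_le_phi (hc : c.Pos) (hμ : 0 < μ) : c.A μ ≤ c.phi μ := by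
  have h := hc.le_phi hμ le_rfl (hc.Lgt.le.trans (le_max_left _ _))
  simpa using h

theorem Consts.Pos.phi' (hc : c.Pos) (hμ : 0 < μ) : 0 < c.phi μ :=
  (hc.A' hμ).trans_le (hc.A_le_phi hμ)

theorem lyapunov_step_le {cγ cl cβ : ℝ} (hW : Network G W) (hμ : 0 < μ) (hc : c.Pos)
    (hf : ∀ i, OuterAssumption c (f i) (g i)) (hg : ∀ i, InnerAssumption c μ (g i))
    {bf bg : ℝ} (hh : Heterogeneity bf bg f g) (ℓ : ℝ)
    (hσ : Admissible c μ cγ cl cβ (1 - rho W) σ) {S : State m n p} (hy : S.y = S.z) :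
    lyapunov c μ cγ cl cβ (1 - rho W) σ.τ σ.α ℓ f g (step W f g σ S) ≤
      lyapunov c μ cγ cl cβ (1 - rho W) σ.τ σ.α ℓ f g S
        - σ.τ * σ.α / 2 * ‖gradient (Phi f g) (avg S.x)‖ ^ 2
        + 24 * c.phi μ * σ.τ * σ.α ^ 3 / (1 - rho W) ^ 2 * (4 * c.b μ bf bg ^ 2 / m) := by
  have hα := hσ.α_pos
  have hγ : 0 < σ.γ := by rw [hσ.γ_eq]; exact mul_pos hσ.cγ_pos hα
  have hlam : 0 < σ.lam := by rw [hσ.lam_eq]; exact mul_pos hσ.cl_pos hα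
  have hβ : 0 < σ.β := by rw [hσ.β_eq]; exact mul_pos hσ.cβ_pos hα
  have kF := Phi_step_le (σ := σ) hW hy hμ hc hf hg
  have kQ := errQ_step_le hW hy hμ hc hf hg hγ hσ.γ_lt
  have kZ := errZ_step_le hW hy hμ hc hf hg hγ hσ.γ_lt
  have kS := errS_le (S := S) hμ hc hf hg
  have kV := errV_step_le hW hy hμ hc hf hg hlam hσ.lam_mul_sq_le hσ.lam_mul_le
  have kT := errT_step_le (f := f) hW hy hμ hc hg hβ hσ.β_mul_sq_le hσ.β_mul_le
  have kX := errX_step_le hW hy hμ hc hf hg hh hσ.τ_pos.le hσ.τ_le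
  rw [hσ.γ_eq] at kQ kZ
  rw [hσ.lam_eq] at kV
  rw [hσ.β_eq] at kT
  have key := lyapunov_decrease hσ.τ_pos hα hμ (hc.A' hμ) (hc.phi' hμ) hσ.cγ_pos hσ.cl_pos
    hσ.cβ_pos (sub_pos.2 hW.rho_lt_one) (errX_nonneg S) (errT_nonneg S) (errS_nonneg S)
    (sq_nonneg _) kF kQ kZ kS kV kT kX le_rfl (hc.Lfgt' hμ).le
    (hc.le_phi hμ hc.Cgxt.le (le_max_right _ _)) hσ.consensus hσ.descent hσ.momentum hσ.hessian
    hσ.inner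
  rw [lyapunov, lyapunov]
  linarith

theorem lyapunov_nonneg {cγ cl cβ r τ α ℓ : ℝ} (hμ : 0 < μ) (hc : c.Pos) (hcγ : 0 < cγ)
    (hcl : 0 < cl) (hcβ : 0 < cβ) (hr : 0 < r) (hτ : 0 < τ) (hα : 0 ≤ α)
    (hℓ : ∀ x, ℓ ≤ Phi f g x) (S : State m n p) :
    0 ≤ lyapunov c μ cγ cl cβ r τ α ℓ f g S := by
  have h1 := sub_nonneg.2 (hℓ (avg S.x))
  have h2 := errX_nonneg S
  have h3 := errT_nonneg (g := g) S
  have h4 := errV_nonneg (f := f) (g := g) S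
  have h5 := errZ_nonneg (f := f) (g := g) S
  have h6 := errQ_nonneg (f := f) (g := g) S
  have h7 := hc.A' hμ
  have h8 := hc.phi' hμ
  rw [lyapunov]
  positivity

/-- Summing the decrease and dropping the nonnegative final value. Division by `τα` turns the
heterogeneity term from `τα³` into `α²`, free of `τ`. -/
theorem mean_gradient_le_lyapunov {cγ cl cβ : ℝ} (hW : Network G W) (hμ : 0 < μ) (hc : c.Pos)
    (hf : ∀ i, OuterAssumption c (f i) (g i)) (hg : ∀ i, InnerAssumption c μ (g i))
    {bf bg : ℝ} (hh : Heterogeneity bf bg f g) {ℓ : ℝ} (hℓ : ∀ x, ℓ ≤ Phi f g x)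
    (hσ : Admissible c μ cγ cl cβ (1 - rho W) σ) {S : State m n p} (hy : S.y = S.z) (K : ℕ) :
    (1 / ((K : ℝ) + 1)) * ∑ k ∈ Finset.range (K + 1),
        ‖gradient (Phi f g) (avg (run W f g σ S k).x)‖ ^ 2 ≤
      2 * lyapunov c μ cγ cl cβ (1 - rho W) σ.τ σ.α ℓ f g S / (σ.τ * σ.α * ((K : ℝ) + 1))
        + 192 * c.phi μ * σ.α ^ 2 / (1 - rho W) ^ 2 * (c.b μ bf bg ^ 2 / m) := by
  have hα := hσ.α_pos
  have hτ := hσ.τ_pos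
  have hr := sub_pos.2 hW.rho_lt_one
  set B := 24 * c.phi μ * σ.τ * σ.α ^ 3 / (1 - rho W) ^ 2 * (4 * c.b μ bf bg ^ 2 / m) with hB
  have hsum : ∀ N : ℕ, σ.τ * σ.α / 2 * ∑ k ∈ Finset.range N,
      ‖gradient (Phi f g) (avg (run W f g σ S k).x)‖ ^ 2
      + lyapunov c μ cγ cl cβ (1 - rho W) σ.τ σ.α ℓ f g (run W f g σ S N)
      ≤ lyapunov c μ cγ cl cβ (1 - rho W) σ.τ σ.α ℓ f g S + N * B := by
    intro N
    induction N with
    | zero => simp [run]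
    | succ N ih =>
      have h1 := lyapunov_step_le hW hμ hc hf hg hh ℓ hσ
        (run_y_eq_z (W := W) (f := f) (g := g) (σ := σ) hy N)
      rw [← run_succ] at h1
      rw [Finset.sum_range_succ, Nat.cast_succ]
      linarith
  have h2 := hsum (K + 1)
  have h3 := lyapunov_nonneg hμ hc hσ.cγ_pos hσ.cl_pos hσ.cβ_pos hr hτ hα.le hℓ
    (run W f g σ S (K + 1))
  set T := ∑ k ∈ Finset.range (K + 1), ‖gradient (Phi f g) (avg (run W f g σ S k).x)‖ ^ 2
  set V := lyapunov c μ cγ cl cβ (1 - rho W) σ.τ σ.α ℓ f g S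
  have hK : (0 : ℝ) < (K : ℝ) + 1 := by positivity
  have h4 : σ.τ * σ.α / 2 * T ≤ V + ((K : ℝ) + 1) * B := by
    push_cast at h2
    linarith
  have h5 : (1 / ((K : ℝ) + 1)) * T =
      2 / (σ.τ * σ.α * ((K : ℝ) + 1)) * (σ.τ * σ.α / 2 * T) := by
    field_simp
  rw [h5]
  refine (mul_le_mul_of_nonneg_left h4 (by positivity)).trans_eq ?_
  rw [hB]
  field_simp
  ring

end Convergence

/-! ### Growth of the constants with the condition number -/

section Scaling

variable {c : Consts} {μ κ Λ : ℝ}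

theorem Consts.one_add_LthetaStar_le (c : Consts) (hκ : 1 ≤ κ) :
    1 + c.LthetaStar (Λ / κ) ≤ κ * (1 + c.LthetaStar Λ) := by
  have h : c.LthetaStar (Λ / κ) = κ * c.LthetaStar Λ := by
    simp only [Consts.LthetaStar]
    rw [div_div_eq_mul_div]
    ring
  rw [h]
  linarith

namespace Consts.Pos

variable (hc : c.Pos)
include hc

theorem LthetaStar' (hμ : 0 < μ) : 0 < c.LthetaStar μ := by
  have := hc.Cgxt
  rw [Consts.LthetaStar]; positivity

theorem Lv' (hμ : 0 < μ) : 0 < c.Lv μ := by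
  have := hc.Lft; have := hc.Cft; have := hc.Lgtt
  rw [Consts.Lv]; positivity

theorem LvStar' (hμ : 0 < μ) : 0 < c.LvStar μ := by
  have := hc.Lv' hμ; have := hc.LthetaStar' hμ
  rw [Consts.LvStar]; positivity

theorem Lf' (hμ : 0 < μ) : 0 < c.Lf μ := by
  have := hc.Lv' hμ; have := hc.Lfx; have := hc.Cgxt; have := hc.Cft; have := hc.Lgxt
  rw [Consts.Lf]; positivity

theorem L' (hμ : 0 < μ) : 0 < c.L μ := by
  have := hc.Lf' hμ; have := hc.LthetaStar' hμ
  rw [Consts.L]; positivity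

theorem Lv_le (hκ : 1 ≤ κ) (hΛ : 0 < Λ) : c.Lv (Λ / κ) ≤ κ ^ 2 * c.Lv Λ := by
  have h1 := hc.Lft; have h2 := hc.Cft; have h3 := hc.Lgtt
  have h0 : 0 < κ := by linarith
  have h4 : c.Lft / (Λ / κ) = κ * (c.Lft / Λ) := by field_simp
  have h5 : c.Cft * c.Lgtt / (Λ / κ) ^ 2 = κ ^ 2 * (c.Cft * c.Lgtt / Λ ^ 2) := by field_simp
  simp only [Consts.Lv]
  rw [h4, h5, mul_add]
  have h6 : κ ≤ κ ^ 2 := by nlinarith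
  gcongr

theorem LvStar_le (hκ : 1 ≤ κ) (hΛ : 0 < Λ) : c.LvStar (Λ / κ) ≤ κ ^ 3 * c.LvStar Λ := by
  have h0 : 0 < κ := by linarith
  have h1 := hc.Lv' hΛ
  have h2 := hc.LthetaStar' (div_pos hΛ h0)
  calc c.LvStar (Λ / κ) ≤ (κ ^ 2 * c.Lv Λ) * (κ * (1 + c.LthetaStar Λ)) := by
        rw [Consts.LvStar]
        exact mul_le_mul (hc.Lv_le hκ hΛ) (c.one_add_LthetaStar_le hκ) (by positivity)
          (by positivity)
    _ = _ := by rw [Consts.LvStar]; ring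

theorem Lf_le (hκ : 1 ≤ κ) (hΛ : 0 < Λ) : c.Lf (Λ / κ) ≤ κ ^ 2 * c.Lf Λ := by
  have h0 : 0 < κ := by linarith
  have h1 := hc.Lfx; have h2 := hc.Cft; have h3 := hc.Lgxt; have h4 := hc.Cgxt
  have h5 := hc.Lv_le hκ hΛ
  have h6 : c.Cft * c.Lgxt / (Λ / κ) = κ * (c.Cft * c.Lgxt / Λ) := by field_simp
  have h7 : κ ≤ κ ^ 2 := by nlinarith
  have h8 : (1 : ℝ) ≤ κ ^ 2 := by nlinarith
  calc c.Lf (Λ / κ) ≤ κ ^ 2 * c.Lfx + c.Cgxt * (κ ^ 2 * c.Lv Λ)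
        + κ ^ 2 * (c.Cft * c.Lgxt / Λ) := by
        rw [Consts.Lf, h6]
        gcongr
        exact le_mul_of_one_le_left h1.le h8
    _ = _ := by rw [Consts.Lf]; ring

theorem L_le (hκ : 1 ≤ κ) (hΛ : 0 < Λ) : c.L (Λ / κ) ≤ κ ^ 3 * c.L Λ := by
  have h0 : 0 < κ := by linarith
  have h1 := hc.Lf' hΛ
  have h2 := hc.LthetaStar' (div_pos hΛ h0)
  calc c.L (Λ / κ) ≤ (κ ^ 2 * c.Lf Λ) * (κ * (1 + c.LthetaStar Λ)) := by
        rw [Consts.L]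
        exact mul_le_mul (hc.Lf_le hκ hΛ) (c.one_add_LthetaStar_le hκ) (by positivity)
          (by positivity)
    _ = _ := by rw [Consts.L]; ring

theorem A_le (hκ : 1 ≤ κ) (hΛ : 0 < Λ) : c.A (Λ / κ) ≤ κ ^ 4 * c.A Λ := by
  have h0 : 0 < κ := by linarith
  have h1 := hc.Lfx; have h2 := hc.Lft; have h3 := hc.Lgxt; have h4 := hc.Lgtt
  have h5 := hc.Cft; have h6 := hc.Cgxt
  have hM : c.M (Λ / κ) = κ * c.M Λ := by
    simp only [Consts.M]
    field_simp
  have hM0 := hc.M hΛ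
  have e1 : (1 : ℝ) ≤ κ ^ 2 := by nlinarith
  have e2 : κ ^ 2 ≤ κ ^ 4 := by nlinarith
  have hx : c.Lfgx (Λ / κ) ≤ κ ^ 4 * c.Lfgx Λ := by
    simp only [Consts.Lfgx, hM]
    nlinarith [mul_le_mul_of_nonneg_right (e1.trans e2) (sq_nonneg c.Lfx),
      mul_le_mul_of_nonneg_right e2 (mul_nonneg (sq_nonneg (c.M Λ)) (sq_nonneg c.Lgxt))]
  have ht : c.Lfgt (Λ / κ) ≤ κ ^ 2 * c.Lfgt Λ := by
    simp only [Consts.Lfgt, hM]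
    nlinarith [mul_le_mul_of_nonneg_right e1 (sq_nonneg c.Lft)]
  have h7 : 32 * c.Cgxt ^ 2 * c.Lfgt (Λ / κ) / (Λ / κ) ^ 2
      = κ ^ 2 * (32 * c.Cgxt ^ 2) / Λ ^ 2 * c.Lfgt (Λ / κ) := by field_simp
  calc c.A (Λ / κ) ≤ κ ^ 4 * c.Lfgx Λ
        + κ ^ 2 * (32 * c.Cgxt ^ 2) / Λ ^ 2 * (κ ^ 2 * c.Lfgt Λ) := by
        rw [Consts.A, h7]
        gcongr
    _ = _ := by rw [Consts.A]; ring

/-- Together with `omega_le`, `ω` equals `μ` up to a constant factor; the lower bound needs `μ ≤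
L_{g,θ}`. -/
theorem le_omega (hμ : 0 < μ) (hμL : μ ≤ c.Lgt) : μ / 4 ≤ c.omega μ := by
  have := hc.Lgt
  rw [Consts.omega, div_le_div_iff₀ (by positivity) (by positivity)]
  nlinarith [mul_pos hμ hμ]

theorem phi_le (hκ : 1 ≤ κ) (hΛ : 0 < Λ) (hL : Λ / κ ≤ c.Lgt) :
    c.phi (Λ / κ) ≤ κ ^ 6 * (c.A Λ * (1 + 64 * max c.Lgt c.Cgxt ^ 2 / Λ ^ 2)) := by
  have h0 : 0 < κ := by linarith
  have hμ : 0 < Λ / κ := by positivity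
  have h1 := hc.le_omega hμ hL
  have h2 := hc.A_le hκ hΛ
  have h3 := hc.A' hΛ
  set m := max c.Lgt c.Cgxt
  have e1 : (1 : ℝ) ≤ κ ^ 2 := by nlinarith
  calc c.phi (Λ / κ) ≤ κ ^ 4 * c.A Λ * (1 + 4 * m ^ 2 / (Λ / κ / 4) ^ 2) := by
        rw [Consts.phi]
        gcongr
    _ = κ ^ 4 * c.A Λ * (1 + κ ^ 2 * (64 * m ^ 2 / Λ ^ 2)) := by
        congr 2
        field_simp
        ring
    _ ≤ κ ^ 4 * c.A Λ * (κ ^ 2 + κ ^ 2 * (64 * m ^ 2 / Λ ^ 2)) := by gcongr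
    _ = _ := by ring

end Consts.Pos

/-- The numerator of the condition number. -/
noncomputable def Consts.maxL (c : Consts) : ℝ :=
  max c.Lfx (max c.Lft (max c.Lgt (max c.Lgxt c.Lgtt)))

theorem Consts.Pos.maxL (hc : c.Pos) : 0 < c.maxL := lt_of_lt_of_le hc.Lfx (le_max_left _ _)

theorem Consts.Lgt_le_maxL (c : Consts) : c.Lgt ≤ c.maxL :=
  (le_max_left _ _).trans ((le_max_right _ _).trans (le_max_right _ _))

/-- The value of `τ₀`. -/
noncomputable def Consts.tau0 (c : Consts) : ℝ :=
  1 / (2 + 4 * c.L c.maxL / c.Lfx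
    + 16 * c.Cgxt * c.LvStar c.maxL / (c.maxL * (c.Lfx / c.Lgt))
    + 16 * √(c.A c.maxL) * c.LthetaStar c.maxL / (c.maxL * (c.Lfx / c.Lgt)))

/-- Bounds satisfied by the relaxation parameter `τ`. -/
structure TauBounds (c : Consts) (μ τ : ℝ) : Prop where
  pos : 0 < τ
  le_half : τ ≤ 1 / 2
  momentum : c.L μ * τ ≤ c.Lfx / 4
  hessian : c.Cgxt * c.LvStar μ * τ ≤ μ * (c.Lfx / c.Lgt) / 16
  inner : √(c.A μ) * c.LthetaStar μ * τ ≤ μ * (c.Lfx / c.Lgt) / 16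

theorem Consts.Pos.tau0' (hc : c.Pos) : 0 < c.tau0 := by
  have h0 := hc.maxL
  have := hc.L' h0; have := hc.LvStar' h0; have := hc.A' h0; have := hc.LthetaStar' h0
  have := hc.Lfx; have := hc.Lgt; have := hc.Cgxt
  rw [Consts.tau0]
  positivity

/-- `tau0` is the reciprocal of a sum whose terms each enforce one requirement. The power `κ⁻⁴` is
dictated by the last two: `L_{v*}` and `√A · L_{θ*}` grow like `κ³`, while the right side,
proportional to `μ`, shrinks like `κ⁻¹`. -/
theorem Consts.Pos.tauBounds (hc : c.Pos) (hκ : 1 ≤ κ) :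
    TauBounds c (c.maxL / κ) (c.tau0 / κ ^ 4) := by
  have h0 := hc.maxL
  have h1 := hc.L' h0; have h2 := hc.LvStar' h0; have h3 := hc.A' h0
  have h4 := hc.LthetaStar' h0
  have h5 := hc.Lfx; have h6 := hc.Lgt; have h7 := hc.Cgxt
  have hκ0 : 0 < κ := by linarith
  set a₁ := 4 * c.L c.maxL / c.Lfx with ha1
  set a₂ := 16 * c.Cgxt * c.LvStar c.maxL / (c.maxL * (c.Lfx / c.Lgt)) with ha2
  set a₃ := 16 * √(c.A c.maxL) * c.LthetaStar c.maxL / (c.maxL * (c.Lfx / c.Lgt)) with ha3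
  have p1 : 0 ≤ a₁ := by positivity
  have p2 : 0 ≤ a₂ := by positivity
  have p3 : 0 ≤ a₃ := by positivity
  have ht : c.tau0 * (2 + a₁ + a₂ + a₃) = 1 := one_div_mul_cancel (by positivity)
  have ht0 := hc.tau0'
  have t1 : c.tau0 * a₁ ≤ 1 := by nlinarith [mul_nonneg ht0.le p2, mul_nonneg ht0.le p3]
  have t2 : c.tau0 * a₂ ≤ 1 := by nlinarith [mul_nonneg ht0.le p1, mul_nonneg ht0.le p3]
  have t3 : c.tau0 * a₃ ≤ 1 := by nlinarith [mul_nonneg ht0.le p1, mul_nonneg ht0.le p2]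
  have t0 : c.tau0 ≤ 1 / 2 := by
    nlinarith [mul_nonneg ht0.le p1, mul_nonneg ht0.le p2, mul_nonneg ht0.le p3]
  have hκ4 : 1 ≤ κ ^ 4 := one_le_pow₀ hκ
  constructor
  · positivity
  · exact (div_le_self ht0.le hκ4).trans t0
  · have hL := hc.L_le hκ h0
    calc c.L (c.maxL / κ) * (c.tau0 / κ ^ 4) ≤ κ ^ 3 * c.L c.maxL * (c.tau0 / κ ^ 4) := by gcongr
      _ = c.Lfx / 4 * (c.tau0 * a₁) / κ := by rw [ha1]; field_simp
      _ ≤ c.Lfx / 4 * 1 / 1 := by gcongr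
      _ = _ := by ring
  · have hL := hc.LvStar_le hκ h0
    calc c.Cgxt * c.LvStar (c.maxL / κ) * (c.tau0 / κ ^ 4)
        ≤ c.Cgxt * (κ ^ 3 * c.LvStar c.maxL) * (c.tau0 / κ ^ 4) := by gcongr
      _ = c.maxL / κ * (c.Lfx / c.Lgt) / 16 * (c.tau0 * a₂) := by rw [ha2]; field_simp
      _ ≤ c.maxL / κ * (c.Lfx / c.Lgt) / 16 * 1 := by gcongr
      _ = _ := by ring
  · have hA : √(c.A (c.maxL / κ)) ≤ κ ^ 2 * √(c.A c.maxL) := by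
      rw [Real.sqrt_le_left (by positivity), mul_pow, Real.sq_sqrt h3.le]
      exact (hc.A_le hκ h0).trans_eq (by ring)
    have hθ : c.LthetaStar (c.maxL / κ) = κ * c.LthetaStar c.maxL := by
      simp only [Consts.LthetaStar]
      field_simp
    rw [hθ]
    calc √(c.A (c.maxL / κ)) * (κ * c.LthetaStar c.maxL) * (c.tau0 / κ ^ 4)
        ≤ κ ^ 2 * √(c.A c.maxL) * (κ * c.LthetaStar c.maxL) * (c.tau0 / κ ^ 4) := by gcongr
      _ = c.maxL / κ * (c.Lfx / c.Lgt) / 16 * (c.tau0 * a₃) := by rw [ha3]; field_simp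
      _ ≤ c.maxL / κ * (c.Lfx / c.Lgt) / 16 * 1 := by gcongr
      _ = _ := by ring

end Scaling

/-! ### Admissibility of every step-size up to `u` -/

section StepSize

variable {c : Consts} {μ κ τ ρ α : ℝ}

theorem Consts.Pos.sq_mul_sq_le_phi (hc : c.Pos) (hμ : 0 < μ) :
    c.Lfx ^ 2 * c.Lgt ^ 2 ≤ μ ^ 2 * c.phi μ := by
  have h1 := hc.le_phi hμ hc.Lgt.le (le_max_left _ _)
  have h2 := (hc.Lfgx' hμ).trans (hc.Lfgx_le_A hμ)
  have h3 := hc.A' hμ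
  have h4 := hc.Lgt
  have h5 := hc.Lfx
  calc c.Lfx ^ 2 * c.Lgt ^ 2 ≤ 2 * c.Lfx ^ 2 * (μ ^ 2 + 16 * c.Lgt ^ 2) := by
        nlinarith [mul_nonneg (sq_nonneg c.Lfx) (sq_nonneg c.Lgt),
          mul_nonneg (sq_nonneg c.Lfx) (sq_nonneg μ)]
    _ ≤ c.A μ * (μ ^ 2 + 16 * c.Lgt ^ 2) := by gcongr
    _ = μ ^ 2 * (c.A μ * (1 + 16 * c.Lgt ^ 2 / μ ^ 2)) := by field_simp
    _ ≤ _ := by gcongr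

theorem Consts.Pos.sq_Lfx_le_phi (hc : c.Pos) (hμ : 0 < μ) : c.Lfx ^ 2 ≤ c.phi μ := by
  have h1 := hc.Lfgx' hμ
  have h2 := hc.Lfgx_le_A hμ
  have h3 := hc.A_le_phi hμ
  nlinarith [sq_nonneg c.Lfx]

/-- The first entry of `u₂`. It controls the consensus weight and, because `φ` dominates `L_{f,x}²`
and `(L_{f,x}L_{g,θ}/μ)²`, also keeps `γ`, `λ` and `β` small. -/
theorem phi_mul_sq_le (hc : c.Pos) (hμ : 0 < μ) (hα : 0 ≤ α)
    (hu : α ≤ c.u μ ρ τ) : c.phi μ * α ^ 2 ≤ (1 - ρ) ^ 2 / 144 := by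
  have hφ := hc.phi' hμ
  have h1 : α ≤ (1 - ρ) / (12 * √(c.phi μ)) :=
    hu.trans ((min_le_right _ _).trans ((min_le_left _ _).trans (min_le_left _ _)))
  have h2 : 0 < √(c.phi μ) := Real.sqrt_pos.2 hφ
  rw [le_div_iff₀ (by positivity)] at h1
  have h3 : (α * (12 * √(c.phi μ))) ^ 2 ≤ (1 - ρ) ^ 2 := by gcongr
  rw [mul_pow, mul_pow, Real.sq_sqrt hφ.le] at h3
  linarith

theorem Lfx_mul_le (hc : c.Pos) (hμ : 0 < μ) (hρ : ρ < 1) (hρ0 : 0 ≤ ρ) (hα : 0 ≤ α)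
    (hu : α ≤ c.u μ ρ τ) : c.Lfx * α ≤ 1 / 12 := by
  have h1 := phi_mul_sq_le hc hμ hα hu
  have h2 := hc.sq_Lfx_le_phi hμ
  have h3 := hc.Lfx
  refine le_of_sq_le_sq ?_ (by norm_num)
  calc (c.Lfx * α) ^ 2 = c.Lfx ^ 2 * α ^ 2 := mul_pow _ _ _
    _ ≤ c.phi μ * α ^ 2 := by gcongr
    _ ≤ _ := h1
    _ ≤ (1 / 12) ^ 2 := by nlinarith

theorem Lfx_mul_Lgt_mul_le (hc : c.Pos) (hμ : 0 < μ) (hρ : ρ < 1) (hρ0 : 0 ≤ ρ) (hα : 0 ≤ α)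
    (hu : α ≤ c.u μ ρ τ) : c.Lfx * c.Lgt * α ≤ μ := by
  have h1 := phi_mul_sq_le hc hμ hα hu
  have h2 := hc.sq_mul_sq_le_phi hμ
  refine le_of_sq_le_sq ?_ hμ.le
  calc (c.Lfx * c.Lgt * α) ^ 2 = c.Lfx ^ 2 * c.Lgt ^ 2 * α ^ 2 := by ring
    _ ≤ μ ^ 2 * c.phi μ * α ^ 2 := by gcongr
    _ = μ ^ 2 * (c.phi μ * α ^ 2) := by ring
    _ ≤ μ ^ 2 * 1 := by
      gcongr
      nlinarith
    _ = _ := mul_one _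

/-- The choice `c_γ = L_{f,x}`, `c_λ = c_β = L_{f,x}/L_{g,θ}` makes `γ = L_{f,x}α` and `λL_{g,θ}² =
L_{f,x}L_{g,θ}α`, precisely the quantities that `u₂` bounds. The conditions without `α` are those on
`τ`. -/
theorem admissible_of_le_u (hc : c.Pos) (hμ : 0 < μ) (hμL : μ ≤ c.Lgt) (hρ : ρ < 1) (hρ0 : 0 ≤ ρ)
    (hτ : TauBounds c μ τ) (hα : 0 < α) (hu : α ≤ c.u μ ρ τ) :
    Admissible c μ c.Lfx (c.Lfx / c.Lgt) (c.Lfx / c.Lgt) (1 - ρ)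
      ⟨α, c.Lfx / c.Lgt * α, c.Lfx / c.Lgt * α, c.Lfx * α, τ⟩ := by
  have h1 := Lfx_mul_le hc hμ hρ hρ0 hα.le hu
  have h2 := Lfx_mul_Lgt_mul_le hc hμ hρ hρ0 hα.le hu
  have h3 := phi_mul_sq_le hc hμ hα.le hu
  have hx := hc.Lfx
  have hg := hc.Lgt
  have hC := hc.Cgxt
  have hτ0 := hτ.pos
  have hr := sub_pos.2 hρ
  have hL := hc.L' hμ
  have hv := hc.LvStar' hμ
  have hA := hc.A' hμ
  have ht := hc.LthetaStar' hμ
  have e1 : c.Lfx / c.Lgt * α * c.Lgt ^ 2 ≤ μ := by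
    calc _ = c.Lfx * c.Lgt * α := by field_simp
      _ ≤ _ := h2
  have e2 : c.Lfx / c.Lgt * α * μ ≤ 1 := by
    calc c.Lfx / c.Lgt * α * μ ≤ c.Lfx / c.Lgt * α * c.Lgt := by gcongr
      _ = c.Lfx * α := by field_simp
      _ ≤ 1 := by linarith
  refine ⟨hτ0, hτ.le_half.trans (by norm_num), hα, hx, div_pos hx hg, div_pos hx hg, rfl, rfl, rfl,
    ?_, e1, e2, e1, e2, ?_, ?_, ?_, ?_, ?_⟩
  · change c.Lfx * α < 1
    linarith
  · change 96 * c.phi μ * α ^ 2 / (1 - ρ) ^ 2 ≤ 1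
    rw [div_le_one (by positivity)]
    nlinarith
  · change c.L μ * τ * α ≤ 1 / 8
    have h4 : α ≤ 1 / (8 * c.L μ * τ) :=
      hu.trans ((min_le_right _ _).trans ((min_le_right _ _).trans ((min_le_right _ _).trans
        (min_le_right _ _))))
    rw [le_div_iff₀ (by positivity)] at h4
    linarith
  · change (c.L μ * τ / c.Lfx) ^ 2 ≤ 1 / 16
    have h4 : c.L μ * τ / c.Lfx ≤ 1 / 4 := by
      rw [div_le_iff₀ hx]
      linarith [hτ.momentum]
    calc _ ≤ (1 / 4 : ℝ) ^ 2 := by gcongr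
      _ = _ := by norm_num
  · change (c.Cgxt * c.LvStar μ * τ / (μ * (c.Lfx / c.Lgt))) ^ 2 ≤ 1 / 256
    have h4 : c.Cgxt * c.LvStar μ * τ / (μ * (c.Lfx / c.Lgt)) ≤ 1 / 16 := by
      rw [div_le_iff₀ (by positivity)]
      linarith [hτ.hessian]
    calc _ ≤ (1 / 16 : ℝ) ^ 2 := by gcongr
      _ = _ := by norm_num
  · change c.A μ * (c.LthetaStar μ * τ / (μ * (c.Lfx / c.Lgt))) ^ 2 ≤ 1 / 256
    have h4 : √(c.A μ) * c.LthetaStar μ * τ / (μ * (c.Lfx / c.Lgt)) ≤ 1 / 16 := by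
      rw [div_le_iff₀ (by positivity)]
      linarith [hτ.inner]
    calc c.A μ * (c.LthetaStar μ * τ / (μ * (c.Lfx / c.Lgt))) ^ 2
        = √(c.A μ) ^ 2 * (c.LthetaStar μ * τ / (μ * (c.Lfx / c.Lgt))) ^ 2 := by
          rw [Real.sq_sqrt hA.le]
      _ = (√(c.A μ) * c.LthetaStar μ * τ / (μ * (c.Lfx / c.Lgt))) ^ 2 := by ring
      _ ≤ (1 / 16 : ℝ) ^ 2 := by gcongr
      _ = _ := by norm_num

end StepSize

/-! ### Lower bound on `u` and upper bound on the initial Lyapunov value -/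

section Rate

variable {c : Consts} {μ κ τ ρ : ℝ}

/-- Upper bound of `φ / κ⁶`. -/
noncomputable def Consts.phiBound (c : Consts) : ℝ :=
  1 + c.A c.maxL * (1 + 64 * max c.Lgt c.Cgxt ^ 2 / c.maxL ^ 2)

theorem Consts.Pos.one_le_phiBound (hc : c.Pos) : 1 ≤ c.phiBound := by
  have := hc.A' hc.maxL
  rw [Consts.phiBound]
  exact le_add_of_nonneg_right (by positivity)

theorem Consts.Pos.phi_le_phiBound (hc : c.Pos) (hκ : 1 ≤ κ) (hL : c.maxL / κ ≤ c.Lgt) :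
    c.phi (c.maxL / κ) ≤ κ ^ 6 * c.phiBound := by
  refine (hc.phi_le hκ hc.maxL hL).trans ?_
  rw [Consts.phiBound]
  gcongr
  linarith

/-- Lower bound of `u κ³ / (1 - ρ)`. -/
noncomputable def Consts.uBound (c : Consts) : ℝ :=
  min (1 / (6 * c.Lfx)) (min 1 ((c.Lfx ^ 2) ^ (1 / 3 : ℝ)) / (12 * √c.phiBound))

theorem Consts.Pos.uBound' (hc : c.Pos) : 0 < c.uBound := by
  have h1 := hc.Lfx
  have h2 := hc.one_le_phiBound
  have h3 : 0 < c.phiBound := by linarith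
  rw [Consts.uBound]
  positivity

theorem Consts.Pos.uBound_le_u (hc : c.Pos) (hκ : 1 ≤ κ) (hL : c.maxL / κ ≤ c.Lgt) (hρ : ρ < 1)
    (hρ0 : 0 ≤ ρ) (hτ : TauBounds c (c.maxL / κ) τ) :
    c.uBound * ((1 - ρ) / κ ^ 3) ≤ c.u (c.maxL / κ) ρ τ := by
  have hκ0 : 0 < κ := by linarith
  have hμ : 0 < c.maxL / κ := div_pos hc.maxL hκ0
  have hx := hc.Lfx
  have hg := hc.Lgt
  have hC := hc.Cgxt
  have hL0 := hc.L' hμ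
  have hv := hc.LvStar' hμ
  have hA := hc.A' hμ
  have ht := hc.LthetaStar' hμ
  have hτ0 := hτ.pos
  have hφ := hc.phi' hμ
  have hω := hc.omega' hμ
  have hω' := hc.le_omega hμ hL
  have hφB := hc.phi_le_phiBound hκ hL
  have hB1 := hc.one_le_phiBound
  have hxA := hc.Lfgx_le_A hμ
  have hAφ := hc.A_le_phi hμ
  have hx2 := hc.Lfgx' hμ
  set μ := c.maxL / κ with hμdef
  set r := 1 - ρ with hr
  have hr0 : 0 < r := by linarith
  have hr1 : r ≤ 1 := by linarith
  have hκ3 : 1 ≤ κ ^ 3 := one_le_pow₀ hκ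
  have hq1 : r / κ ^ 3 ≤ 1 := (div_le_one (by positivity)).2 (hr1.trans hκ3)
  have hq0 : 0 ≤ r / κ ^ 3 := by positivity
  have hB0 : 0 < c.phiBound := by linarith
  -- This covers `u₁` and `u₃`: the powers of `κ` in `τ` have already been spent, and `1/(6L_{f,x})`
  -- is what the bounds on `τ` leave for their worst entries.
  have hsmall : c.uBound * (r / κ ^ 3) ≤ 1 / (6 * c.Lfx) :=
    (mul_le_of_le_one_right hc.uBound'.le hq1).trans (min_le_left _ _)
  set a := min 1 ((c.Lfx ^ 2) ^ (1 / 3 : ℝ)) with ha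
  have ha1 : a ≤ 1 := min_le_left _ _
  have ha0 : 0 ≤ a := by positivity
  have hP1 : 1 ≤ κ ^ 6 * c.phiBound := one_le_mul_of_one_le_of_one_le (one_le_pow₀ hκ) hB1
  have hs : √(κ ^ 6 * c.phiBound) = κ ^ 3 * √c.phiBound := by
    rw [Real.sqrt_mul (by positivity), show κ ^ 6 = (κ ^ 3) ^ 2 by ring,
      Real.sqrt_sq (by positivity)]
  -- This covers `u₂`, where `12` is the largest of the four denominators and `a` takes care of the
  -- numerator `A^(1/3)`.
  have hbig : c.uBound * (r / κ ^ 3) ≤ a * r / (12 * (κ ^ 3 * √c.phiBound)) := by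
    calc _ ≤ a / (12 * √c.phiBound) * (r / κ ^ 3) := by
          gcongr
          exact min_le_right _ _
      _ = _ := by field_simp
  -- The summand `1` in `phiBound` makes the base at least `1`, so the roots with exponents `1/3`
  -- and `1/4` are bounded by the square root, hence by a multiple of `κ³`.
  have hrt : ∀ y : ℝ, 0 < y → y ≤ c.phi μ → ∀ s : ℝ, 0 ≤ s → s ≤ 1 / 2 →
      y ^ s ≤ κ ^ 3 * √c.phiBound := by
    intro y hy hyφ s hs0 hs1
    calc y ^ s ≤ (κ ^ 6 * c.phiBound) ^ s :=
          Real.rpow_le_rpow hy.le (hyφ.trans hφB) hs0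
      _ ≤ (κ ^ 6 * c.phiBound) ^ (1 / 2 : ℝ) := Real.rpow_le_rpow_of_exponent_le hP1 hs1
      _ = _ := by rw [← Real.sqrt_eq_rpow, hs]
  have hrr : ∀ s : ℝ, s ≤ 1 → r ≤ r ^ s := fun s hs => by
    simpa using Real.rpow_le_rpow_of_exponent_ge hr0 hr1 hs
  have hsx : 0 < κ ^ 3 * √c.phiBound := by positivity
  have hLx0 : 0 < c.Lfgx μ := lt_of_lt_of_le (by positivity) hx2
  refine le_min ?_ (le_min (le_min ?_ (le_min ?_ (le_min ?_ ?_))) (le_min ?_ (le_min ?_ ?_)))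
  · refine hsmall.trans ?_
    apply one_div_le_one_div_of_le (by positivity)
    linarith [hτ.momentum]
  · refine hbig.trans ?_
    have h1 := hrt (c.phi μ) hφ le_rfl (1 / 2) (by norm_num) le_rfl
    rw [← Real.sqrt_eq_rpow] at h1
    have h2 : 0 < √(c.phi μ) := Real.sqrt_pos.2 hφ
    apply div_le_div₀ hr0.le (mul_le_of_le_one_left hr0.le ha1) (by positivity)
    gcongr
  · refine hbig.trans ?_
    have h1 := hrt (c.phi μ) hφ le_rfl (1 / 3) (by norm_num) (by norm_num)
    have h2 := hrr (2 / 3) (by norm_num)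
    apply div_le_div₀ (by positivity) ((mul_le_of_le_one_left hr0.le ha1).trans h2)
      (by positivity)
    linarith
  · refine hbig.trans ?_
    have h1 := hrt (c.phi μ) hφ le_rfl (1 / 3) (by norm_num) (by norm_num)
    have h2 := hrr (2 / 3) (by norm_num)
    have h3 : a ≤ c.A μ ^ (1 / 3 : ℝ) := by
      refine (min_le_right _ _).trans (Real.rpow_le_rpow (by positivity) ?_ (by norm_num))
      linarith [sq_nonneg c.Lfx]
    apply div_le_div₀ (by positivity) (mul_le_mul h3 h2 hr0.le (by positivity)) (by positivity)
    linarith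
  · refine hbig.trans ?_
    have h1 := hrt (c.Lfgx μ) hLx0 (hxA.trans hAφ) (1 / 4) (by norm_num) (by norm_num)
    have h2 := hrr (1 / 2) (by norm_num)
    apply div_le_div₀ (by positivity) ((mul_le_of_le_one_left hr0.le ha1).trans h2)
      (by positivity)
    linarith
  · refine hsmall.trans ?_
    apply one_div_le_one_div_of_le (by positivity)
    have h1 := hτ.hessian
    have h2 : μ * (c.Lfx / c.Lgt) ≤ c.Lfx := by
      calc μ * (c.Lfx / c.Lgt) ≤ c.Lgt * (c.Lfx / c.Lgt) := by gcongr
        _ = c.Lfx := by field_simp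
    linarith
  · refine hsmall.trans ?_
    have h1 := hτ.inner
    have h2 : 1 / (2 * c.Lgt) ≤ min (2 / (μ + c.Lgt)) ((μ + c.Lgt) / (2 * μ * c.Lgt)) := by
      refine le_min ?_ ?_
      · rw [div_le_div_iff₀ (by positivity) (by positivity)]
        linarith
      · rw [div_le_div_iff₀ (by positivity) (by positivity)]
        linarith [mul_pos hg hg]
    calc 1 / (6 * c.Lfx)
        = 1 / (2 * c.Lgt) * (μ / 4) / (12 * (μ * (c.Lfx / c.Lgt) / 16)) := by
          field_simp
          norm_num
      _ ≤ min (2 / (μ + c.Lgt)) ((μ + c.Lgt) / (2 * μ * c.Lgt)) * c.omega μ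
          / (12 * (√(c.A μ) * c.LthetaStar μ * τ)) := by gcongr
      _ = _ := by
        congr 1
        ring
  · refine hsmall.trans ?_
    apply one_div_le_one_div_of_le (by positivity)
    linarith [hτ.momentum]

variable {m n p : ℕ} {f g : Fin m → E n → E p → ℝ} {S : State m n p} {ℓ R : ℝ}

/-- Upper bound of `V̂⁰ / (R κ⁵)`. -/
noncomputable def Consts.V0Bound (c : Consts) : ℝ :=
  1 / c.tau0 + 8 * c.Cgxt ^ 2 / (c.maxL * (c.Lfx / c.Lgt))
    + 4 * c.A c.maxL / (c.maxL * (c.Lfx / c.Lgt)) + 1 / c.Lfx + 1 / c.Lfx ^ 2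

theorem Consts.Pos.V0Bound' (hc : c.Pos) : 0 < c.V0Bound := by
  have := hc.maxL; have := hc.tau0'; have := hc.A' hc.maxL; have := hc.Lfx; have := hc.Lgt
  rw [Consts.V0Bound]
  positivity

theorem avg_eq_of_consensus (hm : 0 < m) (h : ∀ i j, S.x i = S.x j) (i : Fin m) :
    S.x i = avg S.x := by
  have : S.x = fun _ => S.x i := funext fun j => h j i
  rw [this, avg_const hm]

theorem errX_eq_zero (hm : 0 < m) (h : ∀ i j, S.x i = S.x j) : errX S = 0 := by
  rw [errX]
  simp only [avg_eq_of_consensus hm h, sub_self]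
  simpa using mean_const hm 0

/-- The initial Lyapunov value in terms of the mean squared errors. -/
theorem V0_eq (hm : 0 < m) (hS : ∀ i j, S.x i = S.x j) (cγ cl cβ : ℝ) :
    c.V0 μ ρ τ cγ cl cβ f g ℓ S = (1 / τ) * ((Phi f g (avg S.x) - ℓ)
      + 8 * c.Cgxt ^ 2 * τ / (μ * cl) * errV f g S + c.A μ * τ / (c.omega μ * cβ) * errT g S
      + τ / (2 * cγ) * errQ f g S
      + 24 * c.phi μ * τ / ((1 - ρ) ^ 2 * cγ) * c.u μ ρ τ ^ 3 * errZ f g S) := by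
  have h1 : errX S = 0 := errX_eq_zero hm hS
  have h2 : errZ f g S = (1 / (m : ℝ)) *
      ∑ i, ‖gradient (PhiLoc (f i) (g i)) (avg S.x) - S.z i‖ ^ 2 := by
    simp only [errZ, mean, norm_sub_rev]
  have h3 : errQ f g S = ‖gradient (Phi f g) (avg S.x) - avg S.z‖ ^ 2 := by
    rw [errQ, norm_sub_rev]
  rw [h2, h3]
  have h4 : (1 / (m : ℝ)) * ∑ i, ‖S.x i - avg S.x‖ ^ 2 = 0 := h1
  rw [Consts.V0, h4, mul_zero, add_zero]
  rfl

theorem V0_le (hm : 0 < m) (hc : c.Pos) (hκ : 1 ≤ κ) (hL : c.maxL / κ ≤ c.Lgt) (hρ : ρ < 1)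
    (hρ0 : 0 ≤ ρ) (hR : 0 < R)
    (hf : ∀ i, OuterAssumption c (f i) (g i)) (hg : ∀ i, InnerAssumption c (c.maxL / κ) (g i))
    (hS : Init R κ f g ℓ S) :
    c.V0 (c.maxL / κ) ρ (c.tau0 / κ ^ 4) c.Lfx (c.Lfx / c.Lgt) (c.Lfx / c.Lgt) f g ℓ S
      ≤ c.V0Bound * R * κ ^ 5 := by
  have hκ0 : 0 < κ := by linarith
  have hμ : 0 < c.maxL / κ := div_pos hc.maxL hκ0
  have hτ := hc.tauBounds hκ
  have hτ0 := hτ.pos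
  have hu : 0 < c.u (c.maxL / κ) ρ (c.tau0 / κ ^ 4) :=
    lt_of_lt_of_le (mul_pos hc.uBound' (div_pos (sub_pos.2 hρ) (by positivity)))
      (hc.uBound_le_u hκ hL hρ hρ0 hτ)
  have h1 := phi_mul_sq_le hc hμ hu.le le_rfl
  have h2 := Lfx_mul_le hc hμ hρ hρ0 hu.le le_rfl
  rw [V0_eq hm hS.consensus]
  have hgap := hS.gap
  have hT : errT g S ≤ R := hS.errT
  have hV : errV f g S ≤ R * κ ^ 2 := hS.errV
  have hZ : errZ f g S ≤ R * κ ^ 2 := hS.errZ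
  have hQ : errQ f g S ≤ R * κ ^ 2 := (errQ_le_errZ hm hμ hc hf hg S).trans hZ
  have hω := hc.le_omega hμ hL
  have hA := hc.A_le hκ hc.maxL
  have hA0 := hc.A' hc.maxL
  have hAμ := hc.A' hμ
  have hx := hc.Lfx
  have hgt := hc.Lgt
  have hC := hc.Cgxt
  have hΛ := hc.maxL
  have ht0 := hc.tau0'
  have hφ := hc.phi' hμ
  have hr := sub_pos.2 hρ
  have hω0 := hc.omega' hμ
  set u := c.u (c.maxL / κ) ρ (c.tau0 / κ ^ 4)
  set a := c.Lfx / c.Lgt with ha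
  have ha0 : 0 < a := by positivity
  have hκ1 : ∀ k : ℕ, k ≤ 5 → κ ^ k ≤ κ ^ 5 := fun k hk => pow_le_pow_right₀ hκ hk
  have t1 : 1 / (c.tau0 / κ ^ 4) * (Phi f g (avg S.x) - ℓ) ≤ 1 / c.tau0 * R * κ ^ 5 := by
    calc _ ≤ 1 / (c.tau0 / κ ^ 4) * R := by gcongr
      _ = 1 / c.tau0 * R * κ ^ 4 := by field_simp
      _ ≤ _ := by gcongr 1 / c.tau0 * R * ?_; exact hκ1 4 (by norm_num)
  have t2 : 8 * c.Cgxt ^ 2 / (c.maxL / κ * a) * errV f g S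
      ≤ 8 * c.Cgxt ^ 2 / (c.maxL * a) * R * κ ^ 5 := by
    calc _ ≤ 8 * c.Cgxt ^ 2 / (c.maxL / κ * a) * (R * κ ^ 2) := by gcongr
      _ = 8 * c.Cgxt ^ 2 / (c.maxL * a) * R * κ ^ 3 := by field_simp
      _ ≤ _ := by gcongr 8 * c.Cgxt ^ 2 / (c.maxL * a) * R * ?_; exact hκ1 3 (by norm_num)
  -- The dominant term: `κ⁴` from `A` and one more `κ` from `1/ω`.
  have t3 : c.A (c.maxL / κ) / (c.omega (c.maxL / κ) * a) * errT g S
      ≤ 4 * c.A c.maxL / (c.maxL * a) * R * κ ^ 5 := by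
    calc _ ≤ κ ^ 4 * c.A c.maxL / (c.maxL / κ / 4 * a) * R := by
          have := errT_nonneg (g := g) S
          gcongr
      _ = _ := by field_simp
  have t4 : 1 / (2 * c.Lfx) * errQ f g S ≤ 1 / c.Lfx * R * κ ^ 5 := by
    calc _ ≤ 1 / (1 * c.Lfx) * (R * κ ^ 2) := by
          have := errQ_nonneg (f := f) (g := g) S
          gcongr
          norm_num
      _ = 1 / c.Lfx * R * κ ^ 2 := by rw [one_mul, mul_assoc]
      _ ≤ _ := by gcongr 1 / c.Lfx * R * ?_; exact hκ1 2 (by norm_num)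
  -- Splitting `u³ = u² · u`, the first factor cancels `φ/(1-ρ)²` and the second is at most
  -- `1/(12L_{f,x})`.
  have t5 : 24 * c.phi (c.maxL / κ) / ((1 - ρ) ^ 2 * c.Lfx) * u ^ 3 * errZ f g S
      ≤ 1 / c.Lfx ^ 2 * R * κ ^ 5 := by
    calc _ ≤ 24 * c.phi (c.maxL / κ) / ((1 - ρ) ^ 2 * c.Lfx) * u ^ 3 * (R * κ ^ 2) := by gcongr
      _ = 24 / ((1 - ρ) ^ 2 * c.Lfx ^ 2) * (c.phi (c.maxL / κ) * u ^ 2) * (c.Lfx * u)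
          * (R * κ ^ 2) := by field_simp
      _ ≤ 24 / ((1 - ρ) ^ 2 * c.Lfx ^ 2) * ((1 - ρ) ^ 2 / 144) * (1 / 12) * (R * κ ^ 2) := by
        gcongr
      _ = 1 / 72 * (1 / c.Lfx ^ 2 * R * κ ^ 2) := by field_simp; norm_num
      _ ≤ 1 * (1 / c.Lfx ^ 2 * R * κ ^ 5) := by
        gcongr ?_ * (1 / c.Lfx ^ 2 * R * ?_)
        · norm_num
        · exact hκ1 2 (by norm_num)
      _ = _ := one_mul _
  set τ := c.tau0 / κ ^ 4
  have e : 1 / τ * ((Phi f g (avg S.x) - ℓ)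
      + 8 * c.Cgxt ^ 2 * τ / (c.maxL / κ * a) * errV f g S
      + c.A (c.maxL / κ) * τ / (c.omega (c.maxL / κ) * a) * errT g S
      + τ / (2 * c.Lfx) * errQ f g S
      + 24 * c.phi (c.maxL / κ) * τ / ((1 - ρ) ^ 2 * c.Lfx) * u ^ 3 * errZ f g S) =
      1 / τ * (Phi f g (avg S.x) - ℓ) + 8 * c.Cgxt ^ 2 / (c.maxL / κ * a) * errV f g S
      + c.A (c.maxL / κ) / (c.omega (c.maxL / κ) * a) * errT g S
      + 1 / (2 * c.Lfx) * errQ f g S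
      + 24 * c.phi (c.maxL / κ) / ((1 - ρ) ^ 2 * c.Lfx) * u ^ 3 * errZ f g S := by
    field_simp
  rw [e, Consts.V0Bound, ← ha]
  calc _ ≤ _ := add_le_add (add_le_add (add_le_add (add_le_add t1 t2) t3) t4) t5
    _ = _ := by ring

/-- The factor `4` in `a₀` absorbs the change from `8/μ` to `1/ω`, and the consensus error vanishes
initially. The weight of `errZ` carries `α²` here but `u³` in `V̂⁰`; as `α²` need not be bounded by
a multiple of `u³`, that term is kept separately. -/
theorem lyapunov_le_a0 {cγ cl cβ α : ℝ} (hm : 0 < m) (hc : c.Pos) (hμ : 0 < μ) (hρ : ρ < 1)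
    (hcγ : 0 < cγ) (hcl : 0 < cl) (hcβ : 0 < cβ) (hτ : 0 < τ) (hu : 0 ≤ c.u μ ρ τ)
    (hℓ : ∀ x, ℓ ≤ Phi f g x) (hS : ∀ i j, S.x i = S.x j) :
    lyapunov c μ cγ cl cβ (1 - ρ) τ α ℓ f g S ≤ τ * (c.a0 μ ρ τ cγ cl cβ f g ℓ S
      + 48 * c.phi μ * α ^ 2 / ((1 - ρ) ^ 2 * cγ) * errZ f g S) := by
  have h1 : errX S = 0 := errX_eq_zero hm hS
  have hgap := sub_nonneg.2 (hℓ (avg S.x))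
  have hV := errV_nonneg (f := f) (g := g) S
  have hT := errT_nonneg (g := g) S
  have hQ := errQ_nonneg (f := f) (g := g) S
  have hZ := errZ_nonneg (f := f) (g := g) S
  have hω := hc.omega_le hμ
  have hω0 := hc.omega' hμ
  have hA := hc.A' hμ
  have hφ := hc.phi' hμ
  have hr := sub_pos.2 hρ
  have k1 : 8 * c.A μ * τ / (μ * cβ) ≤ 4 * (c.A μ * τ / (c.omega μ * cβ)) := by
    calc 8 * c.A μ * τ / (μ * cβ) = 4 * (c.A μ * τ / (μ / 2 * cβ)) := by field_simp; norm_num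
      _ ≤ _ := by gcongr
  have k2 := mul_le_mul_of_nonneg_right k1 hT
  have k3 : 0 ≤ 8 * c.Cgxt ^ 2 * τ / (μ * cl) * errV f g S := by positivity
  have k4 : 0 ≤ τ / (2 * cγ) * errQ f g S := by positivity
  have k5 : 0 ≤ 24 * c.phi μ * τ / ((1 - ρ) ^ 2 * cγ) * c.u μ ρ τ ^ 3 * errZ f g S := by
    positivity
  have k6 : τ * (48 * c.phi μ * α ^ 2 / ((1 - ρ) ^ 2 * cγ) * errZ f g S) =
      48 * c.phi μ * α ^ 2 * τ / ((1 - ρ) ^ 2 * cγ) * errZ f g S := by ring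
  have k7 : ∀ y, τ * (4 * (1 / τ * y)) = 4 * y := fun y => by field_simp
  rw [lyapunov, h1, Consts.a0, V0_eq hm hS, mul_add, k6, k7]
  linarith

end Rate

/-! ### Choice of `α` and the rate -/

section MainBound

variable {c : Consts} {κ ρ : ℝ} {m n p : ℕ} {f g : Fin m → E n → E p → ℝ} {S : State m n p}
  {ℓ R : ℝ} {G : SimpleGraph (Fin m)} {W : Matrix (Fin m) (Fin m) ℝ}

/-- The heterogeneity term for the step-size that balances it. -/
theorem mul_rpow_third_sq_le {a₀ φ r q b K k₀ kφ cγ : ℝ} (ha₀ : 0 < a₀) (hφ : 0 < φ) (hr : 0 < r)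
    (hq : 0 < q) (hb : 0 < b) (hK : 0 < K) (hcγ : 0 < cγ) (hκ : 0 < κ)
    (h1 : a₀ ≤ k₀ * κ ^ 5) (h2 : φ ≤ κ ^ 6 * kφ) :
    96 * φ / (r ^ 2 * cγ) * (b ^ 2 / q)
        * ((a₀ / (96 * φ / (r ^ 2 * cγ) * (b ^ 2 / q) * (K + 1))) ^ (1 / 3 : ℝ)) ^ 2
      ≤ (1 + 96 * kφ * k₀ ^ 2 / cγ) * (κ ^ (16 / 3 : ℝ) * (b / √q) ^ (2 / 3 : ℝ)
          / (r ^ (2 / 3 : ℝ) * K ^ (2 / 3 : ℝ))) := by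
  have hkφ : 0 < kφ := by
    by_contra h
    have : κ ^ 6 * kφ ≤ 0 := mul_nonpos_of_nonneg_of_nonpos (by positivity) (not_lt.1 h)
    linarith
  set a₂ := 96 * φ / (r ^ 2 * cγ) * (b ^ 2 / q) with ha2
  have ha₂ : 0 < a₂ := by positivity
  set Y := κ ^ (16 / 3 : ℝ) * (b / √q) ^ (2 / 3 : ℝ) / (r ^ (2 / 3 : ℝ) * K ^ (2 / 3 : ℝ)) with hY
  have hY0 : 0 ≤ Y := by positivity
  have cube : ∀ x : ℝ, 0 ≤ x → ∀ s : ℝ, (x ^ s) ^ 3 = x ^ (s * 3) := fun x hx s => by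
    rw [← Real.rpow_natCast, ← Real.rpow_mul hx]
    norm_num
  have hY3 : Y ^ 3 = κ ^ 16 * (b ^ 2 / q) / (r ^ 2 * K ^ 2) := by
    rw [hY, div_pow, mul_pow, mul_pow, cube _ hκ.le, cube _ (by positivity), cube _ hr.le,
      cube _ hK.le]
    norm_num
    rw [div_pow, Real.sq_sqrt hq.le]
  have hw : ((a₀ / (a₂ * (K + 1))) ^ (1 / 3 : ℝ)) ^ 3 = a₀ / (a₂ * (K + 1)) := by
    rw [cube _ (by positivity)]
    norm_num
  set w := (a₀ / (a₂ * (K + 1))) ^ (1 / 3 : ℝ)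
  set k₁ := 96 * kφ * k₀ ^ 2 / cγ with hk1
  have hk₁ : 0 ≤ k₁ := by positivity
  -- Comparing cubes removes all fractional powers: the cube of the left side is `a₂a₀²/(K+1)²`.
  -- Bounding the constant `k₁` by `(1 + k₁)³` avoids its cube root.
  refine le_of_pow_le_pow_left₀ (n := 3) (by norm_num) (by positivity) ?_
  calc (a₂ * w ^ 2) ^ 3 = a₂ ^ 3 * (w ^ 3) ^ 2 := by ring
    _ = a₂ * a₀ ^ 2 / (K + 1) ^ 2 := by
      rw [hw]
      field_simp
    _ ≤ (96 * (κ ^ 6 * kφ) / (r ^ 2 * cγ) * (b ^ 2 / q)) * (k₀ * κ ^ 5) ^ 2 / K ^ 2 := by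
      rw [ha2]
      gcongr
      linarith
    _ = k₁ * Y ^ 3 := by
      rw [hY3, hk1]
      field_simp
    _ ≤ (1 + k₁) ^ 3 * Y ^ 3 := by
      gcongr
      nlinarith [pow_nonneg hk₁ 2, pow_nonneg hk₁ 3]
    _ = _ := (mul_pow _ _ _).symm

/-- The constant of the rate. -/
noncomputable def Consts.rateConst (c : Consts) (R : ℝ) : ℝ :=
  8 * c.V0Bound * R / c.uBound + 8 * √c.phiBound * R / c.Lfx
    + (2 + 2 * c.Lfx) * (1 + 96 * c.phiBound * (4 * c.V0Bound * R) ^ 2 / c.Lfx)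

theorem Consts.Pos.rateConst' (hc : c.Pos) (hR : 0 < R) : 0 < c.rateConst R := by
  have := hc.V0Bound'; have := hc.uBound'; have := hc.Lfx
  have : 0 < c.phiBound := by linarith [hc.one_le_phiBound]
  rw [Consts.rateConst]
  positivity

theorem Consts.Pos.b' (hc : c.Pos) {μ bf bg : ℝ} (hμ : 0 < μ) (hbf : 0 < bf) :
    0 < c.b μ bf bg := by
  have := hc.Lfx; have := hc.Lft; have := hc.Cft; have := hc.Lgtt; have := hc.Lgxt
  have := hc.Cgxt
  rw [Consts.b, Consts.C1, Consts.C2]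
  positivity

theorem avg_run_of_alpha_eq_zero {σ : Steps} (hW : Network G W) (hσ : σ.α = 0) (hy : S.y = S.z)
    (k : ℕ) : avg (run W f g σ S k).x = avg S.x := by
  induction k with
  | zero => rfl
  | succ k ih =>
    rw [run_succ, avg_step hW (run_y_eq_z hy k), hσ, mul_zero, zero_smul, sub_zero, ih]

/-- If the initial Lyapunov value vanishes, the averaged iterate starts at a minimizer. -/
theorem gradient_eq_zero_of_gap_le {Φ : E n → ℝ} {x : E n} (hℓ : ∀ y, ℓ ≤ Φ y) (hx : Φ x ≤ ℓ) :
    gradient Φ x = 0 := by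
  have h : IsLocalMin Φ x := Filter.Eventually.of_forall fun y => hx.trans (hℓ y)
  rw [gradient, h.fderiv_eq_zero, map_zero]

/-- Three contributions: `a₀/(αK)`, the initial momentum error, and heterogeneity. As `α` is a
minimum, the first is bounded by the sum of its values at `u` and at the balancing step-size `w`;
the third increases with `α` and is bounded by its value at `w`. -/
theorem mean_gradient_le_rate (hc : c.Pos) (hR : 0 < R) (hκ : 1 ≤ κ) (hL : c.maxL / κ ≤ c.Lgt)
    (hW : Network G W) (hf : ∀ i, OuterAssumption c (f i) (g i))
    (hg : ∀ i, InnerAssumption c (c.maxL / κ) (g i)) {bf bg : ℝ} (hbf : 0 < bf)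
    (hh : Heterogeneity bf bg f g) (hℓ : ∀ x, ℓ ≤ Phi f g x) (hS : Init R κ f g ℓ S)
    {K : ℕ} (hK : 1 ≤ K) :
    (1 / ((K : ℝ) + 1)) * ∑ k ∈ Finset.range (K + 1),
        ‖gradient (Phi f g) (avg (run W f g (c.steps (c.maxL / κ) (rho W) (c.tau0 / κ ^ 4) c.Lfx
          (c.Lfx / c.Lgt) (c.Lfx / c.Lgt) bf bg f g ℓ S K) S k).x)‖ ^ 2
      ≤ c.rateConst R * (κ ^ 8 / ((1 - rho W) * K)
          + κ ^ (16 / 3 : ℝ) * (c.b (c.maxL / κ) bf bg / √(m : ℝ)) ^ (2 / 3 : ℝ)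
            / ((1 - rho W) ^ (2 / 3 : ℝ) * (K : ℝ) ^ (2 / 3 : ℝ))) := by
  have hκ0 : 0 < κ := by linarith
  have hμ : 0 < c.maxL / κ := div_pos hc.maxL hκ0
  have hm := hW.pos
  have hm' : (0 : ℝ) < m := Nat.cast_pos.2 hm
  have hρ := hW.rho_lt_one
  have hρ0 := rho_nonneg W
  have hr := sub_pos.2 hρ
  have hK0 : (0 : ℝ) < K := Nat.cast_pos.2 hK
  have hτ := hc.tauBounds hκ
  have hτ0 := hτ.pos
  have hx := hc.Lfx
  have ha : 0 < c.Lfx / c.Lgt := div_pos hx hc.Lgt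
  have hφ := hc.phi' hμ
  have hφB := hc.phi_le_phiBound hκ hL
  have hB0 : 0 < c.phiBound := by linarith [hc.one_le_phiBound]
  have hb := hc.b' (bg := bg) hμ hbf
  have huB := hc.uBound'
  have hVB := hc.V0Bound'
  have huL := hc.uBound_le_u hκ hL hρ hρ0 hτ
  have hu : 0 < c.u (c.maxL / κ) (rho W) (c.tau0 / κ ^ 4) := lt_of_lt_of_le (by positivity) huL
  have ha0k : c.a0 (c.maxL / κ) (rho W) (c.tau0 / κ ^ 4) c.Lfx (c.Lfx / c.Lgt) (c.Lfx / c.Lgt)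
      f g ℓ S ≤ 4 * c.V0Bound * R * κ ^ 5 := by
    have := V0_le hm hc hκ hL hρ hρ0 hR hf hg hS
    rw [Consts.a0]
    linarith
  have hlyap := fun α : ℝ => lyapunov_le_a0 (α := α) hm hc hμ hρ hx ha ha hτ0 hu.le hℓ hS.consensus
  have hRC := hc.rateConst' hR
  set μ := c.maxL / κ with hμdef
  set τ := c.tau0 / κ ^ 4 with hτdef
  set a := c.Lfx / c.Lgt with hadef
  set a₀ := c.a0 μ (rho W) τ c.Lfx a a f g ℓ S with ha0def
  set σ := c.steps μ (rho W) τ c.Lfx a a bf bg f g ℓ S K with hσdef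
  set r := 1 - rho W with hrdef
  have hbnn : 0 ≤ c.b μ bf bg / √(m : ℝ) := by positivity
  have ha₀ : 0 ≤ a₀ := by
    have h1 := lyapunov_nonneg (f := f) (g := g) hμ hc hx ha ha hr hτ0 le_rfl hℓ S
    -- At `α = 0` the weights of `errZ` and `errX` vanish, so the comparison reads `0 ≤ lyapunov ≤ τ
    -- * a₀`.
    have h2 := h1.trans (hlyap 0)
    have h3 : 0 ≤ τ * a₀ := by simpa using h2
    exact nonneg_of_mul_nonneg_right h3 hτ0
  have ha2 : c.a2 μ (rho W) c.Lfx bf bg m =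
      96 * c.phi μ / (r ^ 2 * c.Lfx) * (c.b μ bf bg ^ 2 / m) := by
    rw [Consts.a2, Consts.vartheta]
    ring
  have hα : σ.α = min (c.u μ (rho W) τ)
      ((a₀ / (96 * c.phi μ / (r ^ 2 * c.Lfx) * (c.b μ bf bg ^ 2 / m) * ((K : ℝ) + 1)))
        ^ (1 / 3 : ℝ)) := by
    rw [← ha2]
    rfl
  -- If `a₀ = 0`, then `α = 0` and the averaged iterate never moves; but then `Φ(x̄⁰) = ℓ`, so it
  -- rests at a minimizer and every gradient in the sum is zero.
  rcases ha₀.eq_or_lt with h0 | h0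
  · have hα0 : σ.α = 0 := by
      rw [hα, ← h0, zero_div, Real.zero_rpow (by norm_num), min_eq_right hu.le]
    have hgap : Phi f g (avg S.x) ≤ ℓ := by
      have h1 := hlyap 0
      rw [← h0] at h1
      have h2 := errT_nonneg (g := g) S
      have h3 := errV_nonneg (f := f) (g := g) S
      have h4 := errQ_nonneg (f := f) (g := g) S
      have h5 := hc.A' hμ
      have h6 : 0 ≤ 8 * c.Cgxt ^ 2 * τ / (μ * a) * errV f g S := by positivity
      have h7 : 0 ≤ 8 * c.A μ * τ / (μ * a) * errT g S := by positivity
      have h8 : 0 ≤ τ / (2 * c.Lfx) * errQ f g S := by positivity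
      simp only [lyapunov] at h1
      norm_num at h1
      linarith
    have hz := gradient_eq_zero_of_gap_le hℓ hgap
    simp only [avg_run_of_alpha_eq_zero hW hα0 hS.y_eq_z, hz]
    simp only [norm_zero, ne_eq, OfNat.ofNat_ne_zero, not_false_eq_true, zero_pow,
      Finset.sum_const_zero, mul_zero]
    positivity
  · set w := (a₀ / (96 * c.phi μ / (r ^ 2 * c.Lfx) * (c.b μ bf bg ^ 2 / m) * ((K : ℝ) + 1)))
        ^ (1 / 3 : ℝ) with hw
    have hw0 : 0 < w := by positivity
    have hα0 : 0 < σ.α := by rw [hα]; exact lt_min hu hw0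
    have hαu : σ.α ≤ c.u μ (rho W) τ := by rw [hα]; exact min_le_left _ _
    have hαw : σ.α ≤ w := by rw [hα]; exact min_le_right _ _
    have hadm : Admissible c μ c.Lfx a a (1 - rho W) σ :=
      admissible_of_le_u hc hμ hL hρ hρ0 hτ hα0 hαu
    have hmain := mean_gradient_le_lyapunov hW hμ hc hf hg hh hℓ hadm hS.y_eq_z K
    refine hmain.trans ?_
    have hl := hlyap σ.α
    have hZ : errZ f g S ≤ R * κ ^ 2 := hS.errZ
    have hsq := phi_mul_sq_le hc hμ hα0.le hαu
    change 2 * lyapunov c μ c.Lfx a a r τ σ.α ℓ f g S / (τ * σ.α * ((K : ℝ) + 1)) +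
      192 * c.phi μ * σ.α ^ 2 / r ^ 2 * (c.b μ bf bg ^ 2 / m) ≤ _
    set T := 96 * c.phi μ / (r ^ 2 * c.Lfx) * (c.b μ bf bg ^ 2 / m) with hT
    set Y := κ ^ (16 / 3 : ℝ) * (c.b μ bf bg / √(m : ℝ)) ^ (2 / 3 : ℝ)
            / (r ^ (2 / 3 : ℝ) * (K : ℝ) ^ (2 / 3 : ℝ)) with hY
    have hY0 : 0 ≤ Y := by positivity
    have hT0 : 0 < T := by positivity
    set k₂ := 1 + 96 * c.phiBound * (4 * c.V0Bound * R) ^ 2 / c.Lfx with hk2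
    have hTw : T * w ^ 2 ≤ k₂ * Y :=
      mul_rpow_third_sq_le h0 hφ hr hm' hb hK0 hx hκ0 ha0k hφB
    -- The balance that defines `w`: it makes `a₀/(w(K+1))` equal to `T * w ^ 2`.
    have hw3 : a₀ = T * ((K : ℝ) + 1) * w ^ 3 := by
      have : w ^ 3 = a₀ / (T * ((K : ℝ) + 1)) := by
        rw [hw, ← Real.rpow_natCast, ← Real.rpow_mul (by positivity)]
        norm_num
      rw [this]
      field_simp
    have b1 : 2 * lyapunov c μ c.Lfx a a r τ σ.α ℓ f g S / (τ * σ.α * ((K : ℝ) + 1)) ≤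
        2 * (a₀ / (σ.α * ((K : ℝ) + 1)))
          + 96 * c.phi μ * σ.α / (r ^ 2 * c.Lfx * ((K : ℝ) + 1)) * errZ f g S := by
      calc _ ≤ 2 * (τ * (a₀ + 48 * c.phi μ * σ.α ^ 2 / (r ^ 2 * c.Lfx) * errZ f g S))
            / (τ * σ.α * ((K : ℝ) + 1)) := by gcongr
        _ = _ := by field_simp; ring
    have b2 : a₀ / (σ.α * ((K : ℝ) + 1)) ≤
        4 * c.V0Bound * R / c.uBound * (κ ^ 8 / (r * K)) + T * w ^ 2 := by
      have e1 : a₀ / (c.u μ (rho W) τ * ((K : ℝ) + 1)) ≤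
          4 * c.V0Bound * R / c.uBound * (κ ^ 8 / (r * K)) := by
        calc _ ≤ 4 * c.V0Bound * R * κ ^ 5 / (c.uBound * (r / κ ^ 3) * K) := by
              gcongr
              linarith
          _ = _ := by field_simp
      have e2 : a₀ / (w * ((K : ℝ) + 1)) = T * w ^ 2 := by
        rw [hw3]
        field_simp
      have e3 : 0 ≤ T * w ^ 2 := by positivity
      have e4 : 0 ≤ 4 * c.V0Bound * R / c.uBound * (κ ^ 8 / (r * K)) := by positivity
      rw [hα]
      rcases min_choice (c.u μ (rho W) τ) w with h | h <;> rw [h]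
      · linarith
      · linarith
    -- One factor `√φ` is absorbed by `α`, through `√φ · α ≤ r/12`, and the other costs `κ³`; with
    -- `errZ ≤ Rκ²` this gives `κ⁵`, well below `κ⁸`.
    have b3 : 96 * c.phi μ * σ.α / (r ^ 2 * c.Lfx * ((K : ℝ) + 1)) * errZ f g S ≤
        8 * √c.phiBound * R / c.Lfx * (κ ^ 8 / (r * K)) := by
      have e1 : √(c.phi μ) ≤ κ ^ 3 * √c.phiBound := by
        rw [Real.sqrt_le_left (by positivity), mul_pow, Real.sq_sqrt hB0.le]
        exact hφB.trans_eq (by ring)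
      have e2 : √(c.phi μ) * σ.α ≤ r / 12 := by
        refine le_of_sq_le_sq ?_ (by positivity)
        rw [mul_pow, Real.sq_sqrt hφ.le]
        exact hsq.trans_eq (by ring)
      have e3 : c.phi μ * σ.α ≤ κ ^ 3 * √c.phiBound * (r / 12) := by
        calc c.phi μ * σ.α = √(c.phi μ) * (√(c.phi μ) * σ.α) := by
              rw [← mul_assoc, Real.mul_self_sqrt hφ.le]
          _ ≤ _ := by gcongr
      calc _ = 96 * (c.phi μ * σ.α) / (r ^ 2 * c.Lfx * ((K : ℝ) + 1)) * errZ f g S := by ring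
        _ ≤ 96 * (κ ^ 3 * √c.phiBound * (r / 12)) / (r ^ 2 * c.Lfx * K) * (R * κ ^ 2) := by
          have := errZ_nonneg (f := f) (g := g) S
          gcongr
          linarith
        _ = 8 * √c.phiBound * R / c.Lfx * (κ ^ 5 / (r * K)) := by
          field_simp
          norm_num
        _ ≤ _ := by
          gcongr
          norm_num
    have b4 : 192 * c.phi μ * σ.α ^ 2 / r ^ 2 * (c.b μ bf bg ^ 2 / m) ≤
        2 * c.Lfx * (T * w ^ 2) := by
      calc _ ≤ 192 * c.phi μ * w ^ 2 / r ^ 2 * (c.b μ bf bg ^ 2 / m) := by gcongr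
        _ = _ := by
          rw [hT]
          field_simp
          norm_num
    have hX0 : 0 ≤ κ ^ 8 / (r * K) := by positivity
    have c1 : 0 ≤ 8 * c.V0Bound * R / c.uBound + 8 * √c.phiBound * R / c.Lfx := by positivity
    have hk20 : 0 ≤ (2 + 2 * c.Lfx) * k₂ := by positivity
    calc _ ≤ (8 * c.V0Bound * R / c.uBound + 8 * √c.phiBound * R / c.Lfx) * (κ ^ 8 / (r * K))
          + (2 + 2 * c.Lfx) * (T * w ^ 2) := by
          have e : 8 * c.V0Bound * R / c.uBound = 2 * (4 * c.V0Bound * R / c.uBound) := by ring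
          rw [e]
          linarith
      _ ≤ (8 * c.V0Bound * R / c.uBound + 8 * √c.phiBound * R / c.Lfx) * (κ ^ 8 / (r * K))
          + (2 + 2 * c.Lfx) * (k₂ * Y) := by gcongr
      -- Nonnegative cross terms are added so that a single constant factors out of both rates.
      _ ≤ (8 * c.V0Bound * R / c.uBound + 8 * √c.phiBound * R / c.Lfx) * (κ ^ 8 / (r * K))
          + (2 + 2 * c.Lfx) * (k₂ * Y)
          + ((8 * c.V0Bound * R / c.uBound + 8 * √c.phiBound * R / c.Lfx) * Y
            + (2 + 2 * c.Lfx) * k₂ * (κ ^ 8 / (r * K))) :=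
          le_add_of_nonneg_right (by positivity)
      _ = c.rateConst R * (κ ^ 8 / (r * K) + Y) := by
          rw [Consts.rateConst, ← hk2]
          ring

end MainBound

end LoPA

/-! ### The main theorem -/

theorem mainTheorem6 (c : Consts) (hc : c.Pos) :
    ∃ cγ > (0 : ℝ), ∃ cl > (0 : ℝ), ∃ cβ > (0 : ℝ), ∃ τ₀ > (0 : ℝ),
    ∀ R > (0 : ℝ), ∃ C > (0 : ℝ),
    ∀ (μ : ℝ) (_ : 0 < μ) (m n p : ℕ) (_ : 1 ≤ p)
      (G : SimpleGraph (Fin m)) (W : Matrix (Fin m) (Fin m) ℝ) (_ : Network G W)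
      (f g : Fin m → E n → E p → ℝ)
      (_ : ∀ i, OuterAssumption c (f i) (g i)) (_ : ∀ i, InnerAssumption c μ (g i))
      (bf bg : ℝ) (_ : 0 < bf) (_ : 0 < bg) (_ : Heterogeneity bf bg f g)
      (ℓ : ℝ) (_ : ∀ x, ℓ ≤ Phi f g x)
      (S₀ : State m n p) (_ : Init R (c.kappa μ) f g ℓ S₀)
      (K : ℕ) (_ : 1 ≤ K)
      (τ : ℝ) (_ : τ = τ₀ / c.kappa μ ^ 4)
      (σ : Steps) (_ : σ = c.steps μ (rho W) τ cγ cl cβ bf bg f g ℓ S₀ K),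
      τ < 1 ∧ σ.γ < 1 ∧ Differentiable ℝ (Phi f g) ∧
      (1 / ((K : ℝ) + 1)) * ∑ k ∈ Finset.range (K + 1),
          ‖gradient (Phi f g) (avg (run W f g σ S₀ k).x)‖ ^ 2
        ≤ C * (c.kappa μ ^ 8 / ((1 - rho W) * K)
            + c.kappa μ ^ (16 / 3 : ℝ) * (c.b μ bf bg / √(m : ℝ)) ^ (2 / 3 : ℝ)
              / ((1 - rho W) ^ (2 / 3 : ℝ) * (K : ℝ) ^ (2 / 3 : ℝ))) := by
  have ha : 0 < c.Lfx / c.Lgt := div_pos hc.Lfx hc.Lgt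
  refine ⟨c.Lfx, hc.Lfx, c.Lfx / c.Lgt, ha, c.Lfx / c.Lgt, ha, c.tau0, hc.tau0', fun R hR =>
    ⟨c.rateConst R, hc.rateConst' hR, ?_⟩⟩
  intro μ hμ m n p hp G W hW f g hf hg bf bg hbf _ hh ℓ hℓ S₀ hS K hK τ hτ σ hσ
  have hμL : μ ≤ c.Lgt := (hg ⟨0, hW.pos⟩).modulus_le hp 0
  obtain ⟨κ, hκ⟩ : ∃ κ, c.kappa μ = κ := ⟨_, rfl⟩
  have hκ1 : 1 ≤ κ := by
    rw [← hκ]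
    exact (one_le_div hμ).2 (hμL.trans c.Lgt_le_maxL)
  -- From here on `κ` replaces `μ` as the parameter, so that every constant depends on `c` alone
  -- apart from explicit powers of `κ`.
  have hμκ : μ = c.maxL / κ := by
    have : κ = c.maxL / μ := hκ.symm
    rw [this, div_div_cancel₀ hc.maxL.ne']
  rw [hκ] at hS hτ ⊢
  clear hκ
  subst hμκ hτ hσ
  have hτB := hc.tauBounds hκ1
  refine ⟨hτB.le_half.trans_lt (by norm_num), ?_,
    fun x => (hasGradientAt_Phi hμ hc hf hg x).differentiableAt,
    mean_gradient_le_rate hc hR hκ1 hμL hW hf hg hbf hh hℓ hS hK⟩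
  have hu := hc.uBound_le_u hκ1 hμL hW.rho_lt_one (rho_nonneg W) hτB
  set u := c.u (c.maxL / κ) (rho W) (c.tau0 / κ ^ 4) with hudef
  have hu0 : 0 ≤ u := by
    have := hc.uBound'
    have := sub_pos.2 hW.rho_lt_one
    have : 0 < κ := by linarith
    exact le_trans (by positivity) hu
  -- As `γ = L_{f,x}α` and `α ≤ u`, the bound `L_{f,x}u ≤ 1/12` gives `γ < 1`, even when `α = 0`.
  have h1 := Lfx_mul_le hc hμ hW.rho_lt_one (rho_nonneg W) hu0 le_rfl
  have h2 : c.alpha (c.maxL / κ) (rho W) (c.tau0 / κ ^ 4) c.Lfx (c.Lfx / c.Lgt) (c.Lfx / c.Lgt)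
      bf bg f g ℓ S₀ K ≤ u := min_le_left _ _
  calc _ ≤ c.Lfx * u := mul_le_mul_of_nonneg_left h2 hc.Lfx.le
    _ < 1 := by linarith
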